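/- **Setting.** Let $d\ge 1$ and let $\Omega\subset\mathbb R^{d}$ be a bounded open set with piecewise smooth boundary: $\partial\Omega$ is a $C^1$ hypersurface with $\Omega$ on one side, except on a singular set (edges, corners) of finite $(d-2)$-dimensional Hausdorff measure (finite if $d=2$, empty if $d=1$). Let $\widehat{\mathbf n}$ be the outward unit normal and $\mathrm d\Gamma$ the surface measure. For each pore-network $i\in\{1,2\}$ let $\partial\Omega=\Gamma_i^v\cup\Gamma_i^p$ with $\Gamma_i^v,\Gamma_i^p$ disjoint and measurable. Let $\mu>0$ (viscosity), $\gamma$ (true density) and $\beta$ be real constants, let the porosities $\phi_i$ be continuous on $\overline\Omega$, and let the permeabilities $\mathbf K_i(\mathbf x)$ be measurable, symmetric and uniformly positive definite on $\Omega$. Put $\rho_i=\phi_i\gamma$ and $\alpha_i=\mu\phi_i^2\mathbf K_i^{-1}$. A *solution* of the double porosity/permeability model for the data set $(\mathbf b,v_{n1},p_{01},v_{n2},p_{02})$, with $\mathbf b\in L^2(\Omega)^d$, is a quadruple $(\mathbf v_1,p_1,\mathbf v_2,p_2)$ with $$\alpha_i\mathbf v_i+\phi_i\,\mathrm{grad}\,p_i=\rho_i\mathbf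 b,\qquad \mathrm{div}[\phi_1\mathbf v_1]=\chi,\qquad \mathrm{div}[\phi_2\mathbf v_2]=-\chi,\qquad \chi=-\tfrac{\beta}{\mu}(p_1-p_2)\qquad\text{in }\Omega,$$ $$\mathbf v_i\cdot\widehat{\mathbf n}=v_{ni}\ \text{ a.e. on }\Gamma_i^v,\qquad p_i=p_{0i}\ \text{ a.e. on }\Gamma_i^p\qquad(i=1,2),$$ where $p_i$ and $\phi_i\mathbf v_i$ are differentiable in $\Omega$; $p_i$ and $\mathbf v_i$ are continuous on $\overline\Omega\setminus N_i$ for some closed $N_i\subset\partial\Omega$ of finite $(d-2)$-dimensional Hausdorff measure (empty if $d=1$); $p_i$ is bounded in $\Omega$; $\mathbf v_i\in L^2(\Omega)^d$; and $\phi_i\mathbf v_i\cdot\widehat{\mathbf n}$ is integrable over $\partial\Omega$. **Theorem (Reciprocal relation).** Let $(\mathbf v_1',p_1',\mathbf v_2',p_2')$ and $(\mathbf v_1^*,p_1^*,\mathbf v_2^*,p_2^*)$ be solutions for the data sets $(\mathbf b',v_{n1}',p_{01}',v_{n2}',p_{02}')$ and $(\mathbf b^*,v_{n1}^*,p_{01}^*,v_{n2}^*,p_{02}^*)$,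 with the same $\Omega$, $\Gamma_i^v$, $\Gamma_i^p$ and the same material parameters. Then all integrals below converge absolutely, and $$\sum_{i=1}^{2}\Big(\int_\Omega\phi_i\gamma\,\mathbf b'\cdot\mathbf v_i^*\,\mathrm d\Omega-\int_{\Gamma_i^p}\phi_i\,p_{0i}'\,\mathbf v_i^*\cdot\widehat{\mathbf n}\,\mathrm d\Gamma-\int_{\Gamma_i^v}\phi_i\,p_i'\,v_{ni}^*\,\mathrm d\Gamma\Big)$$ $$=\sum_{i=1}^{2}\Big(\int_\Omega\phi_i\gamma\,\mathbf b^*\cdot\mathbf v_i'\,\mathrm d\Omega-\int_{\Gamma_i^p}\phi_i\,p_{0i}^*\,\mathbf v_i'\cdot\widehat{\mathbf n}\,\mathrm d\Gamma-\int_{\Gamma_i^v}\phi_i\,p_i^*\,v_{ni}'\,\mathrm d\Gamma\Big).$$ Moreover, each of the two sides is equal to $$\int_\Omega\alpha_1\mathbf v_1'\cdot\mathbf v_1^*\,\mathrm d\Omega+\int_\Omega\alpha_2\mathbf v_2'\cdot\mathbf v_2^*\,\mathrm d\Omega+\int_\Omega\frac{\beta}{\mu}(p_1'-p_2')(p_1^*-p_2^*)\,\mathrm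 d\Omega .$$ -/

import Mathlib

open MeasureTheory Set Filter Topology
open scoped RealInnerProductSpace

namespace DoublePorosity

/-- The ambient space `ℝ^d` with its Euclidean norm. -/
abbrev Space (d : ℕ) := EuclideanSpace ℝ (Fin d)

/-! ### Domains with piecewise smooth boundary -/

/-- `ν` is the outward unit normal of the open set `Ω` at the boundary point `x`: near `x`, the set
`Ω` is the sublevel set `{ρ < 0}` of a function `ρ` which is `C¹` near `x`, vanishes at `x` and has
there the gradient `ν`, a vector of length one. (Any `C¹` defining function with nonvanishing
gradient can be rescaled in this way.) In particular `x` lies on the boundary of `Ω`, this boundary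
is a `C¹` hypersurface near `x`, and `Ω` lies on one side of it. -/
def IsOutwardUnitNormal {d : ℕ} (Ω : Set (Space d)) (x ν : Space d) : Prop :=
  ‖ν‖ = 1 ∧ ∃ ρ : Space d → ℝ, ContDiffAt ℝ 1 ρ x ∧ ρ x = 0 ∧ HasGradientAt ρ ν x ∧
    ∀ᶠ y in 𝓝 x, y ∈ Ω ↔ ρ y < 0

/-- The singular part of the boundary (edges, corners, ...): the boundary points near which the
boundary is not a `C¹` hypersurface with `Ω` on one side. It is a closed set. -/
def singularBoundary {d : ℕ} (Ω : Set (Space d)) : Set (Space d) :=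
  {x ∈ frontier Ω | ¬ ∃ ν, IsOutwardUnitNormal Ω x ν}

/-- `Ω` has piecewise smooth boundary: the boundary is a `C¹` hypersurface, with `Ω` on one side,
away from a singular set of finite `(d-2)`-dimensional Hausdorff measure. In the plane the singular
set is finite, in space it has finite length, and on the line it is empty, because
`μH[-1]` of a nonempty set is infinite. -/
def HasPiecewiseSmoothBoundary {d : ℕ} (Ω : Set (Space d)) : Prop :=
  μH[(d : ℝ) - 2] (singularBoundary Ω) < ⊤

theorem hasDerivAt_comp_line {d : ℕ} {x ν w : Space d} {ρ : Space d → ℝ} (h : HasGradientAt ρ ν x) :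
   HasDerivAt (fun t : ℝ => ρ (x + t • w)) ⟪ν, w⟫ 0 := by
  have := h.hasFDerivAt
  have h2 : HasDerivAt (fun t : ℝ => x + t • w) w 0 := by
    simpa using ((hasDerivAt_id (0:ℝ)).smul_const w).const_add x
  have h3 : HasFDerivAt ρ (InnerProductSpace.toDual ℝ _ ν) (x + (0:ℝ) • w) := by simpa using this
  have h4 := h3.comp_hasDerivAt (0:ℝ) h2
  rw [InnerProductSpace.toDual_apply_apply] at h4
  exact h4

/-- The outward unit normal is unique, so `outwardNormal` is well defined. -/
theorem IsOutwardUnitNormal.unique {d : ℕ} {Ω : Set (Space d)} {x ν ν' : Space d} (h : IsOutwardUnitNormal Ω x ν)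
    (h' : IsOutwardUnitNormal Ω x ν') : ν = ν' := by
  obtain ⟨hn, ρ, -, h0, hg, he⟩ := h
  obtain ⟨hn', ρ', -, h0', hg', he'⟩ := h'
  have key : ∀ w, ⟪ν, w⟫ < 0 → ⟪ν', w⟫ ≤ 0 := by
    intro w hw
    by_contra! hc
    have tend : Tendsto (fun t : ℝ => x + t • w) (𝓝[>] 0) (𝓝 x) := by
      have : Continuous (fun t : ℝ => x + t • w) := by fun_prop
      have := this.tendsto 0
      simp at this
      exact this.mono_left nhdsWithin_le_nhds
    have e1 : ∀ᶠ t in 𝓝[>] (0:ℝ), ρ (x + t • w) < 0 := by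
      have := (hasDerivAt_comp_line (w := w) hg).tendsto_slope.mono_left (nhdsWithin_mono 0 (fun t (ht : 0 < t) => ht.ne'))
      filter_upwards [this.eventually_lt_const hw, self_mem_nhdsWithin] with t ht ht0
      simp [slope_def_field, h0] at ht
      have : (0:ℝ) < t := ht0
      by_contra! hh; exact absurd ht (not_lt.2 (by positivity))
    have e2 : ∀ᶠ t in 𝓝[>] (0:ℝ), 0 < ρ' (x + t • w) := by
      have := (hasDerivAt_comp_line (w := w) hg').tendsto_slope.mono_left (nhdsWithin_mono 0 (fun t (ht : 0 < t) => ht.ne'))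
      filter_upwards [this.eventually_const_lt hc, self_mem_nhdsWithin] with t ht ht0
      simp [slope_def_field, h0'] at ht
      have ht0 : (0:ℝ) < t := ht0
      exact (div_pos_iff_of_pos_right ht0).1 ht
    obtain ⟨t, a, b, c, d⟩ := (e1.and (e2.and ((tend.eventually he).and (tend.eventually he')))).exists
    have := d.1 (c.2 a); linarith
  have := key (ν' - ν)
  have k2 := key (ν' - 2 • ν)
  have i1 : ⟪ν, ν⟫ = 1 := by simp [hn]
  have i2 : ⟪ν', ν'⟫ = 1 := by simp [hn']
  have i3 : ⟪ν', ν⟫ = ⟪ν, ν'⟫ := real_inner_comm _ _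
  have cs : ⟪ν, ν'⟫ ≤ 1 := by simpa [hn, hn'] using real_inner_le_norm ν ν'
  simp only [inner_sub_right, i1, i2, i3] at this
  rcases cs.lt_or_eq with h | h
  · have := this (by linarith); linarith
  · exact (inner_eq_one_iff_of_norm_eq_one hn hn').1 h

open Classical in
/-- The outward unit normal field on the boundary (zero at points without outward normal). -/
noncomputable def outwardNormal {d : ℕ} (Ω : Set (Space d)) (x : Space d) : Space d :=
  if h : ∃ ν, IsOutwardUnitNormal Ω x ν then h.choose else 0

/-- The divergence `∑ᵢ ∂ᵢ Fᵢ` of a vector field. -/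
noncomputable def divergence {d : ℕ} (F : Space d → Space d) (x : Space d) : ℝ :=
  ∑ i : Fin d, (fderiv ℝ F x (EuclideanSpace.single i 1)) i

/-- The surface integral of `f` over a subset `Γ` of the boundary. The measure `μHE[d - 1]` is the
`(d-1)`-dimensional Hausdorff measure, normalised so that it is surface area. -/
noncomputable def surfaceIntegral {d : ℕ} (Γ : Set (Space d)) (f : Space d → ℝ) : ℝ :=
  ∫ x in Γ, f x ∂(μHE[d - 1] : Measure (Space d))

/-! ### The porous medium, the data and the fields -/

/-- The material parameters: viscosity `μ`, true density `γ` of the fluid, mass transfer coefficient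
`β`, and the porosity (volume fraction) `φᵢ` and the permeability tensor `Kᵢ` of the macro-pore
network (`i = 1`) and of the micro-pore network (`i = 2`). -/
structure Medium (d : ℕ) where
  μ : ℝ
  γ : ℝ
  β : ℝ
  φ₁ : Space d → ℝ
  φ₂ : Space d → ℝ
  K₁ : Space d → Matrix (Fin d) (Fin d) ℝ
  K₂ : Space d → Matrix (Fin d) (Fin d) ℝ

/-- A permeability field on `Ω`: measurable, symmetric, and uniformly positive definite. It may be
anisotropic and spatially inhomogeneous. -/
structure IsPermeability {d : ℕ} (Ω : Set (Space d))
    (K : Space d → Matrix (Fin d) (Fin d) ℝ) : Prop where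
  measurable : ∀ i j, AEMeasurable (fun x => K x i j) (volume.restrict Ω)
  symm : ∀ x ∈ Ω, (K x).IsSymm
  elliptic : ∃ k : ℝ, 0 < k ∧ ∀ x ∈ Ω, ∀ ξ : Space d,
    k * ‖ξ‖ ^ 2 ≤ ⟪ξ, Matrix.toEuclideanCLM (𝕜 := ℝ) (K x) ξ⟫

/-- The standing assumptions on the material parameters. -/
structure Medium.IsAdmissible {d : ℕ} (m : Medium d) (Ω : Set (Space d)) : Prop where
  viscosity_pos : 0 < m.μ
  porosity₁ : ContinuousOn m.φ₁ (closure Ω)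
  porosity₂ : ContinuousOn m.φ₂ (closure Ω)
  permeability₁ : IsPermeability Ω m.K₁
  permeability₂ : IsPermeability Ω m.K₂

/-- The bulk density `ρ₁ = φ₁ γ` of the macro-pore network. -/
def Medium.ρ₁ {d : ℕ} (m : Medium d) (x : Space d) : ℝ := m.φ₁ x * m.γ

/-- The bulk density `ρ₂ = φ₂ γ` of the micro-pore network. -/
def Medium.ρ₂ {d : ℕ} (m : Medium d) (x : Space d) : ℝ := m.φ₂ x * m.γ

/-- The drag tensor `α₁ = μ φ₁² K₁⁻¹` of the macro-pore network, as a linear map on `ℝ^d`. -/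
noncomputable def Medium.α₁ {d : ℕ} (m : Medium d) (x : Space d) : Space d →L[ℝ] Space d :=
  Matrix.toEuclideanCLM (𝕜 := ℝ) ((m.μ * m.φ₁ x ^ 2) • (m.K₁ x)⁻¹)

/-- The drag tensor `α₂ = μ φ₂² K₂⁻¹` of the micro-pore network. -/
noncomputable def Medium.α₂ {d : ℕ} (m : Medium d) (x : Space d) : Space d →L[ℝ] Space d :=
  Matrix.toEuclideanCLM (𝕜 := ℝ) ((m.μ * m.φ₂ x ^ 2) • (m.K₂ x)⁻¹)

/-- For each network, a decomposition of the boundary of `Ω` into a part `Γvᵢ` on which the normal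
velocity is prescribed and a part `Γpᵢ` on which the pressure is prescribed. -/
structure BoundaryPartition {d : ℕ} (Ω : Set (Space d)) where
  Γv₁ : Set (Space d)
  Γp₁ : Set (Space d)
  Γv₂ : Set (Space d)
  Γp₂ : Set (Space d)
  union₁ : Γv₁ ∪ Γp₁ = frontier Ω
  inter₁ : Γv₁ ∩ Γp₁ = ∅
  union₂ : Γv₂ ∪ Γp₂ = frontier Ω
  inter₂ : Γv₂ ∩ Γp₂ = ∅
  measurable_v₁ : MeasurableSet Γv₁
  measurable_p₁ : MeasurableSet Γp₁
  measurable_v₂ : MeasurableSet Γv₂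
  measurable_p₂ : MeasurableSet Γp₂

/-- A data set: specific body force, prescribed normal velocities and prescribed boundary
pressures. -/
structure DataSet (d : ℕ) where
  b : Space d → Space d
  vn₁ : Space d → ℝ
  p₀₁ : Space d → ℝ
  vn₂ : Space d → ℝ
  p₀₂ : Space d → ℝ

/-- The unknown fields: true velocity and pressure in each network. -/
structure Fields (d : ℕ) where
  v₁ : Space d → Space d
  p₁ : Space d → ℝ
  v₂ : Space d → Space d
  p₂ : Space d → ℝ

/-- The mass transfer `χ = -(β/μ) (p₁ - p₂)`. -/
noncomputable def massTransfer {d : ℕ} (m : Medium d) (s : Fields d) (x : Space d) : ℝ :=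
  -(m.β / m.μ) * (s.p₁ x - s.p₂ x)

/-- Regularity of the velocity `v` and the pressure `p` of a classical solution in a network of
porosity `φ`. The pressure and the discharge velocity `φ v` are differentiable in `Ω`; pressure and
velocity are continuous up to the boundary except at a small closed set `N` of boundary points
(corners, and the interface between the two parts of the boundary, where solutions of mixed problems
have singularities); the pressure is bounded, the velocity square integrable, and the normal flux
integrable over the boundary. -/
structure IsRegular {d : ℕ} (Ω : Set (Space d)) (φ : Space d → ℝ) (v : Space d → Space d)
    (p : Space d → ℝ) : Prop where
  differentiable_pressure : DifferentiableOn ℝ p Ω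
  differentiable_discharge : DifferentiableOn ℝ (fun x => φ x • v x) Ω
  continuous_closure : ∃ N ⊆ frontier Ω, IsClosed N ∧ μH[(d : ℝ) - 2] N < ⊤ ∧
    ContinuousOn p (closure Ω \ N) ∧ ContinuousOn v (closure Ω \ N)
  bounded_pressure : ∃ C : ℝ, ∀ x ∈ Ω, |p x| ≤ C
  memLp_velocity : MemLp v 2 (volume.restrict Ω)
  integrable_flux : IntegrableOn (fun x => φ x * ⟪v x, outwardNormal Ω x⟫) (frontier Ω)
    (μHE[d - 1] : Measure (Space d))

/-- `s` is a solution of the double porosity/permeability model on `Ω` for the data set `D`.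
The field equations hold at every point of `Ω`, the boundary conditions at almost every point of the
respective part of the boundary with respect to surface measure. -/
structure IsSolution {d : ℕ} (Ω : Set (Space d)) (P : BoundaryPartition Ω) (m : Medium d)
    (D : DataSet d) (s : Fields d) : Prop where
  memLp_force : MemLp D.b 2 (volume.restrict Ω)
  regular₁ : IsRegular Ω m.φ₁ s.v₁ s.p₁
  regular₂ : IsRegular Ω m.φ₂ s.v₂ s.p₂
  momentum₁ : ∀ x ∈ Ω, m.α₁ x (s.v₁ x) + m.φ₁ x • gradient s.p₁ x = m.ρ₁ x • D.b x
  momentum₂ : ∀ x ∈ Ω, m.α₂ x (s.v₂ x) + m.φ₂ x • gradient s.p₂ x = m.ρ₂ x • D.b x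
  mass₁ : ∀ x ∈ Ω, divergence (fun y => m.φ₁ y • s.v₁ y) x = massTransfer m s x
  mass₂ : ∀ x ∈ Ω, divergence (fun y => m.φ₂ y • s.v₂ y) x = -massTransfer m s x
  velocity_bc₁ : ∀ᵐ x ∂(μHE[d - 1] : Measure (Space d)).restrict P.Γv₁,
    ⟪s.v₁ x, outwardNormal Ω x⟫ = D.vn₁ x
  velocity_bc₂ : ∀ᵐ x ∂(μHE[d - 1] : Measure (Space d)).restrict P.Γv₂,
    ⟪s.v₂ x, outwardNormal Ω x⟫ = D.vn₂ x
  pressure_bc₁ : ∀ᵐ x ∂(μHE[d - 1] : Measure (Space d)).restrict P.Γp₁, s.p₁ x = D.p₀₁ x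
  pressure_bc₂ : ∀ᵐ x ∂(μHE[d - 1] : Measure (Space d)).restrict P.Γp₂, s.p₂ x = D.p₀₂ x

/-! ### The two sides of the reciprocal relation -/

/-- The work of the data set `D` (with solution `s`) against the data set `D'` with solution `s'`:
the sum over both networks of
`∫_Ω φᵢ γ b · vᵢ' - ∫_{Γpᵢ} φᵢ p₀ᵢ vᵢ' · n - ∫_{Γvᵢ} φᵢ pᵢ vnᵢ'`. -/
noncomputable def reciprocalWork {d : ℕ} (Ω : Set (Space d)) (P : BoundaryPartition Ω)
    (m : Medium d) (D : DataSet d) (s : Fields d) (D' : DataSet d) (s' : Fields d) : ℝ :=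
  (∫ x in Ω, m.φ₁ x * m.γ * ⟪D.b x, s'.v₁ x⟫)
    - surfaceIntegral P.Γp₁ (fun x => m.φ₁ x * D.p₀₁ x * ⟪s'.v₁ x, outwardNormal Ω x⟫)
    - surfaceIntegral P.Γv₁ (fun x => m.φ₁ x * s.p₁ x * D'.vn₁ x)
    + (∫ x in Ω, m.φ₂ x * m.γ * ⟪D.b x, s'.v₂ x⟫)
    - surfaceIntegral P.Γp₂ (fun x => m.φ₂ x * D.p₀₂ x * ⟪s'.v₂ x, outwardNormal Ω x⟫)
    - surfaceIntegral P.Γv₂ (fun x => m.φ₂ x * s.p₂ x * D'.vn₂ x)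

/-- All six integrals in `reciprocalWork` converge absolutely. -/
structure ReciprocalWorkConverges {d : ℕ} (Ω : Set (Space d)) (P : BoundaryPartition Ω)
    (m : Medium d) (D : DataSet d) (s : Fields d) (D' : DataSet d) (s' : Fields d) : Prop where
  force₁ : IntegrableOn (fun x => m.φ₁ x * m.γ * ⟪D.b x, s'.v₁ x⟫) Ω
  pressure₁ : IntegrableOn (fun x => m.φ₁ x * D.p₀₁ x * ⟪s'.v₁ x, outwardNormal Ω x⟫) P.Γp₁
    (μHE[d - 1] : Measure (Space d))
  velocity₁ : IntegrableOn (fun x => m.φ₁ x * s.p₁ x * D'.vn₁ x) P.Γv₁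
    (μHE[d - 1] : Measure (Space d))
  force₂ : IntegrableOn (fun x => m.φ₂ x * m.γ * ⟪D.b x, s'.v₂ x⟫) Ω
  pressure₂ : IntegrableOn (fun x => m.φ₂ x * D.p₀₂ x * ⟪s'.v₂ x, outwardNormal Ω x⟫) P.Γp₂
    (μHE[d - 1] : Measure (Space d))
  velocity₂ : IntegrableOn (fun x => m.φ₂ x * s.p₂ x * D'.vn₂ x) P.Γv₂
    (μHE[d - 1] : Measure (Space d))

/-- The symmetric bilinear form
`∫_Ω α₁ v₁ · v₁' + ∫_Ω α₂ v₂ · v₂' + ∫_Ω (β/μ) (p₁ - p₂) (p₁' - p₂')`. -/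
noncomputable def dissipationForm {d : ℕ} (Ω : Set (Space d)) (m : Medium d)
    (s s' : Fields d) : ℝ :=
  (∫ x in Ω, ⟪m.α₁ x (s.v₁ x), s'.v₁ x⟫) + (∫ x in Ω, ⟪m.α₂ x (s.v₂ x), s'.v₂ x⟫)
    + ∫ x in Ω, m.β / m.μ * (s.p₁ x - s.p₂ x) * (s'.p₁ x - s'.p₂ x)

/-- The three integrals in `dissipationForm` converge absolutely. -/
structure DissipationFormConverges {d : ℕ} (Ω : Set (Space d)) (m : Medium d)
    (s s' : Fields d) : Prop where
  drag₁ : IntegrableOn (fun x => ⟪m.α₁ x (s.v₁ x), s'.v₁ x⟫) Ω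
  drag₂ : IntegrableOn (fun x => ⟪m.α₂ x (s.v₂ x), s'.v₂ x⟫) Ω
  transfer : IntegrableOn (fun x => m.β / m.μ * (s.p₁ x - s.p₂ x) * (s'.p₁ x - s'.p₂ x)) Ω

end DoublePorosity

open MeasureTheory Set Filter Topology
open scoped RealInnerProductSpace

namespace DoublePorosity

/-! In each network, test the momentum balance of one state with the velocity of the other. The
product rule and the mass balance give `div (p φ v') = p χ' + φ γ b · v' - α v · v'`. Integrating
over `Ω` and splitting the flux of `p φ v'` by the boundary conditions turns the work of one state
against the other into `∫ α v · v' - ∫ p χ'` (`network_identity`, `boundary_splitting`). The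
transfer terms have opposite signs in the two networks, so they add up to `∫ (β/μ) (p₁ - p₂) (p₁' -
p₂')`. The resulting form is symmetric because the drag tensors are, and reciprocity follows.

The substance is a divergence theorem for fields that are merely differentiable in `Ω`, square
integrable, and singular at a set `Z` of finite `(d-2)`-dimensional Hausdorff measure
(`integral_divergence_eq_flux`).

Away from `Z`, near a regular boundary point with normal `ν`, let `ρ` be a defining function whose
gradient is `δ`-close to `ν`. Multiplying the field by a function of `-ρ/s` that vanishes near the
boundary gives a compactly supported field, whose divergence has integral zero. As `s → 0`, the
gradient of the cutoff concentrates on the boundary, and its `ν`-component has mass exactly one on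
each line parallel to `ν`. So `∫ div H` is the flux of `H` through the projection of the boundary
onto the tangent plane, up to `O(δ) ∫ ‖H‖`. Since the boundary is a graph with Lipschitz constant
`2δ`, replacing projected volume by surface measure and `ν` by the true normal costs another `O(δ) ∫
‖H‖` (`IsGraphChart.flux_estimate`). With a partition of unity the errors sum to at most `ε ∫ ‖G‖`
with `ε` arbitrary, so the identity is exact.

To reach `Z`, cover it by balls with `∑ rₙ^(d-2)` bounded. A bump on a ball of radius `r` has
Dirichlet energy of order `r^(d-2)`, so there are cutoffs `η` of bounded energy that vanish near `Z`
and equal `1` off small neighbourhoods of it (`exists_cutoff`). The error `∫ ∇η · F` is at most a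
constant times the `L²` norm of `F` on these neighbourhoods, and that norm tends to zero. -/

/-! ### Calculus of gradient and divergence; fields of compact support -/

theorem inner_gradient_eq_fderiv {d : ℕ} (f : Space d → ℝ) (x w : Space d) :
    ⟪gradient f x, w⟫ = fderiv ℝ f x w := by
  simp [gradient, InnerProductSpace.toDual_symm_apply]

theorem divergence_smul {d : ℕ} {f : Space d → ℝ} {F : Space d → Space d} {x : Space d}
    (hf : DifferentiableAt ℝ f x) (hF : DifferentiableAt ℝ F x) :
    divergence (fun y => f y • F y) x = f x * divergence F x + ⟪gradient f x, F x⟫ := by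
  have h := (hf.hasFDerivAt.smul hF.hasFDerivAt).fderiv
  have h' : fderiv ℝ (fun y => f y • F y) x =
      f x • fderiv ℝ F x + (fderiv ℝ f x).smulRight (F x) := h
  unfold divergence
  rw [h', inner_gradient_eq_fderiv]
  conv_rhs => rw [← (EuclideanSpace.basisFun (Fin d) ℝ).sum_repr (F x)]
  simp [Finset.sum_add_distrib, Finset.mul_sum, mul_comm]

theorem divergence_congr {d : ℕ} {F G : Space d → Space d} {x : Space d} (h : F =ᶠ[𝓝 x] G) :
    divergence F x = divergence G x := by
  simp [divergence, h.fderiv_eq]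

theorem divergence_of_notMem_tsupport {d : ℕ} {F : Space d → Space d} {x : Space d}
    (h : x ∉ tsupport F) : divergence F x = 0 := by
  rw [divergence_congr (notMem_tsupport_iff_eventuallyEq.1 h)]
  simp [divergence]

theorem measurable_divergence {d : ℕ} (F : Space d → Space d) : Measurable (divergence F) := by
  unfold divergence
  refine Finset.measurable_sum _ fun i _ => ?_
  have : Measurable fun x => fderiv ℝ F x (EuclideanSpace.single i 1) :=
    measurable_fderiv_apply_const ℝ F _
  fun_prop

theorem measurable_gradient {d : ℕ} (f : Space d → ℝ) : Measurable (gradient f) := by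
  unfold gradient
  exact (InnerProductSpace.toDual ℝ (Space d)).symm.continuous.measurable.comp
    (measurable_fderiv ℝ f)

/-- The divergence theorem on a cube strictly containing the support: every face integral vanishes.
Only pointwise differentiability and integrability of the divergence are required, not continuity of
the derivative; this suffices for solutions that are only differentiable. -/
theorem integral_divergence_eq_zero {k : ℕ} {F : Space (k + 1) → Space (k + 1)}
    (hF : Differentiable ℝ F) (hc : HasCompactSupport F) (hi : Integrable (divergence F)) :
    ∫ x, divergence F x = 0 := by
  obtain ⟨R, hR⟩ := hc.isBounded.exists_norm_le
  have hR' : ∀ x : Space (k+1), ∀ i, R < |x i| → F x = 0 := by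
    intro x i hx
    by_contra hne
    have h1 := hR x (subset_tsupport _ hne)
    have h2 := PiLp.norm_apply_le x i
    rw [Real.norm_eq_abs] at h2
    linarith
  set e := EuclideanSpace.equiv (Fin (k+1)) ℝ with he
  set T : ℝ := |R| + 1
  have hT : R < T := by have := le_abs_self R; linarith
  have hT0 : 0 ≤ T := by positivity
  let f : (Fin (k+1) → ℝ) → (Fin (k+1) → ℝ) := fun x => e (F (e.symm x))
  let f' : (Fin (k+1) → ℝ) → (Fin (k+1) → ℝ) →L[ℝ] (Fin (k+1) → ℝ) :=
    fun x => (e : Space (k+1) →L[ℝ] _) ∘L fderiv ℝ F (e.symm x) ∘L (e.symm : _ →L[ℝ] Space (k+1))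
  have hfd : ∀ x, HasFDerivAt f (f' x) x := fun x =>
    e.hasFDerivAt.comp x ((hF _).hasFDerivAt.comp x e.symm.hasFDerivAt)
  have hdiv : ∀ x, ∑ i, f' x (Pi.single i 1) i = divergence F (e.symm x) := by
    intro x
    simp only [f', divergence]
    refine Finset.sum_congr rfl fun i _ => ?_
    simp [e, EuclideanSpace.equiv]
  have hmp : MeasurePreserving (e.symm : (Fin (k+1) → ℝ) → Space (k+1)) volume volume :=
    PiLp.volume_preserving_toLp (Fin (k+1))
  have hemb : MeasurableEmbedding (e.symm : (Fin (k+1) → ℝ) → Space (k+1)) :=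
    e.symm.toHomeomorph.measurableEmbedding
  have key := integral_divergence_of_hasFDerivAt_off_countable (E := ℝ) (fun _ => -T) (fun _ => T)
    (fun _ => by linarith) f f' ∅ countable_empty
    (fun x _ => (hfd x).continuousAt.continuousWithinAt) (fun x _ => hfd x) (by
      simp only [hdiv]
      exact ((hmp.integrable_comp_emb hemb).2 hi).integrableOn)
  have hz : ∀ (x : Fin (k+1) → ℝ) i, R < |x i| → f x = 0 := fun x i hx => by
    simp [f, hR' (e.symm x) i hx]
  have hrhs : ∀ i : Fin (k+1), ((∫ x in Icc ((fun _ => -T) ∘ i.succAbove) ((fun _ => T) ∘ i.succAbove),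
      f (i.insertNth T x) i) - ∫ x in Icc ((fun _ => -T) ∘ i.succAbove) ((fun _ => T) ∘ i.succAbove),
      f (i.insertNth (-T) x) i) = 0 := by
    intro i
    have a1 : ∀ x : Fin k → ℝ, f (i.insertNth T x) = 0 := fun x => hz _ i (by
      simpa [abs_of_nonneg hT0] using hT)
    have a2 : ∀ x : Fin k → ℝ, f (i.insertNth (-T) x) = 0 := fun x => hz _ i (by
      simpa [abs_of_nonneg hT0] using hT)
    simp [a1, a2]
  rw [Finset.sum_eq_zero fun i _ => hrhs i] at key
  rw [← hmp.integral_comp hemb, ← setIntegral_eq_integral_of_forall_compl_eq_zero (s := Icc (fun _ => -T) (fun _ => T))]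
  · simpa only [hdiv] using key
  · intro x hx
    apply divergence_of_notMem_tsupport
    intro hmem
    apply hx
    have h1 := hR _ hmem
    have h3 : ∀ i, |x i| ≤ T := fun i => by
      have h2 := PiLp.norm_apply_le (e.symm x) i
      rw [Real.norm_eq_abs] at h2
      exact (h2.trans h1).trans hT.le
    exact ⟨fun i => (abs_le.1 (h3 i)).1, fun i => (abs_le.1 (h3 i)).2⟩

/-! ### Nearly flat pieces of the boundary -/

theorem continuousAt_gradient {d : ℕ} {f : Space d → ℝ} {x : Space d} (h : ContDiffAt ℝ 1 f x) :
    ContinuousAt (gradient f) x := by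
  have h1 : ContinuousAt (fderiv ℝ f) x :=
    (h.fderiv_right (m := 0) (by norm_num)).continuousAt
  exact (InnerProductSpace.toDual ℝ (Space d)).symm.continuous.continuousAt.comp h1

/-- `ρ` is a `C¹` defining function of `Ω` in the ball of radius `r` about its zero `x₀`, which is
there `δ`-close, together with its gradient, to the linear function with gradient `ν`. -/
structure IsNearlyFlat {d : ℕ} (Ω : Set (Space d)) (x₀ ν : Space d) (δ r : ℝ)
    (ρ : Space d → ℝ) : Prop where
  norm_eq : ‖ν‖ = 1
  r_pos : 0 < r
  δ_pos : 0 < δ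
  δ_le : δ ≤ 1 / 4
  zero : ρ x₀ = 0
  contDiffAt : ∀ x ∈ Metric.ball x₀ r, ContDiffAt ℝ 1 ρ x
  gradient_close : ∀ x ∈ Metric.ball x₀ r, ‖gradient ρ x - ν‖ ≤ δ
  approx : ∀ x ∈ Metric.ball x₀ r, ∀ y ∈ Metric.ball x₀ r,
    |ρ x - ρ y - ⟪ν, x - y⟫| ≤ δ * ‖x - y‖
  mem_iff : ∀ x ∈ Metric.ball x₀ r, x ∈ Ω ↔ ρ x < 0

/-- A `C¹` function is strictly differentiable and has a continuous gradient, so on a small ball it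
is as close to its linearisation as desired. -/
theorem IsOutwardUnitNormal.exists_isNearlyFlat {d : ℕ} {Ω : Set (Space d)} {x₀ ν : Space d}
    (h : IsOutwardUnitNormal Ω x₀ ν) {δ : ℝ} (hδ : 0 < δ) (hδ' : δ ≤ 1 / 4) :
    ∃ ρ r, IsNearlyFlat Ω x₀ ν δ r ρ := by
  obtain ⟨hn, ρ, hC, h0, hg, hm⟩ := h
  have hs : HasStrictFDerivAt ρ (InnerProductSpace.toDual ℝ _ ν) x₀ := by
    have := hC.hasStrictFDerivAt (by norm_num)
    rwa [hg.hasFDerivAt.fderiv] at this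
  obtain ⟨s, hs1, hs2⟩ := hs.approximates_deriv_on_nhds (c := ⟨δ, hδ.le⟩) (Or.inr hδ)
  have e1 : ∀ᶠ x in 𝓝 x₀, ContDiffAt ℝ 1 ρ x := hC.eventually (by norm_num)
  have e2 : ∀ᶠ x in 𝓝 x₀, ‖gradient ρ x - ν‖ ≤ δ := by
    have := (continuousAt_gradient hC).sub (continuousAt_const (y := ν)) |>.norm
    have h3 : ‖gradient ρ x₀ - ν‖ < δ := by simpa [hg.gradient] using hδ
    filter_upwards [this.eventually_lt_const h3] with x hx using hx.le
  obtain ⟨r, hr, hb⟩ := Metric.mem_nhds_iff.1 (inter_mem hs1 (e1.and (e2.and hm)))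
  refine ⟨ρ, r, hn, hr, hδ, hδ', h0, fun x hx => (hb hx).2.1, fun x hx => (hb hx).2.2.1, ?_,
    fun x hx => (hb hx).2.2.2⟩
  intro x hx y hy
  have := hs2 x (hb hx).1 y (hb hy).1
  simp only [InnerProductSpace.toDual_apply_apply, Real.norm_eq_abs] at this
  exact this

theorem IsNearlyFlat.one_sub_le_norm_gradient {d : ℕ} {Ω : Set (Space d)} {x₀ ν : Space d} {δ r : ℝ}
    {ρ : Space d → ℝ} (h : IsNearlyFlat Ω x₀ ν δ r ρ) {x : Space d} (hx : x ∈ Metric.ball x₀ r) :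
    1 - δ ≤ ‖gradient ρ x‖ := by
  have h1 := h.gradient_close x hx
  have h2 : ‖ν‖ ≤ ‖gradient ρ x‖ + ‖gradient ρ x - ν‖ := by
    have := norm_sub_le (gradient ρ x) (gradient ρ x - ν)
    simpa using this
  rw [h.norm_eq] at h2
  linarith

theorem IsNearlyFlat.eq_zero_of_mem_frontier {d : ℕ} {Ω : Set (Space d)} (hΩ : IsOpen Ω)
    {x₀ ν : Space d} {δ r : ℝ}
    {ρ : Space d → ℝ} (h : IsNearlyFlat Ω x₀ ν δ r ρ) {x : Space d} (hx : x ∈ Metric.ball x₀ r)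
    (hf : x ∈ frontier Ω) : ρ x = 0 := by
  have h1 : x ∉ Ω := by
    rw [hΩ.frontier_eq] at hf; exact hf.2
  rw [h.mem_iff x hx, not_lt] at h1
  refine le_antisymm ?_ h1
  by_contra! hc
  have := ((h.contDiffAt x hx).continuousAt.eventually_const_lt hc).and
    (Metric.isOpen_ball.mem_nhds hx)
  obtain ⟨y, ⟨hy1, hy2⟩, hy3⟩ := mem_closure_iff_nhds.1 (frontier_subset_closure hf) _ this
  have := (h.mem_iff y hy2).1 hy3
  linarith

theorem outwardNormal_eq {d : ℕ} {Ω : Set (Space d)} {x ν : Space d}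
    (h : IsOutwardUnitNormal Ω x ν) : outwardNormal Ω x = ν := by
  have h' : ∃ ν, IsOutwardUnitNormal Ω x ν := ⟨ν, h⟩
  rw [outwardNormal, dif_pos h']
  exact h'.choose_spec.unique h

theorem isOutwardUnitNormal_of_defining {d : ℕ} {Ω : Set (Space d)} {x : Space d}
    {ρ : Space d → ℝ} (hC : ContDiffAt ℝ 1 ρ x) (h0 : ρ x = 0) (hg : gradient ρ x ≠ 0)
    (hm : ∀ᶠ y in 𝓝 x, y ∈ Ω ↔ ρ y < 0) :
    IsOutwardUnitNormal Ω x (‖gradient ρ x‖⁻¹ • gradient ρ x) := by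
  have hpos : 0 < ‖gradient ρ x‖⁻¹ := inv_pos.2 (norm_pos_iff.2 hg)
  refine ⟨by simp [norm_smul, hg], fun y => ‖gradient ρ x‖⁻¹ * ρ y, contDiffAt_const.mul hC,
    by simp [h0], ?_, ?_⟩
  · have := (hC.differentiableAt (by norm_num)).hasGradientAt
    have h2 := this.hasFDerivAt.const_mul ‖gradient ρ x‖⁻¹
    rw [hasGradientAt_iff_hasFDerivAt]
    have e : InnerProductSpace.toDual ℝ (Space d) (‖gradient ρ x‖⁻¹ • gradient ρ x)
        = ‖gradient ρ x‖⁻¹ • InnerProductSpace.toDual ℝ (Space d) (gradient ρ x) := by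
      ext w
      simp
    rw [e]
    exact h2
  · filter_upwards [hm] with y hy
    rw [hy, mul_neg_iff]
    constructor
    · intro h; exact Or.inl ⟨hpos, h⟩
    · rintro (h | h)
      · exact h.2
      · linarith [h.1]

theorem IsNearlyFlat.isOutwardUnitNormal {d : ℕ} {Ω : Set (Space d)} (hΩ : IsOpen Ω)
    {x₀ ν : Space d} {δ r : ℝ}
    {ρ : Space d → ℝ} (h : IsNearlyFlat Ω x₀ ν δ r ρ) {x : Space d} (hx : x ∈ Metric.ball x₀ r)
    (hf : x ∈ frontier Ω) :
    IsOutwardUnitNormal Ω x (‖gradient ρ x‖⁻¹ • gradient ρ x) := by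
  have h1 := h.one_sub_le_norm_gradient hx
  have h2 := h.δ_le
  refine isOutwardUnitNormal_of_defining (h.contDiffAt x hx) (h.eq_zero_of_mem_frontier hΩ hx hf)
    (norm_pos_iff.1 (by linarith)) ?_
  filter_upwards [Metric.isOpen_ball.mem_nhds hx] with y hy using h.mem_iff y hy

/-- Regularity is an open condition along the boundary: the defining function at a regular point,
after rescaling, also serves at nearby boundary points. -/
theorem isClosed_singularBoundary {d : ℕ} {Ω : Set (Space d)} (hΩ : IsOpen Ω) :
    IsClosed (singularBoundary Ω) := by
  rw [← isOpen_compl_iff, isOpen_iff_mem_nhds]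
  intro x hx
  by_cases hf : x ∈ frontier Ω
  · have : ∃ ν, IsOutwardUnitNormal Ω x ν := by
      by_contra hc
      exact hx ⟨hf, hc⟩
    obtain ⟨ν, hν⟩ := this
    obtain ⟨ρ, r, h⟩ := hν.exists_isNearlyFlat (δ := 1 / 4) (by norm_num) le_rfl
    filter_upwards [Metric.ball_mem_nhds x h.r_pos] with y hy hy'
    exact hy'.2 ⟨_, h.isOutwardUnitNormal hΩ hy hy'.1⟩
  · filter_upwards [isClosed_frontier.isOpen_compl.mem_nhds hf] with y hy hy' using hy hy'.1

theorem IsNearlyFlat.continuousOn_outwardNormal {d : ℕ} {Ω : Set (Space d)} (hΩ : IsOpen Ω)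
    {x₀ ν : Space d} {δ r : ℝ}
    {ρ : Space d → ℝ} (h : IsNearlyFlat Ω x₀ ν δ r ρ) :
    ContinuousOn (outwardNormal Ω) (Metric.ball x₀ r ∩ frontier Ω) := by
  have : ContinuousOn (fun x => ‖gradient ρ x‖⁻¹ • gradient ρ x)
      (Metric.ball x₀ r ∩ frontier Ω) := by
    intro x hx
    have h1 := continuousAt_gradient (h.contDiffAt x hx.1)
    have h2 := h.one_sub_le_norm_gradient hx.1
    have h3 := h.δ_le
    exact ((h1.norm.inv₀ (by linarith)).smul h1).continuousWithinAt
  exact this.congr fun x hx => outwardNormal_eq (h.isOutwardUnitNormal hΩ hx.1 hx.2)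

/-- One `δ` comes from `gradient ρ x - ν`, the other from normalising the gradient, whose length
differs from `1` by at most `δ`. -/
theorem IsNearlyFlat.norm_outwardNormal_sub_le {d : ℕ} {Ω : Set (Space d)} (hΩ : IsOpen Ω)
    {x₀ ν : Space d} {δ r : ℝ}
    {ρ : Space d → ℝ} (h : IsNearlyFlat Ω x₀ ν δ r ρ) {x : Space d} (hx : x ∈ Metric.ball x₀ r)
    (hf : x ∈ frontier Ω) : ‖outwardNormal Ω x - ν‖ ≤ 2 * δ := by
  rw [outwardNormal_eq (h.isOutwardUnitNormal hΩ hx hf)]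
  have h1 := h.gradient_close x hx
  have h2 := h.one_sub_le_norm_gradient hx
  have h3 := h.δ_le
  have h4 : 0 < ‖gradient ρ x‖ := by linarith
  have h5 : ‖‖gradient ρ x‖⁻¹ • gradient ρ x - gradient ρ x‖ ≤ δ := by
    have : ‖gradient ρ x‖⁻¹ • gradient ρ x - gradient ρ x
        = (‖gradient ρ x‖⁻¹ - 1) • gradient ρ x := by rw [sub_smul, one_smul]
    rw [this, norm_smul, Real.norm_eq_abs, ← abs_of_pos h4, ← abs_mul, abs_of_pos h4, sub_mul,
      inv_mul_cancel₀ h4.ne', one_mul, abs_le]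
    have h6 : ‖gradient ρ x‖ ≤ ‖ν‖ + ‖gradient ρ x - ν‖ := by
      have := norm_add_le ν (gradient ρ x - ν)
      simpa using this
    rw [h.norm_eq] at h6
    constructor <;> linarith
  calc _ = ‖(‖gradient ρ x‖⁻¹ • gradient ρ x - gradient ρ x) + (gradient ρ x - ν)‖ := by
        congr 1; abel
    _ ≤ _ := (norm_add_le _ _).trans (by linarith)

/-! ### Coordinates along the normal; the boundary as a Lipschitz graph -/

/-- Complete `ν` to an orthonormal basis with `ν` in position `0`; the remaining basis vectors span
the tangent plane, and `z.2` is the height along `ν`. -/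
theorem exists_orthogonal_coordinates {k : ℕ} {ν : Space (k + 1)} (hν : ‖ν‖ = 1) :
    ∃ ι : Space k →ₗᵢ[ℝ] Space (k + 1), (∀ y, ⟪ν, ι y⟫ = 0) ∧
      MeasurePreserving (fun z : Space k × ℝ => ι z.1 + z.2 • ν) (volume.prod volume) volume ∧
      ∀ x, ∃ z : Space k × ℝ, ι z.1 + z.2 • ν = x := by
  obtain ⟨b, hb⟩ := Orthonormal.exists_orthonormalBasis_extension_of_card_eq (𝕜 := ℝ)
    (E := Space (k + 1)) (ι := Fin (k + 1)) (by simp) (v := fun _ => ν) (s := {0}) (by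
      rw [orthonormal_iff_ite]
      rintro ⟨i, hi⟩ ⟨j, hj⟩
      simp only [mem_singleton_iff] at hi hj
      subst hi; subst hj
      simp [hν])
  have hb0 : b 0 = ν := hb 0 rfl
  let j : Space k →ₗ[ℝ] Space (k + 1) :=
    { toFun := fun y => WithLp.toLp 2 (Fin.cons 0 (fun i => y i) : Fin (k + 1) → ℝ)
      map_add' := fun x y => by ext i; refine Fin.cases ?_ (fun i => ?_) i <;> simp
      map_smul' := fun c y => by ext i; refine Fin.cases ?_ (fun i => ?_) i <;> simp }
  have hj : ∀ y, ‖j y‖ = ‖y‖ := fun y => by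
    simp [j, EuclideanSpace.norm_eq, Fin.sum_univ_succ]
  let ι : Space k →ₗᵢ[ℝ] Space (k + 1) := b.repr.symm.toLinearIsometry.comp ⟨j, hj⟩
  have hι : ∀ z : Space k × ℝ, ι z.1 + z.2 • ν
      = b.repr.symm (WithLp.toLp 2 (Fin.cons z.2 (fun i => z.1 i) : Fin (k + 1) → ℝ)) := by
    intro z
    apply b.repr.injective
    rw [← hb0]
    ext i
    refine Fin.cases ?_ (fun i => ?_) i <;> simp [ι, j]
  refine ⟨ι, fun y => ?_, ?_, fun x => ?_⟩
  · have h1 : ν = b.repr.symm (EuclideanSpace.single 0 1) := by simp [hb0]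
    have h2 : ι y = b.repr.symm (j y) := rfl
    rw [h1, h2, LinearIsometryEquiv.inner_map_map]
    simp [j, EuclideanSpace.inner_single_left]
  · simp_rw [hι]
    have m1 : MeasurePreserving (fun z : Space k × ℝ => (z.2, (fun i => z.1 i : Fin k → ℝ)))
        (volume.prod volume) (volume.prod volume) :=
      ((MeasurePreserving.id (volume : Measure ℝ)).prod (PiLp.volume_preserving_ofLp
        (Fin k))).comp (Measure.measurePreserving_swap)
    have m2 := (volume_preserving_piFinSuccAbove (fun _ : Fin (k + 1) => ℝ) 0).symm
    have m3 := PiLp.volume_preserving_toLp (Fin (k + 1))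
    have m4 := b.measurePreserving_repr_symm.comp (m3.comp (m2.comp m1))
    convert m4 using 1
    ext1 z
    simp only [Function.comp, MeasurableEquiv.piFinSuccAbove_symm_apply, Fin.insertNthEquiv,
      Equiv.coe_fn_mk, Fin.insertNth_zero']
  · refine ⟨(WithLp.toLp 2 fun i => b.repr x i.succ, b.repr x 0), ?_⟩
    rw [hι, LinearIsometryEquiv.symm_apply_eq]
    ext i
    refine Fin.cases ?_ (fun i => ?_) i <;> simp

section Coordinates

variable {k : ℕ} {ν : Space (k + 1)} {ι : Space k →ₗᵢ[ℝ] Space (k + 1)}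

theorem norm_sq_coordinates (hν : ‖ν‖ = 1) (hι : ∀ y, ⟪ν, ι y⟫ = 0) (y : Space k) (t : ℝ) :
    ‖ι y + t • ν‖ ^ 2 = ‖y‖ ^ 2 + t ^ 2 := by
  rw [norm_add_sq_real, inner_smul_right, real_inner_comm, hι, norm_smul, hν, ι.norm_map]
  simp

theorem norm_le_norm_coordinates (hν : ‖ν‖ = 1) (hι : ∀ y, ⟪ν, ι y⟫ = 0) (y : Space k) (t : ℝ) :
    ‖y‖ ≤ ‖ι y + t • ν‖ :=
  le_of_sq_le_sq (by rw [norm_sq_coordinates hν hι]; nlinarith [sq_nonneg t]) (norm_nonneg _)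

theorem abs_le_norm_coordinates (hν : ‖ν‖ = 1) (hι : ∀ y, ⟪ν, ι y⟫ = 0) (y : Space k) (t : ℝ) :
    |t| ≤ ‖ι y + t • ν‖ :=
  abs_le_of_sq_le_sq (by rw [norm_sq_coordinates hν hι]; nlinarith [sq_nonneg ‖y‖]) (norm_nonneg _)

theorem norm_coordinates_le (hν : ‖ν‖ = 1) (y : Space k) (t : ℝ) :
    ‖ι y + t • ν‖ ≤ ‖y‖ + |t| := by
  refine (norm_add_le _ _).trans ?_
  rw [norm_smul, hν, ι.norm_map, mul_one, Real.norm_eq_abs]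

theorem inner_coordinates (hν : ‖ν‖ = 1) (hι : ∀ y, ⟪ν, ι y⟫ = 0) (y : Space k) (t : ℝ) :
    ⟪ν, ι y + t • ν⟫ = t := by
  rw [inner_add_right, hι, inner_smul_right, real_inner_self_eq_norm_sq, hν]; ring

theorem coordinates_sub (x₀ : Space (k + 1)) (y y' : Space k) (t t' : ℝ) :
    x₀ + (ι y + t • ν) - (x₀ + (ι y' + t' • ν)) = ι (y - y') + (t - t') • ν := by
  rw [map_sub, sub_smul]; abel

variable {Ω : Set (Space (k + 1))} {x₀ : Space (k + 1)} {δ r : ℝ} {ρ : Space (k + 1) → ℝ}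

theorem IsNearlyFlat.mem_ball (h : IsNearlyFlat Ω x₀ ν δ r ρ) {y : Space k} {t : ℝ}
    (hy : ‖y‖ < r / 4) (ht : |t| ≤ r / 2) : x₀ + (ι y + t • ν) ∈ Metric.ball x₀ r := by
  rw [mem_ball_iff_norm, add_sub_cancel_left]
  have := norm_coordinates_le (ι := ι) h.norm_eq y t
  have := h.r_pos
  linarith

theorem IsNearlyFlat.abs_sub_le (h : IsNearlyFlat Ω x₀ ν δ r ρ) (hι : ∀ y, ⟪ν, ι y⟫ = 0)
    {y y' : Space k} {t t' : ℝ} (hy : ‖y‖ < r / 4) (ht : |t| ≤ r / 2) (hy' : ‖y'‖ < r / 4)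
    (ht' : |t'| ≤ r / 2) :
    |ρ (x₀ + (ι y + t • ν)) - ρ (x₀ + (ι y' + t' • ν)) - (t - t')| ≤
      δ * (‖y - y'‖ + |t - t'|) := by
  have := h.approx _ (h.mem_ball (ι := ι) hy ht) _ (h.mem_ball (ι := ι) hy' ht')
  rw [coordinates_sub, inner_coordinates h.norm_eq hι] at this
  exact this.trans (mul_le_mul_of_nonneg_left (norm_coordinates_le h.norm_eq _ _) h.δ_pos.le)

/-- On a line parallel to `ν` the function `ρ` grows with slope between `1 - δ` and `1 + δ`, so it
has a zero by the intermediate value theorem. Comparing two zeros gives `(1 - δ) |g y - g y'| ≤ δ ‖y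
- y'‖`, hence the Lipschitz constant `2 δ`. The function is then extended from the ball to the whole
plane. -/
theorem IsNearlyFlat.exists_graph (h : IsNearlyFlat Ω x₀ ν δ r ρ) (hι : ∀ y, ⟪ν, ι y⟫ = 0) :
    ∃ g : Space k → ℝ, LipschitzWith (2 * δ).toNNReal g ∧ ∀ y, ‖y‖ < r / 4 →
      |g y| < r / 4 ∧ ρ (x₀ + (ι y + g y • ν)) = 0 := by
  have hr := h.r_pos
  have hδ := h.δ_pos
  have hδ' := h.δ_le
  have ex : ∀ y : Space k, ‖y‖ < r / 4 → ∃ t, |t| ≤ r / 2 ∧ ρ (x₀ + (ι y + t • ν)) = 0 := by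
    intro y hy
    have hcont : ContinuousOn (fun t : ℝ => ρ (x₀ + (ι y + t • ν))) (Icc (-(r / 2)) (r / 2)) := by
      intro t ht
      have h1 := (h.contDiffAt _ (h.mem_ball (ι := ι) hy (abs_le.2 ht))).continuousAt
      have h2 : Continuous fun t : ℝ => x₀ + (ι y + t • ν) := by fun_prop
      exact (ContinuousAt.comp (f := fun t : ℝ => x₀ + (ι y + t • ν)) h1
        h2.continuousAt).continuousWithinAt
    have hz : (‖(0 : Space k)‖ < r / 4) := by simpa using hr
    have e1 := h.abs_sub_le hι hy (t := r / 2) (by rw [abs_of_pos (by linarith)]) hz (t' := 0)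
      (by rw [abs_zero]; linarith)
    have e2 := h.abs_sub_le hι hy (t := -(r / 2)) (by rw [abs_neg, abs_of_pos (by linarith)]) hz
      (t' := 0) (by rw [abs_zero]; linarith)
    simp only [map_zero, zero_smul, add_zero, h.zero, sub_zero, abs_neg,
      abs_of_pos (half_pos hr)] at e1 e2
    -- The deviation from linearity is below `r / 2`, so `ρ` has opposite signs at the two ends of
    -- the segment.
    have e3 : δ * (‖y‖ + r / 2) ≤ 3 * r / 16 := by nlinarith [norm_nonneg y]
    rw [abs_le] at e1 e2
    obtain ⟨t, ht, ht'⟩ := intermediate_value_Icc (by linarith : -(r / 2) ≤ r / 2) hcont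
      (show (0 : ℝ) ∈ Icc _ _ from ⟨by linarith [e2.2], by linarith [e1.1]⟩)
    exact ⟨t, abs_le.2 ht, ht'⟩
  choose! g hg1 hg2 using ex
  have lip : ∀ y y' : Space k, ‖y‖ < r / 4 → ‖y'‖ < r / 4 → |g y - g y'| ≤ 2 * δ * ‖y - y'‖ := by
    intro y y' hy hy'
    have := h.abs_sub_le hι hy (hg1 y hy) hy' (hg1 y' hy')
    rw [hg2 y hy, hg2 y' hy', sub_zero, zero_sub, abs_neg] at this
    nlinarith [norm_nonneg (y - y'), abs_nonneg (g y - g y')]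
  have lipOn : LipschitzOnWith (2 * δ).toNNReal g (Metric.ball 0 (r / 4)) := by
    refine LipschitzOnWith.of_dist_le_mul fun y hy y' hy' => ?_
    rw [Real.coe_toNNReal _ (by positivity), Real.dist_eq, dist_eq_norm]
    exact lip y y' (by simpa using hy) (by simpa using hy')
  obtain ⟨G, hG, hGe⟩ := lipOn.extend_real
  -- With `g 0 = 0` and Lipschitz constant at most `1 / 2`, the graph stays below height `r / 4`,
  -- which leaves room inside `|t| ≤ r / 2`.
  have g0 : g 0 = 0 := by
    have := h.abs_sub_le hι (y := 0) (by simpa using hr) (hg1 0 (by simpa using hr)) (y' := 0)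
      (t' := 0) (by simpa using hr) (by rw [abs_zero]; linarith)
    rw [hg2 0 (by simpa using hr)] at this
    simp [h.zero] at this
    by_contra hne
    nlinarith [abs_pos.2 hne]
  refine ⟨G, hG, fun y hy => ?_⟩
  have hye : g y = G y := hGe (by simpa using hy)
  rw [← hye]
  refine ⟨?_, hg2 y hy⟩
  have := lip y 0 hy (by simpa using hr)
  rw [g0, sub_zero, sub_zero] at this
  nlinarith [norm_nonneg y]

/-- The local representation of the boundary as the graph of `g`. -/
structure IsGraphChart (Ω : Set (Space (k + 1))) (x₀ ν : Space (k + 1)) (δ r : ℝ)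
    (ρ : Space (k + 1) → ℝ) (ι : Space k →ₗᵢ[ℝ] Space (k + 1)) (g : Space k → ℝ) : Prop extends
    IsNearlyFlat Ω x₀ ν δ r ρ where
  orth : ∀ y, ⟪ν, ι y⟫ = 0
  measurePreserving :
    MeasurePreserving (fun z : Space k × ℝ => ι z.1 + z.2 • ν) (volume.prod volume) volume
  surj : ∀ x, ∃ z : Space k × ℝ, ι z.1 + z.2 • ν = x
  lipschitz : LipschitzWith (2 * δ).toNNReal g
  graph : ∀ y, ‖y‖ < r / 4 → |g y| < r / 4 ∧ ρ (x₀ + (ι y + g y • ν)) = 0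

theorem IsOutwardUnitNormal.exists_isGraphChart
    (h : IsOutwardUnitNormal Ω x₀ ν) {δ : ℝ} (hδ : 0 < δ) (hδ' : δ ≤ 1 / 4) :
    ∃ r ρ ι g, IsGraphChart Ω x₀ ν δ r ρ ι g := by
  obtain ⟨ρ, r, hf⟩ := h.exists_isNearlyFlat hδ hδ'
  obtain ⟨ι, h1, h2, h3⟩ := exists_orthogonal_coordinates hf.norm_eq
  obtain ⟨g, h4, h5⟩ := hf.exists_graph h1
  exact ⟨r, ρ, ι, g, { hf with orth := h1, measurePreserving := h2, surj := h3, lipschitz := h4, graph := h5 }⟩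

namespace IsGraphChart

variable {g : Space k → ℝ} (h : IsGraphChart Ω x₀ ν δ r ρ ι g)
include h

/-- Compare with the graph point over the same `y`, where `ρ` vanishes: the level of `ρ` is the
height over the graph up to relative error `δ`. -/
theorem le_level {y : Space k} {t : ℝ} (hy : ‖y‖ < r / 4) (ht : |t| ≤ r / 2) :
    |ρ (x₀ + (ι y + t • ν)) - (t - g y)| ≤ δ * |t - g y| := by
  have h1 := h.graph y hy
  have := h.abs_sub_le h.orth hy ht hy (t' := g y) (by linarith [h.r_pos])
  simpa [h1.2] using this

theorem mem_frontier {y : Space k} (hΩ : IsOpen Ω) (hy : ‖y‖ < r / 4) :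
    x₀ + (ι y + g y • ν) ∈ frontier Ω := by
  obtain ⟨h1, h2⟩ := h.graph y hy
  have hr := h.r_pos
  have hδ := h.δ_le
  rw [hΩ.frontier_eq]
  constructor
  · have ht : Tendsto (fun s : ℝ => x₀ + (ι y + (g y - s) • ν)) (𝓝[>] 0)
        (𝓝 (x₀ + (ι y + g y • ν))) := by
      have : Continuous fun s : ℝ => x₀ + (ι y + (g y - s) • ν) := by fun_prop
      have := this.tendsto 0
      rw [sub_zero] at this
      exact this.mono_left nhdsWithin_le_nhds
    refine mem_closure_of_tendsto ht ?_
    filter_upwards [Ioo_mem_nhdsGT (show (0 : ℝ) < r / 4 by linarith)] with s hs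
    have hs' : |g y - s| ≤ r / 2 := by
      rw [abs_lt] at h1; rw [abs_le]; constructor <;> linarith [hs.1, hs.2]
    rw [h.mem_iff _ (h.mem_ball hy hs')]
    have := h.le_level hy hs'
    rw [sub_sub_cancel_left, abs_neg, abs_of_pos hs.1, abs_le] at this
    nlinarith [hs.1, this.2]
  · rw [h.mem_iff _ (h.mem_ball hy (by linarith)), h2]
    simp

theorem eq_graph_of_mem_frontier (hΩ : IsOpen Ω) {x : Space (k + 1)}
    (hx : x ∈ Metric.ball x₀ (r / 4)) (hf : x ∈ frontier Ω) :
    ∃ y, ‖y‖ < r / 4 ∧ x₀ + (ι y + g y • ν) = x := by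
  obtain ⟨⟨y, t⟩, hz⟩ := h.surj (x - x₀)
  simp only at hz
  have hx' : x = x₀ + (ι y + t • ν) := by rw [hz]; abel
  have hr := h.r_pos
  rw [mem_ball_iff_norm, ← hz] at hx
  have hy := (norm_le_norm_coordinates h.norm_eq h.orth y t).trans_lt hx
  have ht := (abs_le_norm_coordinates h.norm_eq h.orth y t).trans_lt hx
  refine ⟨y, hy, ?_⟩
  have hmem : x ∈ Metric.ball x₀ r := by rw [hx']; exact h.mem_ball hy (by linarith)
  have h0 := h.eq_zero_of_mem_frontier hΩ hmem hf
  have := h.le_level hy (show |t| ≤ r / 2 by linarith)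
  rw [← hx', h0, zero_sub, abs_neg] at this
  have h3 : t - g y = 0 := by
    by_contra hne
    nlinarith [abs_pos.2 hne, h.δ_le]
  rw [hx', show g y = t by linarith]

end IsGraphChart
end Coordinates

/-! ### The cutoff near the boundary and its layer density -/

/-- A smooth nondecreasing function, `0` on `(-∞, 1]` and `1` on `[2, ∞)`. -/
noncomputable def profile (v : ℝ) : ℝ := Real.smoothTransition (v - 1)

theorem contDiff_profile : ContDiff ℝ 1 profile :=
  Real.smoothTransition.contDiff.comp (contDiff_id.sub contDiff_const)

theorem profile_of_le {v : ℝ} (h : v ≤ 1) : profile v = 0 :=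
  Real.smoothTransition.zero_of_nonpos (by linarith)

theorem profile_of_ge {v : ℝ} (h : 2 ≤ v) : profile v = 1 :=
  Real.smoothTransition.one_of_one_le (by linarith)

theorem profile_nonneg (v : ℝ) : 0 ≤ profile v := Real.smoothTransition.nonneg _

theorem profile_le_one (v : ℝ) : profile v ≤ 1 := Real.smoothTransition.le_one _

theorem monotone_profile : Monotone profile := fun a b h => by
  exact Real.smoothTransition.monotone (by linarith)

theorem deriv_profile_nonneg (v : ℝ) : 0 ≤ deriv profile v := monotone_profile.deriv_nonneg

theorem deriv_profile_of_notMem {v : ℝ} (h : v ∉ Icc (1 : ℝ) 2) : deriv profile v = 0 := by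
  rw [mem_Icc, not_and_or, not_le, not_le] at h
  rcases h with h | h
  · have : profile =ᶠ[𝓝 v] fun _ => 0 := by
      filter_upwards [Iio_mem_nhds h] with w hw using profile_of_le (le_of_lt hw)
    rw [this.deriv_eq, deriv_const]
  · have : profile =ᶠ[𝓝 v] fun _ => 1 := by
      filter_upwards [Ioi_mem_nhds h] with w hw using profile_of_ge (le_of_lt hw)
    rw [this.deriv_eq, deriv_const]

theorem continuous_deriv_profile : Continuous (deriv profile) :=
  contDiff_profile.continuous_deriv le_rfl

theorem exists_deriv_profile_le : ∃ M, 0 ≤ M ∧ ∀ v, deriv profile v ≤ M := by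
  obtain ⟨M, hM⟩ := (isCompact_Icc (a := (1 : ℝ)) (b := 2)).exists_bound_of_continuousOn
    continuous_deriv_profile.continuousOn
  refine ⟨max M 0, le_max_right _ _, fun v => ?_⟩
  by_cases hv : v ∈ Icc (1 : ℝ) 2
  · exact (le_abs_self _).trans ((hM v hv).trans (le_max_left _ _))
  · rw [deriv_profile_of_notMem hv]; exact le_max_right _ _

section Layer

variable {k : ℕ} {ν : Space (k + 1)} {ι : Space k →ₗᵢ[ℝ] Space (k + 1)}
variable {Ω : Set (Space (k + 1))} {x₀ : Space (k + 1)} {δ r : ℝ} {ρ : Space (k + 1) → ℝ}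

/-- The density of the boundary layer `{-2 s ≤ ρ ≤ -s}`. -/
noncomputable def layer (ρ : Space (k + 1) → ℝ) (s : ℝ) (x : Space (k + 1)) : ℝ :=
  s⁻¹ * deriv profile (-ρ x / s)

theorem layer_nonneg {s : ℝ} (hs : 0 < s) (x : Space (k + 1)) : 0 ≤ layer ρ s x :=
  mul_nonneg (inv_nonneg.2 hs.le) (deriv_profile_nonneg _)

theorem exists_layer_le {s : ℝ} (hs : 0 < s) : ∃ M, 0 ≤ M ∧ ∀ x, layer ρ s x ≤ M := by
  obtain ⟨M, hM0, hM⟩ := exists_deriv_profile_le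
  exact ⟨s⁻¹ * M, by positivity, fun x => mul_le_mul_of_nonneg_left (hM _) (by positivity)⟩

theorem gradient_profile {x : Space (k + 1)} (hx : DifferentiableAt ℝ ρ x) (s : ℝ) :
    gradient (fun y => profile (-ρ y / s)) x = -layer ρ s x • gradient ρ x := by
  have h1 : HasDerivAt profile (deriv profile (-ρ x / s)) (-ρ x / s) :=
    ((contDiff_profile.differentiable (by norm_num)) _).hasDerivAt
  have h2 : HasFDerivAt (fun y => -ρ y / s) (s⁻¹ • (-fderiv ℝ ρ x)) x := by
    simp_rw [div_eq_inv_mul]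
    exact hx.hasFDerivAt.neg.const_mul s⁻¹
  have h3 := h1.comp_hasFDerivAt x h2
  refine ext_inner_right ℝ fun w => ?_
  rw [inner_gradient_eq_fderiv, inner_smul_left, inner_gradient_eq_fderiv]
  have h4 : fderiv ℝ (fun y => profile (-ρ y / s)) x = _ := h3.fderiv
  rw [h4]
  simp [layer]
  ring

namespace IsNearlyFlat

theorem continuousOn_layer (h : IsNearlyFlat Ω x₀ ν δ r ρ) (s : ℝ) :
    ContinuousOn (layer ρ s) (Metric.ball x₀ r) := by
  have : ContinuousOn ρ (Metric.ball x₀ r) := fun x hx =>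
    (h.contDiffAt x hx).continuousAt.continuousWithinAt
  exact continuousOn_const.mul
    (continuous_deriv_profile.comp_continuousOn (this.neg.div_const s))

theorem continuousOn_gradient (h : IsNearlyFlat Ω x₀ ν δ r ρ) :
    ContinuousOn (gradient ρ) (Metric.ball x₀ r) := fun x hx =>
  (continuousAt_gradient (h.contDiffAt x hx)).continuousWithinAt

theorem norm_gradient_le (h : IsNearlyFlat Ω x₀ ν δ r ρ) {x : Space (k + 1)}
    (hx : x ∈ Metric.ball x₀ r) : ‖gradient ρ x‖ ≤ 2 := by
  have h6 : ‖gradient ρ x‖ ≤ ‖ν‖ + ‖gradient ρ x - ν‖ := by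
    have := norm_add_le ν (gradient ρ x - ν)
    simpa using this
  rw [h.norm_eq] at h6
  linarith [h.gradient_close x hx, h.δ_le]

theorem half_le_inner_gradient (h : IsNearlyFlat Ω x₀ ν δ r ρ) {x : Space (k + 1)}
    (hx : x ∈ Metric.ball x₀ r) : 1 / 2 ≤ ⟪gradient ρ x, ν⟫ := by
  have h1 : ⟪gradient ρ x, ν⟫ = 1 + ⟪gradient ρ x - ν, ν⟫ := by
    rw [inner_sub_left, real_inner_self_eq_norm_sq, h.norm_eq]; ring
  have h2 := abs_real_inner_le_norm (gradient ρ x - ν) ν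
  rw [h.norm_eq, mul_one, abs_le] at h2
  linarith [h.gradient_close x hx, h.δ_le, h2.1]

end IsNearlyFlat

theorem exists_bound_inter_ball {E : Type*} [NormedAddCommGroup E] {f : Space (k + 1) → E}
    (hf : ContinuousOn f (closure Ω)) (x₀ : Space (k + 1)) (r : ℝ) :
    ∃ C, 0 ≤ C ∧ ∀ x ∈ Ω ∩ Metric.ball x₀ r, ‖f x‖ ≤ C := by
  obtain ⟨C, hC⟩ := ((isCompact_closedBall x₀ r).inter_left
    (isClosed_closure (s := Ω))).exists_bound_of_continuousOn (hf.mono inter_subset_left)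
  exact ⟨max C 0, le_max_right _ _, fun x hx =>
    (hC x ⟨subset_closure hx.1, Metric.ball_subset_closedBall hx.2⟩).trans (le_max_left _ _)⟩

theorem IsNearlyFlat.integrableOn_layer_mul (h : IsNearlyFlat Ω x₀ ν δ r ρ) (hΩ : IsOpen Ω)
    {s : ℝ} (hs : 0 < s) {f : Space (k + 1) → ℝ}
    (hf : ContinuousOn f (Ω ∩ Metric.ball x₀ r)) {C : ℝ}
    (hC : ∀ x ∈ Ω ∩ Metric.ball x₀ r, ‖f x‖ ≤ C) :
    IntegrableOn (fun x => layer ρ s x * f x) (Ω ∩ Metric.ball x₀ r) := by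
  obtain ⟨M, hM0, hM⟩ := exists_layer_le (ρ := ρ) hs
  have hmeas : MeasurableSet (Ω ∩ Metric.ball x₀ r) :=
    (hΩ.inter Metric.isOpen_ball).measurableSet
  have hfin : volume (Ω ∩ Metric.ball x₀ r) ≠ ⊤ :=
    ((measure_mono inter_subset_right).trans_lt measure_ball_lt_top).ne
  refine (integrableOn_const (C := M * C) hfin).mono'
    ((((h.continuousOn_layer s).mono inter_subset_right).mul hf).aestronglyMeasurable hmeas) ?_
  filter_upwards [ae_restrict_mem hmeas] with x hx
  rw [norm_mul, Real.norm_of_nonneg (layer_nonneg hs x)]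
  exact mul_le_mul (hM x) (hC x hx) (norm_nonneg _) hM0

namespace IsGraphChart

variable {g : Space k → ℝ} (h : IsGraphChart Ω x₀ ν δ r ρ ι g)
include h

theorem continuous_graph : Continuous fun y => x₀ + (ι y + g y • ν) :=
  continuous_const.add (ι.continuous.add (h.lipschitz.continuous.smul continuous_const))

/-- The integrand is the derivative of `-profile (-ρ / s)` along the line. The endpoints lie at
distance more than `r / 4` from the graph, so `ρ ≤ -3r/16` at the lower one; `16 s ≤ r` therefore
makes the profile equal to `1` there, and it is `0` at the upper one. -/
theorem integral_layer_line {y : Space k} (hy : ‖y‖ < r / 4) {s : ℝ} (hs : 0 < s)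
    (hsr : 16 * s ≤ r) :
    IntervalIntegrable (fun t => layer ρ s (x₀ + (ι y + t • ν)) *
      ⟪gradient ρ (x₀ + (ι y + t • ν)), ν⟫) volume (-(r / 2)) (r / 2) ∧
    ∫ t in (-(r / 2))..(r / 2), layer ρ s (x₀ + (ι y + t • ν)) *
      ⟪gradient ρ (x₀ + (ι y + t • ν)), ν⟫ = 1 := by
  have hr := h.r_pos
  have hle : -(r / 2) ≤ r / 2 := by linarith
  have hmem : ∀ t ∈ Icc (-(r / 2)) (r / 2), x₀ + (ι y + t • ν) ∈ Metric.ball x₀ r :=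
    fun t ht => h.mem_ball hy (abs_le.2 ht)
  have hc : Continuous fun t : ℝ => x₀ + (ι y + t • ν) := by fun_prop
  have hcont : ContinuousOn (fun t => layer ρ s (x₀ + (ι y + t • ν)) *
      ⟪gradient ρ (x₀ + (ι y + t • ν)), ν⟫) (Icc (-(r / 2)) (r / 2)) :=
    ((h.continuousOn_layer s).comp hc.continuousOn hmem).mul
      ((h.continuousOn_gradient.comp hc.continuousOn hmem).inner continuousOn_const)
  have hint : IntervalIntegrable (fun t => layer ρ s (x₀ + (ι y + t • ν)) *
      ⟪gradient ρ (x₀ + (ι y + t • ν)), ν⟫) volume (-(r / 2)) (r / 2) := by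
    apply ContinuousOn.intervalIntegrable
    rwa [uIcc_of_le hle]
  refine ⟨hint, ?_⟩
  have hd : ∀ t ∈ uIcc (-(r / 2)) (r / 2),
      HasDerivAt (fun t => -profile (-ρ (x₀ + (ι y + t • ν)) / s))
      (layer ρ s (x₀ + (ι y + t • ν)) * ⟪gradient ρ (x₀ + (ι y + t • ν)), ν⟫) t := by
    intro t ht
    rw [uIcc_of_le hle] at ht
    have hρ := (h.contDiffAt _ (hmem t ht)).differentiableAt (by norm_num)
    have h1 : HasDerivAt (fun t : ℝ => x₀ + (ι y + t • ν)) ν t := by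
      simpa using (((hasDerivAt_id t).smul_const ν).const_add (ι y)).const_add x₀
    have h2 := hρ.hasFDerivAt.comp_hasDerivAt t h1
    have h3 : HasDerivAt profile (deriv profile (-ρ (x₀ + (ι y + t • ν)) / s))
        (-ρ (x₀ + (ι y + t • ν)) / s) :=
      ((contDiff_profile.differentiable (by norm_num)) _).hasDerivAt
    have h4 := (h3.comp t (h2.neg.div_const s)).neg
    rw [inner_gradient_eq_fderiv]
    refine h4.congr_deriv ?_
    simp only [layer]
    ring
  rw [intervalIntegral.integral_eq_sub_of_hasDerivAt hd hint]
  have hg := (h.graph y hy).1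
  rw [abs_lt] at hg
  have hδ := h.δ_le
  have a1 := h.le_level hy (t := r / 2) (by rw [abs_of_pos (by linarith)])
  have a2 := h.le_level hy (t := -(r / 2)) (by rw [abs_neg, abs_of_pos (by linarith)])
  rw [abs_of_pos (show 0 < r / 2 - g y by linarith), abs_le] at a1
  rw [abs_of_neg (show -(r / 2) - g y < 0 by linarith), abs_le] at a2
  rw [profile_of_le (v := -ρ (x₀ + (ι y + (r / 2) • ν)) / s), profile_of_ge]
  · ring
  · rw [le_div_iff₀ hs]; nlinarith [a2.2]
  · rw [div_le_iff₀ hs]; nlinarith [a1.1]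

/-- The layer lives on `-2s ≤ ρ ≤ -s`, and the slope of `ρ` is at least `3/4`, so its depth below
the graph is at most `8s/3`. -/
theorem of_layer_ne_zero {y : Space k} (hy : ‖y‖ < r / 4) {s : ℝ} (hs : 0 < s) {t : ℝ}
    (ht : |t| ≤ r / 2) (hne : layer ρ s (x₀ + (ι y + t • ν)) ≠ 0) :
    x₀ + (ι y + t • ν) ∈ Ω ∧ |t - g y| ≤ 4 * s := by
  have hv : -ρ (x₀ + (ι y + t • ν)) / s ∈ Icc (1 : ℝ) 2 := by
    by_contra hc
    exact hne (by rw [layer, deriv_profile_of_notMem hc, mul_zero])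
  rw [mem_Icc, le_div_iff₀ hs, div_le_iff₀ hs] at hv
  refine ⟨(h.mem_iff _ (h.mem_ball hy ht)).2 (by linarith [hv.1]), ?_⟩
  have h1 := h.le_level hy ht
  have h2 : |t - g y| ≤ |ρ (x₀ + (ι y + t • ν))| + δ * |t - g y| := by
    have := abs_sub_abs_le_abs_sub (t - g y) (ρ (x₀ + (ι y + t • ν)))
    rw [abs_sub_comm (t - g y)] at this
    linarith
  have h3 : |ρ (x₀ + (ι y + t • ν))| ≤ 2 * s := by
    rw [abs_le]; constructor <;> linarith [hv.1, hv.2]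
  nlinarith [h.δ_le, abs_nonneg (t - g y)]

end IsGraphChart
end Layer

theorem differentiableAt_profile_comp {d : ℕ} {ρ : Space d → ℝ} {x : Space d}
    (h : DifferentiableAt ℝ ρ x) (s : ℝ) :
    DifferentiableAt ℝ (fun y => profile (-ρ y / s)) x := by
  have h1 : DifferentiableAt ℝ (fun y => -ρ y / s) x := by
    simp_rw [div_eq_inv_mul]
    exact h.neg.const_mul _
  exact DifferentiableAt.comp (g := profile) (f := fun y => -ρ y / s) x
    ((contDiff_profile.differentiable (by norm_num)) _) h1

namespace IsGraphChart

variable {k : ℕ} {ν : Space (k + 1)} {ι : Space k →ₗᵢ[ℝ] Space (k + 1)}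
variable {Ω : Set (Space (k + 1))} {x₀ : Space (k + 1)} {δ r : ℝ} {ρ : Space (k + 1) → ℝ}
variable {g : Space k → ℝ} (h : IsGraphChart Ω x₀ ν δ r ρ ι g)
include h

/-- The integral is an average of `f` against a nonnegative weight of mass one concentrated near the
graph, so it differs from `c` by at most the deviation of `f` from `c` there. -/
theorem abs_integral_line_sub_le {y : Space k} (hy : ‖y‖ < r / 4) {s : ℝ} (hs : 0 < s)
    (hsr : 16 * s ≤ r) {f : Space (k + 1) → ℝ} (hsupp : ∀ x ∉ Metric.ball x₀ (r / 4), f x = 0)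
    {c ω : ℝ} (hω : ∀ t, |t| ≤ r / 2 → x₀ + (ι y + t • ν) ∈ Ω → |t - g y| ≤ 4 * s →
      |f (x₀ + (ι y + t • ν)) - c| ≤ ω)
    (hi : Integrable fun t : ℝ => (Ω ∩ Metric.ball x₀ r).indicator (fun x => layer ρ s x *
      (⟪gradient ρ x, ν⟫ * f x)) (x₀ + (ι y + t • ν))) :
    |(∫ t : ℝ, (Ω ∩ Metric.ball x₀ r).indicator (fun x => layer ρ s x *
      (⟪gradient ρ x, ν⟫ * f x)) (x₀ + (ι y + t • ν))) - c| ≤ ω := by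
  have hr := h.r_pos
  have hle : -(r / 2) ≤ r / 2 := by linarith
  obtain ⟨hw, hw1⟩ := h.integral_layer_line hy hs hsr
  set w : ℝ → ℝ := fun t => layer ρ s (x₀ + (ι y + t • ν)) *
      ⟪gradient ρ (x₀ + (ι y + t • ν)), ν⟫ with hwdef
  set u : ℝ → ℝ := fun t => (Ω ∩ Metric.ball x₀ r).indicator (fun x => layer ρ s x *
      (⟪gradient ρ x, ν⟫ * f x)) (x₀ + (ι y + t • ν)) with hudef
  have hout : ∀ t, t ∉ Ioc (-(r / 2)) (r / 2) → u t = 0 := by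
    intro t ht
    have h1 : f (x₀ + (ι y + t • ν)) = 0 := by
      apply hsupp
      rw [mem_ball_iff_norm, add_sub_cancel_left, not_lt]
      refine le_trans ?_ (abs_le_norm_coordinates h.norm_eq h.orth y t)
      by_contra! hc
      rw [abs_lt] at hc
      exact ht ⟨by linarith [hc.1], by linarith [hc.2]⟩
    simp only [hudef]
    by_cases hm : x₀ + (ι y + t • ν) ∈ Ω ∩ Metric.ball x₀ r
    · rw [indicator_of_mem hm, h1]; ring
    · rw [indicator_of_notMem hm]
  have hu : ∫ t, u t = ∫ t in (-(r / 2))..(r / 2), u t := by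
    rw [intervalIntegral.integral_of_le hle,
      setIntegral_eq_integral_of_forall_compl_eq_zero hout]
  have hc : c = ∫ t in (-(r / 2))..(r / 2), w t * c := by
    rw [intervalIntegral.integral_mul_const, hw1, one_mul]
  rw [hu]
  conv_lhs => rw [hc]
  rw [← intervalIntegral.integral_sub hi.intervalIntegrable (hw.mul_const c), ← Real.norm_eq_abs]
  have hω' : ω = ∫ t in (-(r / 2))..(r / 2), w t * ω := by
    rw [intervalIntegral.integral_mul_const, hw1, one_mul]
  rw [hω']
  refine intervalIntegral.norm_integral_le_of_norm_le hle (Eventually.of_forall fun t ht => ?_)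
    (hw.mul_const ω)
  have ht' : |t| ≤ r / 2 := abs_le.2 ⟨ht.1.le, ht.2⟩
  have hb := h.mem_ball (ι := ι) hy ht'
  have hw0 : 0 ≤ w t := mul_nonneg (layer_nonneg hs _)
    (by linarith [h.half_le_inner_gradient hb])
  by_cases hz : layer ρ s (x₀ + (ι y + t • ν)) = 0
  · have h1 : w t = 0 := by simp [hwdef, hz]
    have h2 : u t = 0 := by
      simp only [hudef]
      by_cases hm : x₀ + (ι y + t • ν) ∈ Ω ∩ Metric.ball x₀ r
      · rw [indicator_of_mem hm, hz, zero_mul]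
      · rw [indicator_of_notMem hm]
    rw [h1, h2]; simp
  · obtain ⟨h1, h2⟩ := h.of_layer_ne_zero hy hs ht' hz
    have h3 : u t - w t * c = w t * (f (x₀ + (ι y + t • ν)) - c) := by
      simp only [hudef, hwdef]
      rw [indicator_of_mem (mem_inter h1 hb)]
      ring
    rw [h3, norm_mul, Real.norm_of_nonneg hw0]
    exact mul_le_mul_of_nonneg_left (hω t ht' h1 h2) hw0

theorem continuousOn_comp_graph {E : Type*} [NormedAddCommGroup E] (hΩ : IsOpen Ω)
    {f : Space (k + 1) → E}
    (hf : ContinuousOn f (closure Ω)) :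
    ContinuousOn (fun y => f (x₀ + (ι y + g y • ν))) (Metric.ball 0 (r / 4)) :=
  hf.comp h.continuous_graph.continuousOn fun y hy =>
    frontier_subset_closure (h.mem_frontier hΩ (by simpa using hy))

theorem integrableOn_comp_graph {E : Type*} [NormedAddCommGroup E] (hΩ : IsOpen Ω)
    {f : Space (k + 1) → E}
    (hf : ContinuousOn f (closure Ω)) :
    IntegrableOn (fun y => f (x₀ + (ι y + g y • ν))) (Metric.ball 0 (r / 4)) := by
  obtain ⟨C, hC⟩ := ((isCompact_closedBall x₀ r).inter_left
    (isClosed_closure (s := Ω))).exists_bound_of_continuousOn (hf.mono inter_subset_left)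
  refine (integrableOn_const (C := C) measure_ball_lt_top.ne).mono'
    ((h.continuousOn_comp_graph hΩ hf).aestronglyMeasurable measurableSet_ball) ?_
  filter_upwards [ae_restrict_mem measurableSet_ball] with y hy
  rw [mem_ball_zero_iff] at hy
  exact hC _ ⟨frontier_subset_closure (h.mem_frontier hΩ hy),
    Metric.ball_subset_closedBall (h.mem_ball (ι := ι) hy (by linarith [(h.graph y hy).1, h.r_pos]))⟩

/-- Fubini in the coordinates `(y, t)`: uniform continuity of `f` makes each line average converge,
uniformly in `y`, to the value on the graph. -/
theorem tendsto_integral_layer (hΩ : IsOpen Ω) {f : Space (k + 1) → ℝ}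
    (hf : ContinuousOn f (closure Ω)) (hsupp : ∀ x ∉ Metric.ball x₀ (r / 4), f x = 0) :
    Tendsto (fun s => ∫ x in Ω ∩ Metric.ball x₀ r, layer ρ s x * (⟪gradient ρ x, ν⟫ * f x))
      (𝓝[>] 0) (𝓝 (∫ y in Metric.ball (0 : Space k) (r / 4), f (x₀ + (ι y + g y • ν)))) := by
  have hr := h.r_pos
  set V := Ω ∩ Metric.ball x₀ r with hV
  have hVm : MeasurableSet V := (hΩ.inter Metric.isOpen_ball).measurableSet
  obtain ⟨C, hC0, hC⟩ := exists_bound_inter_ball hf x₀ r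
  have hint : ∀ s > 0, IntegrableOn (fun x => layer ρ s x * (⟪gradient ρ x, ν⟫ * f x)) V := by
    intro s hs
    refine h.integrableOn_layer_mul hΩ hs (C := 2 * C)
      (((h.continuousOn_gradient.mono inter_subset_right).inner continuousOn_const).mul
        (hf.mono (inter_subset_left.trans subset_closure))) fun x hx => ?_
    rw [norm_mul]
    refine mul_le_mul ?_ (hC x hx) (norm_nonneg _) (by norm_num)
    refine (norm_inner_le_norm _ _).trans ?_
    rw [h.norm_eq, mul_one]
    exact h.norm_gradient_le hx.2
  have hunif : UniformContinuousOn f (closure Ω ∩ Metric.closedBall x₀ r) :=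
    ((isCompact_closedBall x₀ r).inter_left (isClosed_closure
      (s := Ω))).uniformContinuousOn_of_continuous (hf.mono inter_subset_left)
  rw [Metric.tendsto_nhds]
  intro ε hε
  set B := volume.real (Metric.ball (0 : Space k) (r / 4)) with hB
  have hB0 : 0 ≤ B := measureReal_nonneg
  -- Chosen so that `ω * B < ε`, where `B` is the volume of the base ball.
  set ω := ε / (2 * (B + 1)) with hω
  have hω0 : 0 < ω := by positivity
  obtain ⟨η, hη, hη'⟩ := Metric.uniformContinuousOn_iff.1 hunif ω hω0
  -- The first bound makes the line weight have mass one; the second keeps the layer, of depth at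
  -- most `4 s`, within the modulus of continuity `η`.
  have hs0 : 0 < min (r / 16) (η / 8) := by positivity
  filter_upwards [Ioo_mem_nhdsGT hs0] with s hs
  have hs1 : 16 * s ≤ r := by
    have := hs.2.trans_le (min_le_left _ _); linarith
  have hs2 : 4 * s < η := by
    have := hs.2.trans_le (min_le_right _ _); linarith
  have hs := hs.1
  set u : Space (k + 1) → ℝ := V.indicator fun x => layer ρ s x * (⟪gradient ρ x, ν⟫ * f x)
    with hu
  have hui : Integrable u := (hint s hs).integrable_indicator hVm
  have hmp : MeasurePreserving (fun z : Space k × ℝ => x₀ + (ι z.1 + z.2 • ν))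
      (volume.prod volume) volume :=
    (measurePreserving_add_left volume x₀).comp h.measurePreserving
  have hui' : Integrable (fun z : Space k × ℝ => u (x₀ + (ι z.1 + z.2 • ν)))
      (volume.prod volume) := hmp.integrable_comp_of_integrable hui
  have e1 : ∫ x in V, layer ρ s x * (⟪gradient ρ x, ν⟫ * f x)
      = ∫ y in Metric.ball (0 : Space k) (r / 4), ∫ t : ℝ, u (x₀ + (ι y + t • ν)) := by
    rw [← integral_indicator hVm, ← hu]
    conv_lhs => rw [← hmp.map_eq]
    rw [integral_map hmp.aemeasurable (by rw [hmp.map_eq]; exact hui.aestronglyMeasurable),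
      integral_prod _ hui']
    symm
    apply setIntegral_eq_integral_of_forall_compl_eq_zero
    intro y hy
    have : ∀ t : ℝ, u (x₀ + (ι y + t • ν)) = 0 := by
      intro t
      have h1 : f (x₀ + (ι y + t • ν)) = 0 := by
        apply hsupp
        rw [mem_ball_iff_norm, add_sub_cancel_left, not_lt]
        refine le_trans ?_ (norm_le_norm_coordinates h.norm_eq h.orth y t)
        simpa using hy
      rw [hu]
      by_cases hm : x₀ + (ι y + t • ν) ∈ V
      · rw [indicator_of_mem hm, h1, mul_zero, mul_zero]
      · rw [indicator_of_notMem hm]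
    simp [this]
  rw [e1, dist_eq_norm, ← integral_sub hui'.integral_prod_left.integrableOn
    (h.integrableOn_comp_graph hΩ hf)]
  refine lt_of_le_of_lt (norm_setIntegral_le_of_norm_le_const_ae' (C := ω)
    measure_ball_lt_top ?_) ?_
  · filter_upwards [hui'.prod_right_ae] with y hyi hy
    rw [mem_ball_zero_iff] at hy
    refine h.abs_integral_line_sub_le hy hs hs1 hsupp (fun t ht htΩ htg => ?_) hyi
    refine (hη' _ ⟨subset_closure htΩ, Metric.ball_subset_closedBall (h.mem_ball (ι := ι) hy ht)⟩ _
      ⟨frontier_subset_closure (h.mem_frontier hΩ hy), Metric.ball_subset_closedBall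
        (h.mem_ball (ι := ι) hy (by linarith [(h.graph y hy).1]))⟩ ?_).le
    rw [dist_eq_norm, coordinates_sub, sub_self, map_zero, zero_add, norm_smul, h.norm_eq, mul_one]
    exact htg.trans_lt hs2
  · rw [← hB, hω, div_mul_eq_mul_div, div_lt_iff₀ (by positivity)]
    nlinarith

/-- Only points of the support of `H` outside `Ω` need care: there `ρ ≥ 0`, so `ρ > -s` nearby and
the cutoff factor vanishes on a whole neighbourhood. The values of `H` outside `Ω` therefore play no
role. -/
theorem differentiable_profile_smul (hΩ : IsOpen Ω) {H : Space (k + 1) → Space (k + 1)}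
    (hd : DifferentiableOn ℝ H Ω) (hsupp : tsupport H ⊆ Metric.ball x₀ (r / 4)) {s : ℝ}
    (hs : 0 < s) :
    Differentiable ℝ fun x => profile (-ρ x / s) • H x := by
  intro x
  have hr := h.r_pos
  by_cases hx : x ∈ tsupport H
  · have hxb : x ∈ Metric.ball x₀ r :=
      Metric.ball_subset_ball (by linarith) (hsupp hx)
    have hρ := (h.contDiffAt x hxb).differentiableAt (by norm_num)
    by_cases hxΩ : x ∈ Ω
    · exact (differentiableAt_profile_comp hρ s).smul (hd.differentiableAt (hΩ.mem_nhds hxΩ))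
    · have h0 : 0 ≤ ρ x := by
        rw [h.mem_iff x hxb] at hxΩ; linarith
      have : (fun x => profile (-ρ x / s) • H x) =ᶠ[𝓝 x] fun _ => 0 := by
        filter_upwards [hρ.continuousAt.eventually_const_lt (show -s < ρ x by linarith)] with y hy
        rw [profile_of_le, zero_smul]
        rw [div_le_iff₀ hs]; linarith
      exact this.differentiableAt_iff.2 (differentiableAt_const _)
  · have : (fun x => profile (-ρ x / s) • H x) =ᶠ[𝓝 x] fun _ => 0 := by
      filter_upwards [notMem_tsupport_iff_eventuallyEq.1 hx] with y hy
      rw [hy]; simp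
    exact this.differentiableAt_iff.2 (differentiableAt_const _)

/-- The cut-off field is differentiable everywhere with compact support, so its divergence has
integral zero; the product rule splits that integral into the two sides. -/
theorem integral_profile_mul_divergence (hΩ : IsOpen Ω) {H : Space (k + 1) → Space (k + 1)}
    (hd : DifferentiableOn ℝ H Ω) (hc : ContinuousOn H (closure Ω))
    (hsupp : tsupport H ⊆ Metric.ball x₀ (r / 4)) (hi : IntegrableOn (divergence H) Ω) {s : ℝ}
    (hs : 0 < s) :
    ∫ x in Ω ∩ Metric.ball x₀ r, profile (-ρ x / s) * divergence H x
      = ∫ x in Ω ∩ Metric.ball x₀ r, layer ρ s x * ⟪gradient ρ x, H x⟫ := by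
  have hr := h.r_pos
  set V := Ω ∩ Metric.ball x₀ r with hV
  have hVm : MeasurableSet V := (hΩ.inter Metric.isOpen_ball).measurableSet
  obtain ⟨C, hC0, hC⟩ := exists_bound_inter_ball hc x₀ r
  have i1 : IntegrableOn (fun x => profile (-ρ x / s) * divergence H x) V := by
    refine (hi.mono_set inter_subset_left).bdd_mul (c := 1) ?_ ?_
    · have : ContinuousOn ρ V := fun x hx =>
        (h.contDiffAt x hx.2).continuousAt.continuousWithinAt
      exact (contDiff_profile.continuous.comp_continuousOn
        (this.neg.div_const s)).aestronglyMeasurable hVm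
    · exact Eventually.of_forall fun x => by
        rw [Real.norm_of_nonneg (profile_nonneg _)]; exact profile_le_one _
  have i2 : IntegrableOn (fun x => layer ρ s x * ⟪gradient ρ x, H x⟫) V := by
    refine h.integrableOn_layer_mul hΩ hs (C := 2 * C)
      ((h.continuousOn_gradient.mono inter_subset_right).inner
        (hc.mono (inter_subset_left.trans subset_closure))) fun x hx => ?_
    refine (norm_inner_le_norm _ _).trans ?_
    exact mul_le_mul (h.norm_gradient_le hx.2) (hC x hx) (norm_nonneg _) (by norm_num)
  have hdiv : ∀ x, divergence (fun x => profile (-ρ x / s) • H x) x =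
      V.indicator (fun x => profile (-ρ x / s) * divergence H x -
        layer ρ s x * ⟪gradient ρ x, H x⟫) x := by
    intro x
    by_cases hx : x ∈ V
    · have hρ := (h.contDiffAt x hx.2).differentiableAt (by norm_num)
      rw [indicator_of_mem hx, divergence_smul
        (differentiableAt_profile_comp hρ s)
        (hd.differentiableAt (hΩ.mem_nhds hx.1)), gradient_profile hρ, inner_smul_left]
      simp
      ring
    · rw [indicator_of_notMem hx]
      by_cases hxt : x ∈ tsupport H
      · have hxb : x ∈ Metric.ball x₀ r := Metric.ball_subset_ball (by linarith) (hsupp hxt)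
        have hρ := (h.contDiffAt x hxb).differentiableAt (by norm_num)
        have hxΩ : x ∉ Ω := fun hh => hx ⟨hh, hxb⟩
        have h0 : 0 ≤ ρ x := by
          rw [h.mem_iff x hxb] at hxΩ; linarith
        have : (fun x => profile (-ρ x / s) • H x) =ᶠ[𝓝 x] fun _ => 0 := by
          filter_upwards [hρ.continuousAt.eventually_const_lt (show -s < ρ x by linarith)] with y hy
          rw [profile_of_le, zero_smul]
          rw [div_le_iff₀ hs]; linarith
        rw [divergence_congr this]
        simp [divergence]
      · have : (fun x => profile (-ρ x / s) • H x) =ᶠ[𝓝 x] fun _ => 0 := by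
          filter_upwards [notMem_tsupport_iff_eventuallyEq.1 hxt] with y hy
          rw [hy]; simp
        rw [divergence_congr this]
        simp [divergence]
  have hcpt : HasCompactSupport H :=
    HasCompactSupport.of_support_subset_isCompact (isCompact_closedBall x₀ (r / 4))
      ((subset_tsupport _).trans (hsupp.trans Metric.ball_subset_closedBall))
  have key := integral_divergence_eq_zero (h.differentiable_profile_smul hΩ hd hsupp hs)
    (hcpt.smul_left (f := fun x => profile (-ρ x / s))) (by
      rw [show divergence _ = _ from funext hdiv]
      exact (i1.sub i2).integrable_indicator hVm)
  rw [show divergence _ = _ from funext hdiv, integral_indicator hVm, integral_sub i1 i2] at key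
  linarith

theorem tendsto_integral_profile_mul_divergence (hΩ : IsOpen Ω)
    {H : Space (k + 1) → Space (k + 1)}
    (hsupp : tsupport H ⊆ Metric.ball x₀ (r / 4)) (hi : IntegrableOn (divergence H) Ω) :
    Tendsto (fun s => ∫ x in Ω ∩ Metric.ball x₀ r, profile (-ρ x / s) * divergence H x)
      (𝓝[>] 0) (𝓝 (∫ x in Ω, divergence H x)) := by
  have hr := h.r_pos
  set V := Ω ∩ Metric.ball x₀ r with hV
  have hVm : MeasurableSet V := (hΩ.inter Metric.isOpen_ball).measurableSet
  have e : ∫ x in Ω, divergence H x = ∫ x in V, divergence H x := by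
    refine setIntegral_eq_of_subset_of_forall_sdiff_eq_zero hΩ.measurableSet
      inter_subset_left ?_
    intro x hx
    apply divergence_of_notMem_tsupport
    intro hxt
    exact hx.2 ⟨hx.1, Metric.ball_subset_ball (by linarith) (hsupp hxt)⟩
  rw [e]
  refine tendsto_integral_filter_of_dominated_convergence (fun x => |divergence H x|) ?_ ?_
    (hi.mono_set inter_subset_left).abs ?_
  · refine Eventually.of_forall fun s => ?_
    have : ContinuousOn ρ V := fun x hx =>
      (h.contDiffAt x hx.2).continuousAt.continuousWithinAt
    exact ((contDiff_profile.continuous.comp_continuousOn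
      (this.neg.div_const s)).aestronglyMeasurable hVm).mul
      (measurable_divergence H).aestronglyMeasurable
  · refine Eventually.of_forall fun s => Eventually.of_forall fun x => ?_
    rw [norm_mul, Real.norm_of_nonneg (profile_nonneg _), Real.norm_eq_abs]
    exact mul_le_of_le_one_left (abs_nonneg _) (profile_le_one _)
  · filter_upwards [ae_restrict_mem hVm] with x hx
    have h0 : ρ x < 0 := (h.mem_iff x hx.2).1 hx.1
    refine tendsto_const_nhds.congr' ?_
    filter_upwards [Ioo_mem_nhdsGT (show (0 : ℝ) < -ρ x / 2 by linarith)] with s hs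
    rw [profile_of_ge, one_mul]
    rw [le_div_iff₀ hs.1]; linarith [hs.2]

/-- The flux through a nearly flat boundary piece, compared with the flux through its projection. -/
theorem abs_integral_divergence_sub_le (hΩ : IsOpen Ω) {H : Space (k + 1) → Space (k + 1)}
    (hd : DifferentiableOn ℝ H Ω) (hc : ContinuousOn H (closure Ω))
    (hsupp : tsupport H ⊆ Metric.ball x₀ (r / 4)) (hi : IntegrableOn (divergence H) Ω) :
    |(∫ x in Ω, divergence H x) -
      ∫ y in Metric.ball (0 : Space k) (r / 4), ⟪ν, H (x₀ + (ι y + g y • ν))⟫| ≤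
      4 * δ * ∫ y in Metric.ball (0 : Space k) (r / 4), ‖H (x₀ + (ι y + g y • ν))‖ := by
  have hr := h.r_pos
  have hVm : MeasurableSet (Ω ∩ Metric.ball x₀ r) := (hΩ.inter Metric.isOpen_ball).measurableSet
  obtain ⟨C, hC0, hC⟩ := exists_bound_inter_ball hc x₀ r
  have hz : ∀ x ∉ Metric.ball x₀ (r / 4), H x = 0 := fun x hx =>
    image_eq_zero_of_notMem_tsupport fun hxt => hx (hsupp hxt)
  have hcV : ContinuousOn H (Ω ∩ Metric.ball x₀ r) :=
    hc.mono (inter_subset_left.trans subset_closure)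
  have hgV := h.continuousOn_gradient.mono (inter_subset_right (s := Ω))
  have t1 := h.tendsto_integral_layer hΩ (f := fun x => ⟪ν, H x⟫) (continuousOn_const.inner hc)
    (fun x hx => by rw [hz x hx, inner_zero_right])
  have t2 := h.tendsto_integral_layer hΩ (f := fun x => ‖H x‖) hc.norm
    (fun x hx => by rw [hz x hx, norm_zero])
  have t3 := h.tendsto_integral_profile_mul_divergence hΩ hsupp hi
  refine le_of_tendsto_of_tendsto (t3.sub t1).abs (t2.const_mul (4 * δ)) ?_
  filter_upwards [self_mem_nhdsWithin] with s hs
  rw [mem_Ioi] at hs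
  rw [h.integral_profile_mul_divergence hΩ hd hc hsupp hi hs, ← integral_sub, ← integral_const_mul,
    ← Real.norm_eq_abs]
  · refine norm_integral_le_of_norm_le (Integrable.const_mul ?_ _) ?_
    · refine h.integrableOn_layer_mul hΩ hs (C := 2 * C)
        ((hgV.inner continuousOn_const).mul hcV.norm) fun x hx => ?_
      rw [norm_mul, norm_norm]
      refine mul_le_mul ?_ (hC x hx) (norm_nonneg _) (by norm_num)
      refine (norm_inner_le_norm _ _).trans ?_
      rw [h.norm_eq, mul_one]
      exact h.norm_gradient_le hx.2
    · filter_upwards [ae_restrict_mem hVm] with x hx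
      have e : layer ρ s x * ⟪gradient ρ x, H x⟫ - layer ρ s x * (⟪gradient ρ x, ν⟫ * ⟪ν, H x⟫)
          = layer ρ s x * ⟪gradient ρ x - ⟪gradient ρ x, ν⟫ • ν, H x⟫ := by
        rw [inner_sub_left, inner_smul_left]; simp; ring
      -- This is the tangential part of the gradient, which depends only on `gradient ρ x - ν`.
      have e2 : ‖gradient ρ x - ⟪gradient ρ x, ν⟫ • ν‖ ≤ 2 * δ := by
        have h1 : gradient ρ x - ⟪gradient ρ x, ν⟫ • ν
            = (gradient ρ x - ν) - ⟪gradient ρ x - ν, ν⟫ • ν := by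
          rw [inner_sub_left, real_inner_self_eq_norm_sq, h.norm_eq, sub_smul]; simp
        have h2 := norm_inner_le_norm (𝕜 := ℝ) (gradient ρ x - ν) ν
        have h3 := h.gradient_close x hx.2
        rw [h1]
        refine (norm_sub_le _ _).trans ?_
        rw [norm_smul, h.norm_eq, mul_one]
        rw [h.norm_eq, mul_one] at h2
        linarith
      have h4 := h.half_le_inner_gradient hx.2
      rw [e, norm_mul, Real.norm_of_nonneg (layer_nonneg hs x)]
      calc layer ρ s x * ‖⟪gradient ρ x - ⟪gradient ρ x, ν⟫ • ν, H x⟫‖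
          ≤ layer ρ s x * (2 * δ * ‖H x‖) := by
            refine mul_le_mul_of_nonneg_left ?_ (layer_nonneg hs x)
            exact (norm_inner_le_norm _ _).trans (mul_le_mul_of_nonneg_right e2 (norm_nonneg _))
        -- The factor `⟪gradient ρ x, ν⟫ ≥ 1/2` is inserted at the cost of doubling the constant,
        -- because the limit of the layer integral is known only with this weight.
        _ ≤ layer ρ s x * (4 * δ * (⟪gradient ρ x, ν⟫ * ‖H x‖)) := by
            refine mul_le_mul_of_nonneg_left ?_ (layer_nonneg hs x)
            have := mul_nonneg h.δ_pos.le (norm_nonneg (H x))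
            nlinarith
        _ = _ := by ring
  · refine h.integrableOn_layer_mul hΩ hs (C := 2 * C) (hgV.inner hcV) fun x hx => ?_
    refine (norm_inner_le_norm _ _).trans ?_
    exact mul_le_mul (h.norm_gradient_le hx.2) (hC x hx) (norm_nonneg _) (by norm_num)
  · refine h.integrableOn_layer_mul hΩ hs (C := 2 * C)
      ((hgV.inner continuousOn_const).mul (continuousOn_const.inner hcV)) fun x hx => ?_
    rw [norm_mul]
    refine mul_le_mul ?_ ?_ (norm_nonneg _) (by norm_num)
    · refine (norm_inner_le_norm _ _).trans ?_
      rw [h.norm_eq, mul_one]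
      exact h.norm_gradient_le hx.2
    · refine (norm_inner_le_norm _ _).trans ?_
      rw [h.norm_eq, one_mul]
      exact hC x hx

end IsGraphChart

/-! ### Surface measure against projected volume; the local flux estimate -/

/-- For a nonnegative function the two integrals differ by a factor between `1` and `c`; apply this
to the positive and negative parts. -/
theorem abs_integral_sub_le_of_measure_le {α : Type*} [MeasurableSpace α] {μ lam : Measure α}
    {c : ℝ} (hc : 1 ≤ c) (h1 : μ ≤ lam) (h2 : lam ≤ ENNReal.ofReal c • μ) {f : α → ℝ}
    (hf : Integrable f μ) :
    |(∫ x, f x ∂lam) - ∫ x, f x ∂μ| ≤ (c - 1) * ∫ x, |f x| ∂μ := by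
  have hfl : Integrable f lam := (hf.smul_measure ENNReal.ofReal_ne_top).mono_measure h2
  have key : ∀ u : α → ℝ, (∀ x, 0 ≤ u x) → Integrable u μ →
      ∫ x, u x ∂μ ≤ ∫ x, u x ∂lam ∧ ∫ x, u x ∂lam ≤ c * ∫ x, u x ∂μ := by
    intro u hu hui
    have hui2 := hui.smul_measure (c := ENNReal.ofReal c) ENNReal.ofReal_ne_top
    refine ⟨integral_mono_measure h1 (Eventually.of_forall hu) (hui2.mono_measure h2), ?_⟩
    refine (integral_mono_measure h2 (Eventually.of_forall hu) hui2).trans ?_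
    rw [integral_smul_measure, ENNReal.toReal_ofReal (by linarith), smul_eq_mul]
  have kp := key (fun x => max (f x) 0) (fun x => le_max_right _ _) hf.pos_part
  have kn := key (fun x => max (-f x) 0) (fun x => le_max_right _ _) hf.neg_part
  have e : ∀ m : Measure α, Integrable f m →
      ∫ x, f x ∂m = ∫ x, max (f x) 0 ∂m - ∫ x, max (-f x) 0 ∂m := by
    intro m hm
    rw [← integral_sub hm.pos_part hm.neg_part]
    refine integral_congr_ae (Eventually.of_forall fun x => ?_)
    rcases le_total (f x) 0 with h | h
    · simp [h]
    · simp [h]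
  have ea : ∫ x, |f x| ∂μ = ∫ x, max (f x) 0 ∂μ + ∫ x, max (-f x) 0 ∂μ := by
    rw [← integral_add hf.pos_part hf.neg_part]
    refine integral_congr_ae (Eventually.of_forall fun x => ?_)
    rcases le_total (f x) 0 with h | h
    · simp [h, abs_of_nonpos h]
    · simp [h, abs_of_nonneg h]
  rw [e _ hf, e _ hfl, ea, abs_le]
  constructor <;> linarith [kp.1, kp.2, kn.1, kn.2]

namespace IsGraphChart

variable {k : ℕ} {ν : Space (k + 1)} {ι : Space k →ₗᵢ[ℝ] Space (k + 1)}
variable {Ω : Set (Space (k + 1))} {x₀ : Space (k + 1)} {δ r : ℝ} {ρ : Space (k + 1) → ℝ}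
variable {g : Space k → ℝ} (h : IsGraphChart Ω x₀ ν δ r ρ ι g)
include h

theorem antilipschitz_graph : AntilipschitzWith 1 fun y => x₀ + (ι y + g y • ν) := by
  refine AntilipschitzWith.of_le_mul_dist fun y y' => ?_
  rw [NNReal.coe_one, one_mul, dist_eq_norm, dist_eq_norm, coordinates_sub]
  exact norm_le_norm_coordinates h.norm_eq h.orth _ _

theorem lipschitz_graph :
    LipschitzWith (1 + 2 * δ).toNNReal fun y => x₀ + (ι y + g y • ν) := by
  have hδ := h.δ_pos
  refine LipschitzWith.of_dist_le_mul fun y y' => ?_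
  rw [Real.coe_toNNReal _ (by linarith), dist_eq_norm, dist_eq_norm, coordinates_sub]
  refine (norm_coordinates_le h.norm_eq _ _).trans ?_
  have := h.lipschitz.dist_le_mul y y'
  rw [Real.coe_toNNReal _ (by linarith), Real.dist_eq, dist_eq_norm] at this
  linarith

theorem measurableEmbedding_graph : MeasurableEmbedding fun y => x₀ + (ι y + g y • ν) :=
  (h.antilipschitz_graph.isClosedEmbedding h.lipschitz_graph.uniformContinuous).measurableEmbedding

/-- The graph map does not decrease distances, since orthogonal projection is a contraction;
Hausdorff measure can only grow. -/
theorem volume_le_comap :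
    (volume : Measure (Space k)) ≤ (μHE[k] : Measure (Space (k + 1))).comap
      fun y => x₀ + (ι y + g y • ν) := by
  refine Measure.le_iff.2 fun A _ => ?_
  rw [h.measurableEmbedding_graph.comap_apply,
    ← EuclideanSpace.euclideanHausdorffMeasure_eq_volume k,
    Measure.euclideanHausdorffMeasure_def, Measure.euclideanHausdorffMeasure_def,
    Measure.smul_apply, Measure.smul_apply]
  have := h.antilipschitz_graph.le_hausdorffMeasure_image (d := k) (by positivity) A
  simp only [ENNReal.coe_one, ENNReal.one_rpow, one_mul] at this
  gcongr

/-- The graph map is Lipschitz with constant `1 + 2δ`, so it expands `k`-dimensional measure by at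
most the `k`-th power. With the reverse bound this replaces the area formula. -/
theorem comap_le_volume :
    (μHE[k] : Measure (Space (k + 1))).comap (fun y => x₀ + (ι y + g y • ν)) ≤
      ENNReal.ofReal ((1 + 2 * δ) ^ k) • (volume : Measure (Space k)) := by
  have hδ := h.δ_pos
  refine Measure.le_iff.2 fun A _ => ?_
  rw [h.measurableEmbedding_graph.comap_apply, Measure.smul_apply,
    ← EuclideanSpace.euclideanHausdorffMeasure_eq_volume k,
    Measure.euclideanHausdorffMeasure_def, Measure.euclideanHausdorffMeasure_def,
    Measure.smul_apply, Measure.smul_apply]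
  have := h.lipschitz_graph.hausdorffMeasure_image_le (d := k) (by positivity) A
  rw [ENNReal.rpow_natCast, ← ENNReal.ofReal, ← ENNReal.ofReal_pow (by linarith)] at this
  rw [smul_comm]
  gcongr
  exact this

theorem image_graph_subset (hΩ : IsOpen Ω) :
    (fun y => x₀ + (ι y + g y • ν)) '' Metric.ball 0 (r / 4) ⊆ frontier Ω ∩ Metric.ball x₀ r := by
  rintro _ ⟨y, hy, rfl⟩
  rw [mem_ball_zero_iff] at hy
  exact ⟨h.mem_frontier hΩ hy, h.mem_ball (ι := ι) hy (by linarith [(h.graph y hy).1, h.r_pos])⟩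

theorem eq_zero_of_mem_diff (hΩ : IsOpen Ω) {E : Type*} [Zero E] {f : Space (k + 1) → E}
    (hz : ∀ x ∉ Metric.ball x₀ (r / 4), f x = 0) :
    ∀ x ∈ frontier Ω \ ((fun y => x₀ + (ι y + g y • ν)) '' Metric.ball 0 (r / 4)), f x = 0 := by
  intro x hx
  apply hz
  intro hb
  obtain ⟨y, hy, hyx⟩ := h.eq_graph_of_mem_frontier hΩ hb hx.1
  exact hx.2 ⟨y, by simpa using hy, hyx⟩

theorem setIntegral_frontier (hΩ : IsOpen Ω) {f : Space (k + 1) → ℝ}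
    (hz : ∀ x ∉ Metric.ball x₀ (r / 4), f x = 0) :
    ∫ x in frontier Ω, f x ∂μHE[k] = ∫ y in Metric.ball 0 (r / 4), f (x₀ + (ι y + g y • ν))
      ∂(μHE[k] : Measure (Space (k + 1))).comap fun y => x₀ + (ι y + g y • ν) := by
  have hm := h.measurableEmbedding_graph
  rw [setIntegral_eq_of_subset_of_forall_sdiff_eq_zero isClosed_frontier.measurableSet
    ((h.image_graph_subset hΩ).trans inter_subset_left) (h.eq_zero_of_mem_diff hΩ hz)]
  have e := hm.map_comap μHE[k]
  have e2 : (μHE[k] : Measure (Space (k + 1))).restrict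
      ((fun y => x₀ + (ι y + g y • ν)) '' Metric.ball 0 (r / 4)) =
      (((μHE[k] : Measure (Space (k + 1))).comap fun y => x₀ + (ι y + g y • ν)).map
        fun y => x₀ + (ι y + g y • ν)).restrict
      ((fun y => x₀ + (ι y + g y • ν)) '' Metric.ball 0 (r / 4)) := by
    rw [e, Measure.restrict_restrict (hm.measurableSet_image.2 measurableSet_ball),
      inter_eq_left.2 (image_subset_range _ _)]
  rw [e2, hm.setIntegral_map, hm.injective.preimage_image]

theorem integrableOn_frontier (hΩ : IsOpen Ω) {f : Space (k + 1) → ℝ}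
    (hf : ContinuousOn f (frontier Ω ∩ Metric.ball x₀ r)) {C : ℝ}
    (hC : ∀ x ∈ frontier Ω ∩ Metric.ball x₀ r, ‖f x‖ ≤ C)
    (hz : ∀ x ∉ Metric.ball x₀ (r / 4), f x = 0) :
    IntegrableOn f (frontier Ω) μHE[k] := by
  have hm := h.measurableEmbedding_graph
  have hs := h.image_graph_subset hΩ
  have hmeas : MeasurableSet ((fun y => x₀ + (ι y + g y • ν)) '' Metric.ball 0 (r / 4)) :=
    hm.measurableSet_image.2 measurableSet_ball
  have hfin : μHE[k] ((fun y => x₀ + (ι y + g y • ν)) '' Metric.ball 0 (r / 4)) ≠ ⊤ := by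
    rw [← hm.comap_apply]
    refine ((h.comap_le_volume _).trans_lt ?_).ne
    rw [Measure.smul_apply, smul_eq_mul]
    exact ENNReal.mul_lt_top ENNReal.ofReal_lt_top measure_ball_lt_top
  have : IntegrableOn f ((fun y => x₀ + (ι y + g y • ν)) '' Metric.ball 0 (r / 4)) μHE[k] := by
    refine (integrableOn_const (C := C) hfin).mono' ((hf.mono hs).aestronglyMeasurable hmeas) ?_
    filter_upwards [ae_restrict_mem hmeas] with x hx using hC x (hs hx)
  exact this.of_forall_sdiff_eq_zero isClosed_frontier.measurableSet (h.eq_zero_of_mem_diff hΩ hz)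

/-- Three errors add up: `4δ` for the passage from `Ω` to the projection, `(1 + 2δ)^k - 1` for
projected volume against surface measure, and `2δ` for `ν` against the true normal. -/
theorem flux_estimate (hΩ : IsOpen Ω) {H : Space (k + 1) → Space (k + 1)}
    (hd : DifferentiableOn ℝ H Ω) (hc : ContinuousOn H (closure Ω))
    (hsupp : tsupport H ⊆ Metric.ball x₀ (r / 4)) (hi : IntegrableOn (divergence H) Ω) :
    IntegrableOn (fun x => ⟪H x, outwardNormal Ω x⟫) (frontier Ω) μHE[k] ∧
    IntegrableOn (fun x => ‖H x‖) (frontier Ω) μHE[k] ∧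
    |(∫ x in Ω, divergence H x) - ∫ x in frontier Ω, ⟪H x, outwardNormal Ω x⟫ ∂μHE[k]| ≤
      (6 * δ + ((1 + 2 * δ) ^ k - 1)) * ∫ x in frontier Ω, ‖H x‖ ∂μHE[k] := by
  have hr := h.r_pos
  have hδ := h.δ_pos
  have hz : ∀ x ∉ Metric.ball x₀ (r / 4), H x = 0 := fun x hx =>
    image_eq_zero_of_notMem_tsupport fun hxt => hx (hsupp hxt)
  obtain ⟨C, hC⟩ := ((isCompact_closedBall x₀ r).inter_left
    (isClosed_frontier (s := Ω))).exists_bound_of_continuousOn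
    (hc.mono (inter_subset_left.trans frontier_subset_closure))
  have hC : ∀ x ∈ frontier Ω ∩ Metric.ball x₀ r, ‖H x‖ ≤ C := fun x hx =>
    hC x ⟨hx.1, Metric.ball_subset_closedBall hx.2⟩
  have hcf : ContinuousOn H (frontier Ω ∩ Metric.ball x₀ r) :=
    hc.mono (inter_subset_left.trans frontier_subset_closure)
  have hn := h.continuousOn_outwardNormal hΩ
  rw [inter_comm] at hn
  have i1 : IntegrableOn (fun x => ⟪H x, outwardNormal Ω x⟫) (frontier Ω) μHE[k] := by
    refine h.integrableOn_frontier hΩ (hcf.inner hn) (C := C) (fun x hx => ?_)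
      (fun x hx => by rw [hz x hx, inner_zero_left])
    refine (norm_inner_le_norm _ _).trans ?_
    rw [outwardNormal_eq (h.isOutwardUnitNormal hΩ hx.2 hx.1),
      (h.isOutwardUnitNormal hΩ hx.2 hx.1).1, mul_one]
    exact hC x hx
  have i2 : IntegrableOn (fun x => ‖H x‖) (frontier Ω) μHE[k] :=
    h.integrableOn_frontier hΩ hcf.norm (C := C) (fun x hx => by rw [norm_norm]; exact hC x hx)
      (fun x hx => by rw [hz x hx, norm_zero])
  have i3 : IntegrableOn (fun x => ⟪ν, H x⟫) (frontier Ω) μHE[k] := by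
    refine h.integrableOn_frontier hΩ (continuousOn_const.inner hcf) (C := C) (fun x hx => ?_)
      (fun x hx => by rw [hz x hx, inner_zero_right])
    refine (norm_inner_le_norm _ _).trans ?_
    rw [h.norm_eq, one_mul]
    exact hC x hx
  refine ⟨i1, i2, ?_⟩
  have a1 := h.abs_integral_divergence_sub_le hΩ hd hc hsupp hi
  have hN : ∫ y in Metric.ball (0 : Space k) (r / 4), ‖H (x₀ + (ι y + g y • ν))‖ ≤
      ∫ x in frontier Ω, ‖H x‖ ∂μHE[k] := by
    rw [h.setIntegral_frontier hΩ (f := fun x => ‖H x‖) (fun x hx => by rw [hz x hx, norm_zero])]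
    refine integral_mono_measure (Measure.restrict_mono_measure h.volume_le_comap _)
      (Eventually.of_forall fun _ => norm_nonneg _) ?_
    refine ((h.integrableOn_comp_graph hΩ hc.norm).smul_measure
      (c := ENNReal.ofReal ((1 + 2 * δ) ^ k)) ENNReal.ofReal_ne_top).mono_measure ?_
    rw [← Measure.restrict_smul]
    exact Measure.restrict_mono_measure h.comap_le_volume _
  have h1k : 1 ≤ (1 + 2 * δ) ^ k := one_le_pow₀ (by linarith)
  have a2 : |(∫ x in frontier Ω, ⟪ν, H x⟫ ∂μHE[k]) -
      ∫ y in Metric.ball (0 : Space k) (r / 4), ⟪ν, H (x₀ + (ι y + g y • ν))⟫| ≤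
      ((1 + 2 * δ) ^ k - 1) *
        ∫ y in Metric.ball (0 : Space k) (r / 4), ‖H (x₀ + (ι y + g y • ν))‖ := by
    rw [h.setIntegral_frontier hΩ (f := fun x => ⟪ν, H x⟫)
      (fun x hx => by rw [hz x hx, inner_zero_right])]
    have hii := h.integrableOn_comp_graph hΩ (f := fun x => ⟪ν, H x⟫) (continuousOn_const.inner hc)
    refine (abs_integral_sub_le_of_measure_le h1k
      (Measure.restrict_mono_measure h.volume_le_comap _) ?_ hii).trans ?_
    · rw [← Measure.restrict_smul]
      exact Measure.restrict_mono_measure h.comap_le_volume _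
    · refine mul_le_mul_of_nonneg_left ?_ (by linarith)
      refine integral_mono hii.abs (h.integrableOn_comp_graph hΩ hc.norm) fun y => ?_
      refine (abs_real_inner_le_norm _ _).trans ?_
      rw [h.norm_eq, one_mul]
  have a3 : |(∫ x in frontier Ω, ⟪H x, outwardNormal Ω x⟫ ∂μHE[k]) -
      ∫ x in frontier Ω, ⟪ν, H x⟫ ∂μHE[k]| ≤ 2 * δ * ∫ x in frontier Ω, ‖H x‖ ∂μHE[k] := by
    rw [← integral_sub i1 i3, ← integral_const_mul, ← Real.norm_eq_abs]
    refine norm_integral_le_of_norm_le (i2.const_mul _) ?_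
    filter_upwards [ae_restrict_mem isClosed_frontier.measurableSet] with x hx
    by_cases hb : x ∈ Metric.ball x₀ (r / 4)
    · have hb' : x ∈ Metric.ball x₀ r := Metric.ball_subset_ball (by linarith) hb
      rw [real_inner_comm (H x) ν, ← inner_sub_right]
      refine (norm_inner_le_norm _ _).trans ?_
      rw [mul_comm]
      exact mul_le_mul_of_nonneg_right (h.norm_outwardNormal_sub_le hΩ hb' hx) (norm_nonneg _)
    · simp [hz x hb]
  have a4 := mul_le_mul_of_nonneg_left hN (show 0 ≤ 4 * δ + ((1 + 2 * δ) ^ k - 1) by linarith)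
  rw [abs_le] at a1 a2 a3 ⊢
  constructor <;> nlinarith [a1.1, a1.2, a2.1, a2.2, a3.1, a3.2]

end IsGraphChart

theorem IsOutwardUnitNormal.exists_flux_estimate {k : ℕ} {ν : Space (k + 1)}
    {Ω : Set (Space (k + 1))} {x₀ : Space (k + 1)} (hν : IsOutwardUnitNormal Ω x₀ ν)
    (hΩ : IsOpen Ω) {ε : ℝ} (hε : 0 < ε) :
    ∃ t > 0, ∀ H : Space (k + 1) → Space (k + 1), DifferentiableOn ℝ H Ω →
      ContinuousOn H (closure Ω) → tsupport H ⊆ Metric.ball x₀ t →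
      IntegrableOn (divergence H) Ω →
      IntegrableOn (fun x => ⟪H x, outwardNormal Ω x⟫) (frontier Ω) μHE[k] ∧
      IntegrableOn (fun x => ‖H x‖) (frontier Ω) μHE[k] ∧
      |(∫ x in Ω, divergence H x) - ∫ x in frontier Ω, ⟪H x, outwardNormal Ω x⟫ ∂μHE[k]| ≤
        ε * ∫ x in frontier Ω, ‖H x‖ ∂μHE[k] := by
  have hlim : Tendsto (fun δ : ℝ => 6 * δ + ((1 + 2 * δ) ^ k - 1)) (𝓝[>] 0) (𝓝 0) := by
    have : Continuous fun δ : ℝ => 6 * δ + ((1 + 2 * δ) ^ k - 1) := by fun_prop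
    have := this.tendsto 0
    simp only [mul_zero, add_zero, one_pow, sub_self] at this
    exact this.mono_left nhdsWithin_le_nhds
  obtain ⟨δ, hδε, hδ⟩ := ((hlim.eventually_lt_const hε).and
    (Ioo_mem_nhdsGT (show (0 : ℝ) < 1 / 4 by norm_num))).exists
  obtain ⟨r, ρ, ι, g, h⟩ := hν.exists_isGraphChart hδ.1 hδ.2.le
  refine ⟨r / 4, by linarith [h.r_pos], fun H hd hc hs hi => ?_⟩
  obtain ⟨i1, i2, hle⟩ := h.flux_estimate hΩ hd hc hs hi
  exact ⟨i1, i2, hle.trans (mul_le_mul_of_nonneg_right hδε.le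
    (integral_nonneg fun _ => norm_nonneg _))⟩

/-! ### Globalisation by a partition of unity -/

section

theorem divergence_sum {d : ℕ} {α : Type*} (s : Finset α) {F : α → Space d → Space d} {x : Space d}
    (hF : ∀ i ∈ s, DifferentiableAt ℝ (F i) x) :
    divergence (fun y => ∑ i ∈ s, F i y) x = ∑ i ∈ s, divergence (F i) x := by
  unfold divergence
  rw [fderiv_fun_sum hF, Finset.sum_comm]
  simp

theorem continuous_gradient {d : ℕ} {f : Space d → ℝ} (h : ContDiff ℝ 1 f) :
    Continuous (gradient f) :=
  continuous_iff_continuousAt.2 fun _ => continuousAt_gradient h.contDiffAt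

variable {k : ℕ} {Ω : Set (Space (k + 1))}

/-- At a regular boundary point this is the chart estimate. At interior points the field extends by
zero and its divergence integrates to zero; at exterior points every term vanishes. -/
theorem exists_flux_estimate (hΩ : IsOpen Ω) {x : Space (k + 1)} (hx : x ∉ singularBoundary Ω)
    {ε : ℝ} (hε : 0 < ε) :
    ∃ U : Set (Space (k + 1)), IsOpen U ∧ x ∈ U ∧
      ∀ H : Space (k + 1) → Space (k + 1), HasCompactSupport H → DifferentiableOn ℝ H Ω →
      ContinuousOn H (closure Ω) → tsupport H ⊆ U → IntegrableOn (divergence H) Ω →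
      IntegrableOn (fun x => ⟪H x, outwardNormal Ω x⟫) (frontier Ω) μHE[k] ∧
      IntegrableOn (fun x => ‖H x‖) (frontier Ω) μHE[k] ∧
      |(∫ x in Ω, divergence H x) - ∫ x in frontier Ω, ⟪H x, outwardNormal Ω x⟫ ∂μHE[k]| ≤
        ε * ∫ x in frontier Ω, ‖H x‖ ∂μHE[k] := by
  have hfm : MeasurableSet (frontier Ω) := isClosed_frontier.measurableSet
  have trivial_case : ∀ H : Space (k + 1) → Space (k + 1), (∀ x ∈ frontier Ω, H x = 0) →
      ∫ x in Ω, divergence H x = 0 →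
      IntegrableOn (fun x => ⟪H x, outwardNormal Ω x⟫) (frontier Ω) μHE[k] ∧
      IntegrableOn (fun x => ‖H x‖) (frontier Ω) μHE[k] ∧
      |(∫ x in Ω, divergence H x) - ∫ x in frontier Ω, ⟪H x, outwardNormal Ω x⟫ ∂μHE[k]| ≤
        ε * ∫ x in frontier Ω, ‖H x‖ ∂μHE[k] := by
    intro H h1 h2
    have e1 : EqOn (fun x => ⟪H x, outwardNormal Ω x⟫) 0 (frontier Ω) := fun x hx => by
      simp [h1 x hx]
    have e2 : EqOn (fun x => ‖H x‖) 0 (frontier Ω) := fun x hx => by simp [h1 x hx]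
    refine ⟨integrableOn_zero.congr_fun e1.symm hfm, integrableOn_zero.congr_fun e2.symm hfm, ?_⟩
    rw [h2, setIntegral_congr_fun hfm e1, setIntegral_congr_fun hfm e2]
    simp
  by_cases hf : x ∈ frontier Ω
  · have : ∃ ν, IsOutwardUnitNormal Ω x ν := by
      by_contra hc
      exact hx ⟨hf, hc⟩
    obtain ⟨ν, hν⟩ := this
    obtain ⟨t, ht, hest⟩ := hν.exists_flux_estimate hΩ hε
    exact ⟨Metric.ball x t, Metric.isOpen_ball, Metric.mem_ball_self ht,
      fun H _ hd hc hs hi => hest H hd hc hs hi⟩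
  · by_cases hxΩ : x ∈ Ω
    · refine ⟨Ω, hΩ, hxΩ, fun H hcs hd hc hs hi => trivial_case H (fun y hy => ?_) ?_⟩
      · rw [hΩ.frontier_eq] at hy
        exact image_eq_zero_of_notMem_tsupport fun hyt => hy.2 (hs hyt)
      · have hz : ∀ y ∉ Ω, divergence H y = 0 := fun y hy =>
          divergence_of_notMem_tsupport fun hyt => hy (hs hyt)
        rw [setIntegral_eq_integral_of_forall_compl_eq_zero hz]
        refine integral_divergence_eq_zero (fun y => ?_) hcs
          ((integrableOn_iff_integrable_of_support_subset fun y hy => ?_).1 hi)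
        · by_cases hy : y ∈ Ω
          · exact hd.differentiableAt (hΩ.mem_nhds hy)
          · have := notMem_tsupport_iff_eventuallyEq.1 fun hyt => hy (hs hyt)
            exact this.differentiableAt_iff.2 (differentiableAt_const _)
        · by_contra hy'
          exact hy (hz y hy')
    · have hxc : x ∉ closure Ω := by
        rw [hΩ.frontier_eq] at hf
        exact fun hc => hf ⟨hc, hxΩ⟩
      refine ⟨(closure Ω)ᶜ, isClosed_closure.isOpen_compl, hxc,
        fun H _ _ _ hs _ => trivial_case H (fun y hy => ?_) ?_⟩
      · exact image_eq_zero_of_notMem_tsupport fun hyt => hs hyt (frontier_subset_closure hy)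
      · exact setIntegral_eq_zero_of_forall_eq_zero fun y hy =>
          divergence_of_notMem_tsupport fun hyt => hs hyt (subset_closure hy)

/-- The divergence theorem for fields vanishing near the singular part of the boundary. -/
theorem integral_divergence_of_disjoint_singularBoundary (hΩ : IsOpen Ω)
    (hbdd : Bornology.IsBounded Ω) {G : Space (k + 1) → Space (k + 1)}
    (hd : DifferentiableOn ℝ G Ω) (hc : ContinuousOn G (closure Ω)) (hcs : HasCompactSupport G)
    (hsing : Disjoint (tsupport G) (singularBoundary Ω)) (hi : IntegrableOn (divergence G) Ω) :
    IntegrableOn (fun x => ⟪G x, outwardNormal Ω x⟫) (frontier Ω) μHE[k] ∧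
    ∫ x in Ω, divergence G x = ∫ x in frontier Ω, ⟪G x, outwardNormal Ω x⟫ ∂μHE[k] := by
  have hcl : IsCompact (closure Ω) := hbdd.isCompact_closure
  have key : ∀ ε > 0,
      IntegrableOn (fun x => ⟪G x, outwardNormal Ω x⟫) (frontier Ω) μHE[k] ∧
      |(∫ x in Ω, divergence G x) - ∫ x in frontier Ω, ⟪G x, outwardNormal Ω x⟫ ∂μHE[k]| ≤
        ε * ∫ x in frontier Ω, ‖G x‖ ∂μHE[k] := by
    intro ε hε
    choose! U hUo hUx hU using fun x (hx : x ∉ singularBoundary Ω) =>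
      exists_flux_estimate hΩ hx hε
    have hns : ∀ x ∈ tsupport G, x ∉ singularBoundary Ω := fun x hx =>
      disjoint_left.1 hsing hx
    obtain ⟨t, ht, hcov⟩ := hcs.isCompact.elim_nhds_subcover U
      fun x hx => (hUo x (hns x hx)).mem_nhds (hUx x (hns x hx))
    obtain ⟨f, hf⟩ := SmoothPartitionOfUnity.exists_isSubordinate (ι := t)
      (modelWithCornersSelf ℝ (Space (k + 1))) (isClosed_tsupport G) (fun i => U i)
      (fun i => hUo i (hns i (ht i i.2))) (fun x hx => by
        obtain ⟨i, hi, hxi⟩ := mem_iUnion₂.1 (hcov hx)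
        exact mem_iUnion.2 ⟨⟨i, hi⟩, hxi⟩)
    have hfs : ∀ i, ContDiff ℝ 1 (f i) := fun i =>
      ((f i).contMDiff.contDiff).of_le (by exact_mod_cast le_top)
    have hsum : ∀ x ∈ tsupport G, ∑ i, f i x = 1 := fun x hx => by
      rw [← finsum_eq_sum_of_fintype]; exact f.sum_eq_one hx
    have hG : ∀ x, G x = ∑ i, f i x • G x := by
      intro x
      rw [← Finset.sum_smul]
      by_cases hx : x ∈ tsupport G
      · rw [hsum x hx, one_smul]
      · rw [image_eq_zero_of_notMem_tsupport hx, smul_zero]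
    -- The weights are nonnegative with sum one on the support, so the norms of the pieces add up
    -- exactly. The total error is thus `ε ∫ ‖G‖`, however many pieces there are.
    have hGn : ∀ x, ‖G x‖ = ∑ i, ‖f i x • G x‖ := by
      intro x
      simp_rw [norm_smul, Real.norm_of_nonneg (f.nonneg _ _)]
      rw [← Finset.sum_mul]
      by_cases hx : x ∈ tsupport G
      · rw [hsum x hx, one_mul]
      · rw [image_eq_zero_of_notMem_tsupport hx, norm_zero, mul_zero]
    have hHd : ∀ i, DifferentiableOn ℝ (fun x => f i x • G x) Ω := fun i =>
      ((hfs i).differentiable (by norm_num)).differentiableOn.smul hd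
    have hdiv : ∀ i, ∀ x ∈ Ω, divergence (fun x => f i x • G x) x
        = f i x * divergence G x + ⟪gradient (f i) x, G x⟫ := fun i x hx =>
      divergence_smul ((hfs i).differentiable (by norm_num) x)
        (hd.differentiableAt (hΩ.mem_nhds hx))
    have hHi : ∀ i, IntegrableOn (divergence fun x => f i x • G x) Ω := by
      intro i
      refine IntegrableOn.congr_fun ?_ (fun x hx => (hdiv i x hx).symm) hΩ.measurableSet
      refine Integrable.add ?_ ?_
      · refine Integrable.bdd_mul hi (c := 1) (hfs i).continuous.aestronglyMeasurable
          (Eventually.of_forall fun x => ?_)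
        rw [Real.norm_of_nonneg (f.nonneg _ _)]
        exact f.le_one _ _
      · exact (((continuous_gradient (hfs i)).continuousOn.inner hc).integrableOn_compact
          hcl).mono_set subset_closure
    have hest := fun i : t => hU i (hns i (ht i i.2)) (fun x => f i x • G x)
      (hcs.smul_left (f := f i)) (hHd i) ((hfs i).continuous.continuousOn.smul hc)
      ((closure_mono (Function.support_smul_subset_left _ _)).trans (hf i)) (hHi i)
    have e1 : ∫ x in Ω, divergence G x = ∑ i, ∫ x in Ω, divergence (fun x => f i x • G x) x := by
      rw [← integral_finsetSum _ fun i _ => hHi i]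
      refine setIntegral_congr_fun hΩ.measurableSet fun x hx => ?_
      rw [← divergence_sum _ fun i _ => (hHd i).differentiableAt (hΩ.mem_nhds hx), ← funext hG]
    have e0 : (fun x => ⟪G x, outwardNormal Ω x⟫)
        = fun x => ∑ i, ⟪f i x • G x, outwardNormal Ω x⟫ := by
      ext x
      conv_lhs => rw [hG x, sum_inner]
    have i0 : IntegrableOn (fun x => ⟪G x, outwardNormal Ω x⟫) (frontier Ω) μHE[k] := by
      rw [e0]
      exact integrable_finsetSum _ fun i _ => (hest i).1
    have e2 : ∫ x in frontier Ω, ⟪G x, outwardNormal Ω x⟫ ∂μHE[k]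
        = ∑ i, ∫ x in frontier Ω, ⟪f i x • G x, outwardNormal Ω x⟫ ∂μHE[k] := by
      rw [e0, integral_finsetSum _ fun i _ => (hest i).1]
    have e3 : ∫ x in frontier Ω, ‖G x‖ ∂μHE[k]
        = ∑ i, ∫ x in frontier Ω, ‖f i x • G x‖ ∂μHE[k] := by
      rw [← integral_finsetSum _ fun i _ => (hest i).2.1]
      simp_rw [← hGn]
    refine ⟨i0, ?_⟩
    rw [e1, e2, e3, ← Finset.sum_sub_distrib, Finset.mul_sum]
    exact (Finset.abs_sum_le_sum_abs _ _).trans (Finset.sum_le_sum fun i _ => (hest i).2.2)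
  refine ⟨(key 1 one_pos).1, ?_⟩
  rw [← sub_eq_zero, ← abs_nonpos_iff]
  have hlim : Tendsto (fun ε : ℝ => ε * ∫ x in frontier Ω, ‖G x‖ ∂μHE[k]) (𝓝[>] 0) (𝓝 0) := by
    have : Continuous fun ε : ℝ => ε * ∫ x in frontier Ω, ‖G x‖ ∂μHE[k] := by fun_prop
    have := this.tendsto 0
    rw [zero_mul] at this
    exact this.mono_left nhdsWithin_le_nhds
  refine ge_of_tendsto hlim ?_
  filter_upwards [self_mem_nhdsWithin] with ε hε using (key ε hε).2

end

/-! ### Cutoffs of bounded energy around the singular set -/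

/-- Take a near-optimal cover from the definition of Hausdorff measure, replace each set meeting `Z`
by a slightly larger ball centred in `Z`, and use compactness. The bound does not depend on `ε`. -/
theorem exists_finite_ball_cover {X : Type*} [MetricSpace X] [Nonempty X] [MeasurableSpace X]
    [BorelSpace X] {Z : Set X} (hZ : IsCompact Z) {j : ℕ} (hfin : μH[(j : ℝ)] Z < ⊤) :
    ∃ M : ℝ, 0 ≤ M ∧ ∀ ε > 0, ∃ (s : Finset ℕ) (c : ℕ → X) (r : ℕ → ℝ),
      (∀ n ∈ s, c n ∈ Z ∧ 0 < r n ∧ r n < ε) ∧ Z ⊆ ⋃ n ∈ s, Metric.ball (c n) (r n) ∧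
      ∑ n ∈ s, r n ^ j ≤ M := by
  refine ⟨(μH[(j : ℝ)] Z + 1).toReal + 2, by positivity, fun ε hε => ?_⟩
  have hlt : μH[(j : ℝ)] Z < μH[(j : ℝ)] Z + 1 :=
    ENNReal.lt_add_right hfin.ne one_ne_zero
  have h1 := (le_iSup₂ (f := fun (r : ENNReal) (_ : 0 < r) =>
    ⨅ (t : ℕ → Set X) (_ : Z ⊆ ⋃ n, t n) (_ : ∀ n, Metric.ediam (t n) ≤ r),
      ∑' n, ⨆ _ : (t n).Nonempty, Metric.ediam (t n) ^ (j : ℝ)) (ENNReal.ofReal (ε / 2))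
      (by positivity)).trans_lt ((Measure.hausdorffMeasure_apply (j : ℝ) Z).symm.trans_lt hlt)
  simp only [iInf_lt_iff] at h1
  obtain ⟨t, ht1, ht2, ht3⟩ := h1
  have hD : ∀ n, Metric.ediam (t n) ≠ ⊤ := fun n => ((ht2 n).trans_lt ENNReal.ofReal_lt_top).ne
  -- Enlarging the radii costs at most `(1/2)^n` in the `n`-th term, in total the `2` in the bound.
  have hr : ∀ n, ∃ r : ℝ, Metric.diam (t n) < r ∧ r < ε ∧
      r ^ j < Metric.diam (t n) ^ j + (1 / 2) ^ n := by
    intro n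
    have hlt : Metric.diam (t n) < ε := by
      have := ENNReal.toReal_mono ENNReal.ofReal_ne_top (ht2 n)
      rw [ENNReal.toReal_ofReal (by positivity)] at this
      exact this.trans_lt (by linarith)
    have hc : Tendsto (fun r : ℝ => r ^ j) (𝓝[>] (Metric.diam (t n)))
        (𝓝 (Metric.diam (t n) ^ j)) :=
      ((continuous_pow j).tendsto _).mono_left nhdsWithin_le_nhds
    obtain ⟨r, h1, h2⟩ := ((hc.eventually_lt_const (show Metric.diam (t n) ^ j <
      Metric.diam (t n) ^ j + (1 / 2) ^ n by simp)).and (Ioo_mem_nhdsGT hlt)).exists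
    exact ⟨r, h2.1, h2.2, h1⟩
  choose r hr1 hr2 hr3 using hr
  have hr0 : ∀ n, 0 < r n := fun n => Metric.diam_nonneg.trans_lt (hr1 n)
  have hcex : ∀ n, ∃ c, (t n ∩ Z).Nonempty → c ∈ t n ∩ Z := by
    intro n
    by_cases hn : (t n ∩ Z).Nonempty
    · exact ⟨hn.choose, fun _ => hn.choose_spec⟩
    · exact ⟨Classical.arbitrary X, fun h => absurd h hn⟩
  choose c hc using hcex
  obtain ⟨s, hs1, hs2, hs3⟩ := hZ.elim_finite_subcover_image (b := {n | (t n ∩ Z).Nonempty})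
    (c := fun n => Metric.ball (c n) (r n)) (fun n _ => Metric.isOpen_ball) (by
      intro z hz
      obtain ⟨n, hn⟩ := mem_iUnion.1 (ht1 hz)
      refine mem_iUnion₂.2 ⟨n, ⟨z, hn, hz⟩, ?_⟩
      rw [Metric.mem_ball]
      exact (Metric.dist_le_diam_of_mem' (hD n) hn (hc n ⟨z, hn, hz⟩).1).trans_lt (hr1 n))
  refine ⟨hs2.toFinset, c, r, fun n hn => ?_, by simpa using hs3, ?_⟩
  · rw [Finite.mem_toFinset] at hn
    exact ⟨(hc n (hs1 hn)).2, hr0 n, hr2 n⟩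
  · have a1 : ∑ n ∈ hs2.toFinset, Metric.diam (t n) ^ j ≤ (μH[(j : ℝ)] Z + 1).toReal := by
      have e : ∑ n ∈ hs2.toFinset, Metric.diam (t n) ^ j
          = (∑ n ∈ hs2.toFinset, Metric.ediam (t n) ^ (j : ℝ)).toReal := by
        rw [ENNReal.toReal_sum fun n _ => by simp [hD n]]
        simp [Metric.diam]
      rw [e]
      refine ENNReal.toReal_mono (by simp [hfin.ne]) (le_trans ?_ ht3.le)
      refine le_trans (Finset.sum_le_sum fun n hn => ?_) (ENNReal.sum_le_tsum hs2.toFinset)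
      rw [Finite.mem_toFinset] at hn
      have : (t n).Nonempty := (hs1 hn).mono inter_subset_left
      simp [this]
    have a2 : ∑ n ∈ hs2.toFinset, ((1 : ℝ) / 2) ^ n ≤ 2 := by
      refine le_of_le_of_eq ?_ tsum_geometric_two
      exact summable_geometric_two.sum_le_tsum _ fun n _ => by positivity
    calc _ ≤ ∑ n ∈ hs2.toFinset, (Metric.diam (t n) ^ j + (1 / 2) ^ n) :=
          Finset.sum_le_sum fun n _ => (hr3 n).le
      _ ≤ _ := by rw [Finset.sum_add_distrib]; linarith

/-- A nonempty set has measure at least one in dimension `0`, hence infinite measure in every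
negative dimension. This handles the case `d = 1`. -/
theorem eq_empty_of_hausdorffMeasure_lt_top {X : Type*} [MetricSpace X] [MeasurableSpace X]
    [BorelSpace X] {Z : Set X} {a : ℝ} (ha : a < 0) (h : μH[a] Z < ⊤) : Z = ∅ := by
  by_contra hne
  have h1 := Measure.one_le_hausdorffMeasure_zero_of_nonempty (nonempty_iff_ne_empty.2 hne)
  rcases Measure.hausdorffMeasure_zero_or_top ha Z with h2 | h2
  · rw [h2] at h1; exact absurd h1 (by simp)
  · exact h.ne h2

/-- A smooth bump function, equal to `1` on the ball of radius `r` about `c` and vanishing outside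
of the ball of radius `2 r`. -/
noncomputable def bump {d : ℕ} (c : Space d) (r : ℝ) (x : Space d) : ℝ :=
  profile (3 - ‖x - c‖ ^ 2 / r ^ 2)

section Bump

variable {d : ℕ} {c : Space d} {r : ℝ}

theorem contDiff_bump : ContDiff ℝ 1 (bump c r) := by
  have : ContDiff ℝ 1 fun x : Space d => 3 - ‖x - c‖ ^ 2 / r ^ 2 :=
    contDiff_const.sub (((contDiff_id.sub contDiff_const).norm_sq ℝ).div_const _)
  exact contDiff_profile.comp this

theorem bump_of_mem_ball (hr : 0 < r) {x : Space d} (hx : x ∈ Metric.ball c r) :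
    bump c r x = 1 := by
  rw [mem_ball_iff_norm] at hx
  apply profile_of_ge
  have : ‖x - c‖ ^ 2 / r ^ 2 ≤ 1 := by
    rw [div_le_one (by positivity)]
    exact pow_le_pow_left₀ (norm_nonneg _) hx.le 2
  linarith

theorem bump_of_le_norm (hr : 0 < r) {x : Space d} (hx : 2 * r ≤ ‖x - c‖) : bump c r x = 0 := by
  apply profile_of_le
  have : 4 ≤ ‖x - c‖ ^ 2 / r ^ 2 := by
    rw [le_div_iff₀ (by positivity)]
    nlinarith
  linarith

/-- The gradient has size of order `1 / r` and is supported in the ball of radius `2 r`; the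
constant is independent of the centre and the radius. -/
theorem exists_norm_fderiv_bump_le (d : ℕ) : ∃ M : ℝ, 0 ≤ M ∧ ∀ (c : Space d) (r : ℝ), 0 < r →
    ∀ x, ‖fderiv ℝ (bump c r) x‖ ^ 2 ≤
      (Metric.closedBall c (2 * r)).indicator (fun _ => M / r ^ 2) x := by
  obtain ⟨M, hM0, hM⟩ := exists_deriv_profile_le
  refine ⟨(4 * M) ^ 2, by positivity, fun c r hr x => ?_⟩
  have h1 : HasFDerivAt (fun x : Space d => 3 - ‖x - c‖ ^ 2 / r ^ 2)
      (-((r ^ 2)⁻¹ • (2 • innerSL ℝ (x - c)))) x := by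
    have h2 : HasFDerivAt (fun x : Space d => ‖x - c‖ ^ 2) (2 • innerSL ℝ (x - c)) x := by
      have := ((hasFDerivAt_id x).sub_const c).norm_sq
      simpa using this
    simp_rw [div_eq_inv_mul]
    exact (h2.const_mul _).const_sub 3
  have h3 := (((contDiff_profile.differentiable (by norm_num))
    (3 - ‖x - c‖ ^ 2 / r ^ 2)).hasDerivAt).comp_hasFDerivAt x h1
  have h4 : fderiv ℝ (bump c r) x = _ := h3.fderiv
  rw [h4]
  by_cases hx : x ∈ Metric.closedBall c (2 * r)
  · have hn : ‖2 • innerSL ℝ (x - c)‖ = 2 * ‖x - c‖ := by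
      rw [← Nat.cast_smul_eq_nsmul ℝ, norm_smul, innerSL_apply_norm]
      simp
    rw [mem_closedBall_iff_norm] at hx
    rw [indicator_of_mem (by rwa [mem_closedBall_iff_norm]), norm_smul, norm_neg, norm_smul, hn,
      Real.norm_of_nonneg (deriv_profile_nonneg _), Real.norm_of_nonneg (by positivity),
      ← div_pow (4 * M) r 2]
    have hp := deriv_profile_nonneg (3 - ‖x - c‖ ^ 2 / r ^ 2)
    refine pow_le_pow_left₀ (by positivity) ?_ 2
    have h5 : (r ^ 2)⁻¹ * (2 * ‖x - c‖) ≤ 4 / r := by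
      rw [inv_mul_le_iff₀ (by positivity)]
      calc 2 * ‖x - c‖ ≤ 4 * r := by linarith
        _ = r ^ 2 * (4 / r) := by field_simp
    calc _ ≤ M * (4 / r) := mul_le_mul (hM _) h5 (by positivity) hM0
      _ = _ := by ring
  · rw [indicator_of_notMem hx]
    rw [mem_closedBall_iff_norm, not_le] at hx
    rw [deriv_profile_of_notMem, zero_smul, norm_zero]
    · norm_num
    · rw [mem_Icc, not_and_or]
      left
      have : 4 ≤ ‖x - c‖ ^ 2 / r ^ 2 := by
        rw [le_div_iff₀ (by positivity)]
        nlinarith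
      linarith

end Bump

/-- With `S = ∑ bᵢ²`, Cauchy–Schwarz gives `‖∇S‖² ≤ 4 S ∑ ‖∇bᵢ‖²`, and the profile is constant where
`S > 1`. So the energy is bounded by the sum of the energies, regardless of how the supports
overlap. -/
theorem norm_fderiv_profile_sum_sq_le {d : ℕ} {α : Type*} (s : Finset α) {b : α → Space d → ℝ}
    (hb : ∀ i ∈ s, ContDiff ℝ 1 (b i)) {M : ℝ} (hM : ∀ v, deriv profile v ≤ M) (x : Space d) :
    ‖fderiv ℝ (fun x => 1 - profile (1 + ∑ i ∈ s, b i x ^ 2)) x‖ ^ 2 ≤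
      4 * M ^ 2 * ∑ i ∈ s, ‖fderiv ℝ (b i) x‖ ^ 2 := by
  have h1 : HasFDerivAt (fun x => 1 + ∑ i ∈ s, b i x ^ 2)
      (∑ i ∈ s, (2 * b i x) • fderiv ℝ (b i) x) x := by
    refine HasFDerivAt.const_add 1 (HasFDerivAt.fun_sum fun i hi => ?_)
    have := (((hb i hi).differentiable (by norm_num)) x).hasFDerivAt.pow 2
    simpa using this
  have h2 := ((((contDiff_profile.differentiable (by norm_num))
    (1 + ∑ i ∈ s, b i x ^ 2)).hasDerivAt).comp_hasFDerivAt x h1).const_sub 1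
  have h3 : fderiv ℝ (fun x => 1 - profile (1 + ∑ i ∈ s, b i x ^ 2)) x = _ := h2.fderiv
  rw [h3, norm_neg, norm_smul, Real.norm_of_nonneg (deriv_profile_nonneg _)]
  have hS : 0 ≤ ∑ i ∈ s, b i x ^ 2 := Finset.sum_nonneg fun i _ => sq_nonneg _
  have hT : 0 ≤ ∑ i ∈ s, ‖fderiv ℝ (b i) x‖ ^ 2 := Finset.sum_nonneg fun i _ => sq_nonneg _
  have hCS : ‖∑ i ∈ s, (2 * b i x) • fderiv ℝ (b i) x‖ ^ 2 ≤
      4 * ((∑ i ∈ s, b i x ^ 2) * ∑ i ∈ s, ‖fderiv ℝ (b i) x‖ ^ 2) := by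
    calc _ ≤ (∑ i ∈ s, (2 * |b i x|) * ‖fderiv ℝ (b i) x‖) ^ 2 := by
          refine pow_le_pow_left₀ (norm_nonneg _) ((norm_sum_le _ _).trans_eq ?_) 2
          refine Finset.sum_congr rfl fun i _ => ?_
          rw [norm_smul, norm_mul, Real.norm_ofNat, Real.norm_eq_abs]
      _ ≤ (∑ i ∈ s, (2 * |b i x|) ^ 2) * ∑ i ∈ s, ‖fderiv ℝ (b i) x‖ ^ 2 :=
          Finset.sum_mul_sq_le_sq_mul_sq _ _ _
      _ = _ := by
          simp_rw [mul_pow, sq_abs]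
          rw [← Finset.mul_sum]
          ring
  by_cases hle : ∑ i ∈ s, b i x ^ 2 ≤ 1
  · have hP : deriv profile (1 + ∑ i ∈ s, b i x ^ 2) ^ 2 ≤ M ^ 2 :=
      pow_le_pow_left₀ (deriv_profile_nonneg _) (hM _) 2
    rw [mul_pow]
    calc _ ≤ M ^ 2 * (4 * ((∑ i ∈ s, b i x ^ 2) * ∑ i ∈ s, ‖fderiv ℝ (b i) x‖ ^ 2)) :=
          mul_le_mul hP hCS (sq_nonneg _) (sq_nonneg _)
      _ ≤ M ^ 2 * (4 * (1 * ∑ i ∈ s, ‖fderiv ℝ (b i) x‖ ^ 2)) := by gcongr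
      _ = _ := by ring
  · rw [deriv_profile_of_notMem (by rw [mem_Icc]; intro h; linarith [h.2]), zero_mul]
    rw [zero_pow two_ne_zero]
    positivity

theorem norm_gradient_eq {d : ℕ} (f : Space d → ℝ) (x : Space d) :
    ‖gradient f x‖ = ‖fderiv ℝ f x‖ := by
  simp [gradient]

/-- A compact set of finite `(d-2)`-dimensional Hausdorff measure can be cut off by functions of
bounded Dirichlet energy. -/
theorem exists_cutoff {k : ℕ} {Z : Set (Space (k + 1))} (hZ : IsCompact Z)
    (hfin : μH[((k + 1 : ℕ) : ℝ) - 2] Z < ⊤) :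
    ∃ M : ℝ, ∀ ε > 0, ∃ η : Space (k + 1) → ℝ, ContDiff ℝ 1 η ∧
      (∀ x, 0 ≤ η x) ∧ (∀ x, η x ≤ 1) ∧ Disjoint (tsupport η) Z ∧
      (∀ x ∉ Metric.cthickening ε Z, η x = 1) ∧
      Integrable (fun x => ‖gradient η x‖ ^ 2) ∧ ∫ x, ‖gradient η x‖ ^ 2 ≤ M := by
  rcases k with _ | j
  · have hZe : Z = ∅ := eq_empty_of_hausdorffMeasure_lt_top (by norm_num) hfin
    refine ⟨0, fun ε _ => ⟨fun _ => 1, contDiff_const, fun _ => zero_le_one, fun _ => le_rfl,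
      by simp [hZe], fun _ _ => rfl, ?_, ?_⟩⟩ <;> simp
  · have hfin' : μH[(j : ℝ)] Z < ⊤ := by
      convert hfin using 3
      push_cast
      ring
    obtain ⟨M₀, hM₀, hcov⟩ := exists_finite_ball_cover hZ hfin'
    obtain ⟨M₁, hM₁, hP⟩ := exists_deriv_profile_le
    obtain ⟨M₂, hM₂, hB⟩ := exists_norm_fderiv_bump_le (j + 1 + 1)
    set V := volume.real (Metric.ball (0 : Space (j + 1 + 1)) 1) with hV
    -- In dimension `j + 2` the ball of radius `2 r` has volume `(2 r)^(j+2) V`; times `M₂ / r²`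
    -- this is `M₂ 2^(j+2) V r^j`, and `M₀` bounds the sum of the `r^j`.
    refine ⟨4 * M₁ ^ 2 * (M₂ * 2 ^ (j + 2) * V * M₀), fun ε hε => ?_⟩
    obtain ⟨s, c, r, hs, hcovs, hsum⟩ := hcov (ε / 2) (by positivity)
    set S : Space (j + 1 + 1) → ℝ := fun x => ∑ n ∈ s, bump (c n) (r n) x ^ 2 with hS
    have hη : ContDiff ℝ 1 fun x => 1 - profile (1 + S x) :=
      contDiff_const.sub (contDiff_profile.comp
        (contDiff_const.add (ContDiff.sum fun n _ => contDiff_bump.pow 2)))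
    have hgrad : ∀ x, ‖gradient (fun x => 1 - profile (1 + S x)) x‖ ^ 2 ≤ 4 * M₁ ^ 2 *
        ∑ n ∈ s, (Metric.closedBall (c n) (2 * r n)).indicator (fun _ => M₂ / r n ^ 2) x := by
      intro x
      rw [norm_gradient_eq]
      refine (norm_fderiv_profile_sum_sq_le s (fun _ _ => contDiff_bump) hP x).trans ?_
      refine mul_le_mul_of_nonneg_left (Finset.sum_le_sum fun n hn => ?_) (by positivity)
      exact hB _ _ (hs n hn).2.1 x
    have hii : ∀ n, Integrable ((Metric.closedBall (c n) (2 * r n)).indicator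
        (fun _ => M₂ / r n ^ 2)) volume := fun n =>
      (integrable_indicator_iff measurableSet_closedBall).2
        (integrableOn_const measure_closedBall_lt_top.ne)
    have hint : Integrable fun x => 4 * M₁ ^ 2 *
        ∑ n ∈ s, (Metric.closedBall (c n) (2 * r n)).indicator (fun _ => M₂ / r n ^ 2) x :=
      (integrable_finsetSum _ fun n _ => hii n).const_mul _
    have hgi : Integrable fun x => ‖gradient (fun x => 1 - profile (1 + S x)) x‖ ^ 2 := by
      refine hint.mono' ((continuous_gradient hη).norm.pow 2).aestronglyMeasurable
        (Eventually.of_forall fun x => ?_)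
      rw [Real.norm_of_nonneg (sq_nonneg _)]
      exact hgrad x
    refine ⟨fun x => 1 - profile (1 + S x), hη, fun x => ?_, fun x => ?_, ?_, ?_, hgi, ?_⟩
    · linarith [profile_le_one (1 + S x)]
    · linarith [profile_nonneg (1 + S x)]
    · rw [disjoint_right]
      intro z hz
      rw [notMem_tsupport_iff_eventuallyEq]
      obtain ⟨n, hn, hzn⟩ := mem_iUnion₂.1 (hcovs hz)
      filter_upwards [Metric.isOpen_ball.mem_nhds hzn] with y hy
      have : 1 ≤ S y := by
        have h1 := Finset.single_le_sum (f := fun n => bump (c n) (r n) y ^ 2)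
          (fun n _ => sq_nonneg _) hn
        simpa [bump_of_mem_ball (hs n hn).2.1 hy] using h1
      rw [profile_of_ge (by linarith)]
      simp
    · intro x hx
      have : S x = 0 := by
        refine Finset.sum_eq_zero fun n hn => ?_
        rw [bump_of_le_norm (hs n hn).2.1, zero_pow two_ne_zero]
        by_contra! hlt
        refine hx (Metric.mem_cthickening_of_dist_le x (c n) ε Z (hs n hn).1 ?_)
        rw [dist_eq_norm]
        linarith [(hs n hn).2.2]
      simp only [this]
      rw [profile_of_le (by norm_num), sub_zero]
    · refine (integral_mono hgi hint hgrad).trans ?_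
      rw [integral_const_mul, integral_finsetSum _ fun n _ => hii n]
      refine mul_le_mul_of_nonneg_left ?_ (by positivity)
      rw [mul_assoc, mul_comm V, ← mul_assoc]
      calc _ = ∑ n ∈ s, M₂ * 2 ^ (j + 2) * V * r n ^ j := by
            refine Finset.sum_congr rfl fun n hn => ?_
            have hr := (hs n hn).2.1
            rw [integral_indicator measurableSet_closedBall, setIntegral_const, smul_eq_mul,
              Measure.addHaar_real_closedBall _ _ (by positivity), finrank_euclideanSpace_fin, ← hV]
            field_simp
            ring
        _ = M₂ * 2 ^ (j + 2) * V * ∑ n ∈ s, r n ^ j := by rw [Finset.mul_sum]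
        _ ≤ M₂ * 2 ^ (j + 2) * V * M₀ := mul_le_mul_of_nonneg_left hsum (by positivity)
        _ = _ := by ring

/-! ### The divergence theorem up to the singular set -/

section

theorem eventually_notMem_cthickening {X : Type*} [PseudoEMetricSpace X] {Z : Set X}
    (hZ : IsClosed Z) {x : X} (hx : x ∉ Z) {ε : ℕ → ℝ} (hε : Tendsto ε atTop (𝓝 0)) :
    ∀ᶠ n in atTop, x ∉ Metric.cthickening (ε n) Z := by
  have : ∃ δ > 0, x ∉ Metric.cthickening δ Z := by
    by_contra! hc
    apply hx
    rw [← hZ.closure_eq, Metric.closure_eq_iInter_cthickening]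
    exact mem_iInter₂.2 hc
  obtain ⟨δ, hδ, hxδ⟩ := this
  filter_upwards [hε.eventually_lt_const hδ] with n hn hxn
  exact hxδ (Metric.cthickening_mono hn.le _ hxn)

/-- Finite measure in dimension `d - 2` forces measure zero in the larger dimension `d - 1`, so `Z`
is negligible for surface integrals. -/
theorem euclideanHausdorffMeasure_eq_zero {k : ℕ} {Z : Set (Space (k + 1))}
    (h : μH[((k + 1 : ℕ) : ℝ) - 2] Z < ⊤) : μHE[k] Z = 0 := by
  rw [Measure.euclideanHausdorffMeasure_def, Measure.smul_apply]
  rcases Measure.hausdorffMeasure_zero_or_top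
    (show ((k + 1 : ℕ) : ℝ) - 2 < k by push_cast; linarith) Z with h1 | h1
  · rw [h1, smul_zero]
  · exact absurd h1 h.ne

variable {k : ℕ} {Ω : Set (Space (k + 1))}

theorem integrableOn_inner_of_sq {α : Type*} [MeasurableSpace α] {μ : Measure α} {d : ℕ}
    {f g : α → Space d} (hf : AEStronglyMeasurable f μ) (hg : AEStronglyMeasurable g μ)
    (hf2 : Integrable (fun x => ‖f x‖ ^ 2) μ) (hg2 : Integrable (fun x => ‖g x‖ ^ 2) μ) :
    Integrable (fun x => ⟪f x, g x⟫) μ := by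
  refine (hf2.add hg2).mono' (hf.inner hg) (Eventually.of_forall fun x => ?_)
  refine (norm_inner_le_norm _ _).trans ?_
  simp only [Pi.add_apply]
  nlinarith [sq_nonneg (‖f x‖ - ‖g x‖), sq_nonneg (‖f x‖ + ‖g x‖)]

/-- The divergence theorem for fields which are square integrable, differentiable in the domain and
continuous up to the boundary except at a set of finite `(d-2)`-dimensional Hausdorff measure. -/
theorem integral_divergence_eq_flux (hΩ : IsOpen Ω) (hbdd : Bornology.IsBounded Ω)
    {Z : Set (Space (k + 1))} (hZ : IsClosed Z) (hZf : Z ⊆ frontier Ω)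
    (hZs : singularBoundary Ω ⊆ Z) (hfin : μH[((k + 1 : ℕ) : ℝ) - 2] Z < ⊤)
    {F : Space (k + 1) → Space (k + 1)} (hd : DifferentiableOn ℝ F Ω)
    (hc : ContinuousOn F (closure Ω \ Z)) (hL2 : MemLp F 2 (volume.restrict Ω))
    (hdiv : IntegrableOn (divergence F) Ω)
    (hflux : IntegrableOn (fun x => ⟪F x, outwardNormal Ω x⟫) (frontier Ω) μHE[k]) :
    ∫ x in Ω, divergence F x = ∫ x in frontier Ω, ⟪F x, outwardNormal Ω x⟫ ∂μHE[k] := by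
  have hcl : IsCompact (closure Ω) := hbdd.isCompact_closure
  have hZc : IsCompact Z := hcl.of_isClosed_subset hZ (hZf.trans frontier_subset_closure)
  have hZΩ : ∀ x ∈ Ω, x ∉ Z := fun x hx hxZ => by
    have := hZf hxZ
    rw [hΩ.frontier_eq] at this
    exact this.2 hx
  have hF2 : IntegrableOn (fun x => ‖F x‖ ^ 2) Ω := hL2.integrable_norm_pow two_ne_zero
  obtain ⟨M, hM⟩ := exists_cutoff hZc hfin
  have hε : ∀ n : ℕ, (0 : ℝ) < 1 / ((n : ℝ) + 1) := fun n => Nat.one_div_pos_of_nat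
  choose η hη h0 h1 hdis hone hgi hgM using fun n : ℕ => hM (1 / ((n : ℝ) + 1)) (hε n)
  have hlim : Tendsto (fun n : ℕ => 1 / ((n : ℝ) + 1)) atTop (𝓝 0) :=
    tendsto_one_div_add_atTop_nhds_zero_nat
  have hηlim : ∀ x ∉ Z, ∀ᶠ n in atTop, η n x = 1 := fun x hx => by
    filter_upwards [eventually_notMem_cthickening hZ hx hlim] with n hn using hone n x hn
  have hi1 : ∀ n, IntegrableOn (fun x => η n x * divergence F x) Ω := fun n =>
    Integrable.bdd_mul hdiv (c := 1) (hη n).continuous.aestronglyMeasurable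
      (Eventually.of_forall fun x => by rw [Real.norm_of_nonneg (h0 n x)]; exact h1 n x)
  have hi2 : ∀ n, IntegrableOn (fun x => ⟪gradient (η n) x, F x⟫) Ω := fun n =>
    integrableOn_inner_of_sq (continuous_gradient (hη n)).aestronglyMeasurable
      hL2.aestronglyMeasurable (hgi n).integrableOn hF2
  have hgg : ∀ n, (∫ x in Ω, η n x * divergence F x) + ∫ x in Ω, ⟪gradient (η n) x, F x⟫ =
      ∫ x in frontier Ω, η n x * ⟪F x, outwardNormal Ω x⟫ ∂μHE[k] := by
    intro n
    -- Cutting to `closure Ω` provides compact support without changing the field on `closure Ω`;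
    -- the factor `η n` removes the singularities at `Z`.
    set G : Space (k + 1) → Space (k + 1) := fun x => η n x • (closure Ω).indicator F x with hG
    have hGeq : ∀ x ∈ closure Ω, G x = η n x • F x := fun x hx => by
      rw [hG]
      simp only [indicator_of_mem hx]
    have hGΩ : ∀ x ∈ Ω, G =ᶠ[𝓝 x] fun x => η n x • F x := fun x hx => by
      filter_upwards [hΩ.mem_nhds hx] with y hy using hGeq y (subset_closure hy)
    have hFat : ∀ x ∈ Ω, DifferentiableAt ℝ F x := fun x hx =>
      hd.differentiableAt (hΩ.mem_nhds hx)
    have hηat : ∀ x, DifferentiableAt ℝ (η n) x := (hη n).differentiable (by norm_num)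
    have hGd : DifferentiableOn ℝ G Ω := fun x hx =>
      ((hGΩ x hx).differentiableAt_iff.2 ((hηat x).smul (hFat x hx))).differentiableWithinAt
    have hGdiv : ∀ x ∈ Ω, divergence G x = η n x * divergence F x + ⟪gradient (η n) x, F x⟫ :=
      fun x hx => by rw [divergence_congr (hGΩ x hx), divergence_smul (hηat x) (hFat x hx)]
    have hGts : tsupport G ⊆ tsupport (η n) :=
      closure_mono (Function.support_smul_subset_left (η n) ((closure Ω).indicator F))
    have hGc : ContinuousOn G (closure Ω) := by
      intro x hx
      by_cases hxZ : x ∈ Z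
      · have hxt : x ∉ tsupport G := fun hxt => disjoint_left.1 (hdis n) (hGts hxt) hxZ
        exact (continuousAt_const.congr
          (notMem_tsupport_iff_eventuallyEq.1 hxt).symm).continuousWithinAt
      · have h2 : ContinuousWithinAt F (closure Ω) x := by
          have := hc x ⟨hx, hxZ⟩
          rwa [sdiff_eq, continuousWithinAt_inter (hZ.isOpen_compl.mem_nhds hxZ)] at this
        exact ((hη n).continuous.continuousWithinAt.smul h2).congr hGeq (hGeq x hx)
    have hGcs : HasCompactSupport G :=
      HasCompactSupport.of_support_subset_isCompact hcl fun x hx => by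
        by_contra hxc
        exact hx (by simp [hG, indicator_of_notMem hxc])
    have hGi : IntegrableOn (divergence G) Ω :=
      ((hi1 n).add (hi2 n)).congr_fun (fun x hx => (hGdiv x hx).symm) hΩ.measurableSet
    obtain ⟨-, e⟩ := integral_divergence_of_disjoint_singularBoundary hΩ hbdd hGd hGc hGcs
      ((hdis n).mono hGts hZs) hGi
    rw [← integral_add (hi1 n) (hi2 n), ← setIntegral_congr_fun hΩ.measurableSet hGdiv, e]
    refine setIntegral_congr_fun isClosed_frontier.measurableSet fun x hx => ?_
    simp only [hGeq x (frontier_subset_closure hx), real_inner_smul_left]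
  have t1 : Tendsto (fun n => ∫ x in Ω, η n x * divergence F x) atTop
      (𝓝 (∫ x in Ω, divergence F x)) := by
    refine tendsto_integral_of_dominated_convergence (fun x => ‖divergence F x‖)
      (fun n => (hi1 n).aestronglyMeasurable) hdiv.norm (fun n => Eventually.of_forall fun x => ?_)
      ?_
    · rw [norm_mul, Real.norm_of_nonneg (h0 n x)]
      exact mul_le_of_le_one_left (norm_nonneg _) (h1 n x)
    · filter_upwards [ae_restrict_mem hΩ.measurableSet] with x hx
      refine tendsto_const_nhds.congr' ?_
      filter_upwards [hηlim x (hZΩ x hx)] with n hn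
      rw [hn, one_mul]
  have t2 : Tendsto (fun n => ∫ x in frontier Ω, η n x * ⟪F x, outwardNormal Ω x⟫ ∂μHE[k]) atTop
      (𝓝 (∫ x in frontier Ω, ⟪F x, outwardNormal Ω x⟫ ∂μHE[k])) := by
    refine tendsto_integral_of_dominated_convergence (fun x => ‖⟪F x, outwardNormal Ω x⟫‖)
      (fun n => (hη n).continuous.aestronglyMeasurable.mul hflux.aestronglyMeasurable) hflux.norm
      (fun n => Eventually.of_forall fun x => ?_) ?_
    · rw [norm_mul, Real.norm_of_nonneg (h0 n x)]
      exact mul_le_of_le_one_left (norm_nonneg _) (h1 n x)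
    · have hnull : ∀ᵐ x ∂(μHE[k] : Measure (Space (k + 1))).restrict (frontier Ω), x ∉ Z :=
        ae_restrict_of_ae (measure_eq_zero_iff_ae_notMem.1 (euclideanHausdorffMeasure_eq_zero hfin))
      filter_upwards [hnull] with x hx
      refine tendsto_const_nhds.congr' ?_
      filter_upwards [hηlim x hx] with n hn
      rw [hn, one_mul]
  -- The thickenings shrink to `Z`, which is disjoint from `Ω`, so dominated convergence applies.
  have hthick : Tendsto (fun n : ℕ => ∫ x in Ω, (Metric.cthickening (1 / ((n : ℝ) + 1)) Z).indicator
      (fun x => ‖F x‖ ^ 2) x) atTop (𝓝 0) := by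
    have : (0 : ℝ) = ∫ x in Ω, (0 : ℝ) := by simp
    rw [this]
    refine tendsto_integral_of_dominated_convergence (fun x => ‖F x‖ ^ 2)
      (fun n => hF2.aestronglyMeasurable.indicator Metric.isClosed_cthickening.measurableSet) hF2
      (fun n => Eventually.of_forall fun x => ?_) ?_
    · refine (norm_indicator_le_norm_self _ _).trans ?_
      rw [Real.norm_of_nonneg (sq_nonneg _)]
    · filter_upwards [ae_restrict_mem hΩ.measurableSet] with x hx
      refine tendsto_const_nhds.congr' ?_
      filter_upwards [eventually_notMem_cthickening hZ (hZΩ x hx) hlim] with n hn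
      rw [indicator_of_notMem hn]
  -- Young's inequality with a free weight `c`. The gradient of `η n` vanishes off the thickening,
  -- where `η n` is locally `1`, so only the part of `F` near `Z` enters.
  have hyoung : ∀ n, ∀ c > 0, |∫ x in Ω, ⟪gradient (η n) x, F x⟫| ≤ c * M + c⁻¹ *
      ∫ x in Ω, (Metric.cthickening (1 / ((n : ℝ) + 1)) Z).indicator (fun x => ‖F x‖ ^ 2) x := by
    intro n c hcp
    have j1 : IntegrableOn (fun x => c * ‖gradient (η n) x‖ ^ 2) Ω :=
      (hgi n).integrableOn.const_mul c
    have j2 : IntegrableOn (fun x => c⁻¹ * (Metric.cthickening (1 / ((n : ℝ) + 1)) Z).indicator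
        (fun x => ‖F x‖ ^ 2) x) Ω :=
      Integrable.const_mul (hF2.indicator Metric.isClosed_cthickening.measurableSet) c⁻¹
    calc |∫ x in Ω, ⟪gradient (η n) x, F x⟫| ≤ ∫ x in Ω, (c * ‖gradient (η n) x‖ ^ 2 + c⁻¹ *
          (Metric.cthickening (1 / ((n : ℝ) + 1)) Z).indicator (fun x => ‖F x‖ ^ 2) x) := by
          rw [← Real.norm_eq_abs]
          refine norm_integral_le_of_norm_le (j1.add j2) (Eventually.of_forall fun x => ?_)
          by_cases hx : x ∈ Metric.cthickening (1 / ((n : ℝ) + 1)) Z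
          · rw [indicator_of_mem hx]
            refine (norm_inner_le_norm _ _).trans ?_
            have h3 : c * ‖gradient (η n) x‖ ^ 2 + c⁻¹ * ‖F x‖ ^ 2 -
                2 * (‖gradient (η n) x‖ * ‖F x‖) = c⁻¹ * (c * ‖gradient (η n) x‖ - ‖F x‖) ^ 2 := by
              field_simp
              ring
            have h4 : 0 ≤ c⁻¹ * (c * ‖gradient (η n) x‖ - ‖F x‖) ^ 2 := by positivity
            have h5 : 0 ≤ ‖gradient (η n) x‖ * ‖F x‖ := by positivity
            linarith
          · rw [indicator_of_notMem hx]
            have : η n =ᶠ[𝓝 x] fun _ => 1 := by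
              filter_upwards [Metric.isClosed_cthickening.isOpen_compl.mem_nhds hx] with y hy
              exact hone n y hy
            have : gradient (η n) x = 0 := by
              rw [gradient, this.fderiv_eq]
              simp
            simp [this]
      _ = c * (∫ x in Ω, ‖gradient (η n) x‖ ^ 2) + c⁻¹ *
          ∫ x in Ω, (Metric.cthickening (1 / ((n : ℝ) + 1)) Z).indicator
            (fun x => ‖F x‖ ^ 2) x := by
          rw [integral_add j1 j2, integral_const_mul, integral_const_mul]
      _ ≤ _ := by
          refine add_le_add (mul_le_mul_of_nonneg_left ?_ hcp.le) le_rfl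
          exact (setIntegral_le_integral (hgi n) (Eventually.of_forall fun x => sq_nonneg _)).trans
            (hgM n)
  have t3 : Tendsto (fun n => ∫ x in Ω, ⟪gradient (η n) x, F x⟫) atTop (𝓝 0) := by
    rw [Metric.tendsto_nhds]
    intro ε hε
    -- The energy is bounded but need not tend to zero: `c` first makes its contribution at most `ε
    -- / 2`, then a large `n` makes the term with `c⁻¹` small.
    set c := ε / (2 * (|M| + 1)) with hcdef
    have hcp : 0 < c := by positivity
    have hcM : c * M ≤ ε / 2 := by
      refine (mul_le_mul_of_nonneg_left (le_abs_self M) hcp.le).trans ?_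
      rw [hcdef, div_mul_eq_mul_div, div_le_div_iff₀ (by positivity) (by positivity)]
      nlinarith [abs_nonneg M]
    have := hthick.const_mul c⁻¹
    rw [mul_zero] at this
    filter_upwards [this.eventually_lt_const (half_pos hε)] with n hn
    rw [dist_zero_right, Real.norm_eq_abs]
    linarith [hyoung n c hcp]
  have t4 := t1.add t3
  rw [add_zero] at t4
  exact tendsto_nhds_unique (t4.congr hgg) t2

end

/-! ### The drag tensor and the energy identity of one network -/

/-- The drag tensor of a network with porosity `φ` and permeability `K`. -/
noncomputable def drag {d : ℕ} (μ : ℝ) (φ : Space d → ℝ) (K : Space d → Matrix (Fin d) (Fin d) ℝ)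
    (x : Space d) : Space d →L[ℝ] Space d :=
  Matrix.toEuclideanCLM (𝕜 := ℝ) ((μ * φ x ^ 2) • (K x)⁻¹)

theorem inner_drag_comm {d : ℕ} {μ : ℝ} {φ : Space d → ℝ}
    {K : Space d → Matrix (Fin d) (Fin d) ℝ} {x : Space d} (hK : (K x).IsSymm) (ξ η : Space d) :
    ⟪drag μ φ K x ξ, η⟫ = ⟪drag μ φ K x η, ξ⟫ := by
  have h1 : star ((μ * φ x ^ 2) • (K x)⁻¹) = (μ * φ x ^ 2) • (K x)⁻¹ := by
    rw [Matrix.star_eq_conjTranspose, Matrix.conjTranspose_eq_transpose_of_trivial,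
      Matrix.transpose_smul, Matrix.transpose_nonsing_inv, hK.eq]
  have h2 : ContinuousLinearMap.adjoint (drag μ φ K x) = drag μ φ K x := by
    rw [← ContinuousLinearMap.star_eq_adjoint, drag, ← map_star, h1]
  rw [← h2, ContinuousLinearMap.adjoint_inner_left, h2, real_inner_comm]

/-- Apply coercivity to `w = A⁻¹ ξ` and use Cauchy–Schwarz: `c ‖w‖² ≤ ⟪w, ξ⟫ ≤ ‖w‖ ‖ξ‖`. -/
theorem norm_toEuclideanCLM_inv_le {d : ℕ} {A : Matrix (Fin d) (Fin d) ℝ} {c : ℝ} (hc : 0 < c)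
    (hA : ∀ ξ : Space d, c * ‖ξ‖ ^ 2 ≤ ⟪ξ, Matrix.toEuclideanCLM (𝕜 := ℝ) A ξ⟫) (ξ : Space d) :
    ‖Matrix.toEuclideanCLM (𝕜 := ℝ) A⁻¹ ξ‖ ≤ c⁻¹ * ‖ξ‖ := by
  by_cases hu : IsUnit A.det
  · set w := Matrix.toEuclideanCLM (𝕜 := ℝ) A⁻¹ ξ with hw
    have h1 : Matrix.toEuclideanCLM (𝕜 := ℝ) A w = ξ := by
      rw [hw, ← mul_apply_eq_comp, ← map_mul, Matrix.mul_nonsing_inv _ hu, map_one]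
      rfl
    have h2 := hA w
    rw [h1] at h2
    have h3 := h2.trans (real_inner_le_norm w ξ)
    rw [← div_eq_inv_mul, le_div_iff₀ hc]
    rcases (norm_nonneg w).eq_or_lt with h4 | h4
    · rw [← h4, zero_mul]; exact norm_nonneg _
    · nlinarith
  -- For a non-unit determinant the matrix inverse is `0` by convention, so the bound is trivial.
  · rw [Matrix.nonsing_inv_apply_not_isUnit _ hu, map_zero]
    simp only [zero_apply, norm_zero]
    positivity

theorem exists_norm_drag_le {d : ℕ} {Ω : Set (Space d)} {μ : ℝ} {φ : Space d → ℝ}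
    {K : Space d → Matrix (Fin d) (Fin d) ℝ} (hK : IsPermeability Ω K) {C : ℝ}
    (hφ : ∀ x ∈ Ω, ‖φ x‖ ≤ C) :
    ∃ B, ∀ x ∈ Ω, ∀ ξ, ‖drag μ φ K x ξ‖ ≤ B * ‖ξ‖ := by
  obtain ⟨c, hc, hell⟩ := hK.elliptic
  refine ⟨|μ| * C ^ 2 * c⁻¹, fun x hx ξ => ?_⟩
  rw [drag, map_smul, smul_apply, norm_smul, norm_mul, norm_pow,
    Real.norm_eq_abs μ, mul_assoc (|μ| * C ^ 2)]
  have := hφ x hx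
  exact mul_le_mul (by gcongr) (norm_toEuclideanCLM_inv_le hc (hell x hx) ξ) (norm_nonneg _)
    (by positivity)

theorem subset_closure_sdiff_of_subset_frontier {d : ℕ} {Ω N : Set (Space d)} (hΩ : IsOpen Ω)
    (hN : N ⊆ frontier Ω) : Ω ⊆ closure Ω \ N := fun x hx =>
  ⟨subset_closure hx, fun hxN => by
    have := hN hxN
    rw [hΩ.frontier_eq] at this
    exact this.2 hx⟩

theorem abs_le_of_continuousOn_closure_sdiff {d : ℕ} {Ω N : Set (Space d)} (hΩ : IsOpen Ω)
    (hN : N ⊆ frontier Ω) {p : Space d → ℝ} (hp : ContinuousOn p (closure Ω \ N)) {C : ℝ}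
    (hC : ∀ x ∈ Ω, |p x| ≤ C) {x : Space d} (hx : x ∈ closure Ω \ N) : |p x| ≤ C := by
  have h1 := ((hp x hx).mono (subset_closure_sdiff_of_subset_frontier hΩ hN)).mem_closure_image hx.1
  have h2 : closure (p '' Ω) ⊆ {y | |y| ≤ C} := by
    refine closure_minimal ?_ (isClosed_le continuous_abs continuous_const)
    rintro _ ⟨y, hy, rfl⟩
    exact hC y hy
  exact h2 h1

/-- The bound on `p` in `Ω` passes by continuity to the boundary outside the null set `N`, and a
bounded factor preserves integrability of the flux. -/
theorem IsRegular.integrableOn_flux {k : ℕ} {Ω : Set (Space (k + 1))} (hΩ : IsOpen Ω)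
    {φ : Space (k + 1) → ℝ} {v v' : Space (k + 1) → Space (k + 1)} {p p' : Space (k + 1) → ℝ}
    (h : IsRegular Ω φ v p) (h' : IsRegular Ω φ v' p') :
    IntegrableOn (fun x => p x * (φ x * ⟪v' x, outwardNormal Ω x⟫)) (frontier Ω) μHE[k] := by
  obtain ⟨N, hNf, hN, hNμ, hp, -⟩ := h.continuous_closure
  obtain ⟨C, hC⟩ := h.bounded_pressure
  have hN0 := euclideanHausdorffMeasure_eq_zero hNμ
  have hmeas : MeasurableSet (frontier Ω) := isClosed_frontier.measurableSet
  have hsub : frontier Ω \ N ⊆ closure Ω \ N := sdiff_subset_sdiff_left frontier_subset_closure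
  refine Integrable.bdd_mul h'.integrable_flux (c := C) ?_ ?_
  · have h1 : (μHE[k] : Measure (Space (k + 1))).restrict (frontier Ω \ N) =
        (μHE[k] : Measure (Space (k + 1))).restrict (frontier Ω) :=
      Measure.restrict_congr_set (sdiff_null_ae_eq_self hN0)
    have h2 := (hp.mono hsub).aestronglyMeasurable (μ := μHE[k]) (hmeas.diff hN.measurableSet)
    rw [h1] at h2
    exact h2
  · filter_upwards [ae_restrict_mem hmeas,
      ae_restrict_of_ae (measure_eq_zero_iff_ae_notMem.1 hN0)] with x hx hxN
    exact abs_le_of_continuousOn_closure_sdiff hΩ hNf hp hC (hsub ⟨hx, hxN⟩)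

/-- The energy identity of one network for a force and pressure of one state and a velocity of
another one. -/
theorem network_identity {k : ℕ} {Ω : Set (Space (k + 1))} (hΩ : IsOpen Ω)
    (hbdd : Bornology.IsBounded Ω) (hsmooth : HasPiecewiseSmoothBoundary Ω) {μ γ : ℝ}
    {φ : Space (k + 1) → ℝ} (hφ : ContinuousOn φ (closure Ω))
    {K : Space (k + 1) → Matrix (Fin (k + 1)) (Fin (k + 1)) ℝ} (hK : IsPermeability Ω K)
    {b v v' : Space (k + 1) → Space (k + 1)} {p p' χ : Space (k + 1) → ℝ}
    (h : IsRegular Ω φ v p) (h' : IsRegular Ω φ v' p') (hb : MemLp b 2 (volume.restrict Ω))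
    (hmom : ∀ x ∈ Ω, drag μ φ K x (v x) + φ x • gradient p x = (φ x * γ) • b x)
    (hmass : ∀ x ∈ Ω, divergence (fun y => φ y • v' y) x = χ x)
    (hχ : IntegrableOn (fun x => p x * χ x) Ω) :
    IntegrableOn (fun x => φ x * γ * ⟪b x, v' x⟫) Ω ∧
    IntegrableOn (fun x => ⟪drag μ φ K x (v x), v' x⟫) Ω ∧
    (∫ x in Ω, φ x * γ * ⟪b x, v' x⟫) -
      ∫ x in frontier Ω, p x * (φ x * ⟪v' x, outwardNormal Ω x⟫) ∂μHE[k] =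
    (∫ x in Ω, ⟪drag μ φ K x (v x), v' x⟫) - ∫ x in Ω, p x * χ x := by
  have hΩm := hΩ.measurableSet
  obtain ⟨C, hC⟩ := hbdd.isCompact_closure.exists_bound_of_continuousOn hφ
  have hC : ∀ x ∈ Ω, ‖φ x‖ ≤ C := fun x hx => hC x (subset_closure hx)
  obtain ⟨B, hB⟩ := exists_norm_drag_le (μ := μ) hK hC
  obtain ⟨Cp, hCp⟩ := h.bounded_pressure
  have hφm : AEStronglyMeasurable φ (volume.restrict Ω) :=
    (hφ.mono subset_closure).aestronglyMeasurable hΩm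
  have hφb : ∀ᵐ x ∂volume.restrict Ω, ‖φ x‖ ≤ C := by
    filter_upwards [ae_restrict_mem hΩm] with x hx using hC x hx
  have hforce : MemLp (fun x => (φ x * γ) • b x) 2 (volume.restrict Ω) := by
    refine MemLp.of_le_mul (c := C * |γ|) hb
      ((hφm.mul_const γ).smul hb.aestronglyMeasurable) ?_
    filter_upwards [hφb] with x hx
    rw [norm_smul, norm_mul, Real.norm_eq_abs γ]
    gcongr
  have hdragL2 : MemLp (fun x => drag μ φ K x (v x)) 2 (volume.restrict Ω) := by
    refine MemLp.of_le_mul (c := B) h.memLp_velocity ?_ ?_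
    -- Measurability of the drag term is read off from the momentum balance, which expresses it
    -- through `b` and `gradient p`.
    · have : AEStronglyMeasurable (fun x => (φ x * γ) • b x - φ x • gradient p x)
          (volume.restrict Ω) :=
        hforce.aestronglyMeasurable.sub
          (hφm.smul (measurable_gradient p).aestronglyMeasurable)
      refine this.congr ?_
      filter_upwards [ae_restrict_mem hΩm] with x hx
      rw [← hmom x hx, add_sub_cancel_right]
    · filter_upwards [ae_restrict_mem hΩm] with x hx using hB x hx _
  have hin : ∀ f : Space (k + 1) → Space (k + 1), MemLp f 2 (volume.restrict Ω) →
      IntegrableOn (fun x => ⟪f x, v' x⟫) Ω := fun f hf =>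
    integrableOn_inner_of_sq hf.aestronglyMeasurable h'.memLp_velocity.aestronglyMeasurable
      (hf.integrable_norm_pow two_ne_zero) (h'.memLp_velocity.integrable_norm_pow two_ne_zero)
  have i1 : IntegrableOn (fun x => φ x * γ * ⟪b x, v' x⟫) Ω := by
    simpa only [real_inner_smul_left] using hin _ hforce
  have i2 := hin _ hdragL2
  refine ⟨i1, i2, ?_⟩
  obtain ⟨N, hNf, hN, hNμ, hNp, -⟩ := h.continuous_closure
  obtain ⟨N', hNf', hN', hNμ', -, hNv'⟩ := h'.continuous_closure
  set Z := N ∪ N' ∪ singularBoundary Ω with hZdef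
  have hZN : N ⊆ Z := subset_union_left.trans subset_union_left
  have hZN' : N' ⊆ Z := subset_union_right.trans subset_union_left
  -- The gradient of `p` enters only through `φ • gradient p`, which the momentum balance
  -- eliminates; every remaining term is integrable, although `gradient p` itself is not assumed to
  -- be.
  have hdiv : ∀ x ∈ Ω, divergence (fun y => p y • (φ y • v' y)) x =
      p x * χ x + (φ x * γ * ⟪b x, v' x⟫ - ⟪drag μ φ K x (v x), v' x⟫) := by
    intro x hx
    rw [divergence_smul (h.differentiable_pressure.differentiableAt (hΩ.mem_nhds hx))
      (h'.differentiable_discharge.differentiableAt (hΩ.mem_nhds hx)), hmass x hx,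
      ← real_inner_smul_left, ← hmom x hx, inner_add_left, real_inner_smul_left,
      real_inner_smul_right]
    ring
  have hpm : AEStronglyMeasurable p (volume.restrict Ω) :=
    h.differentiable_pressure.continuousOn.aestronglyMeasurable hΩm
  have hflux : ∀ x, ⟪p x • (φ x • v' x), outwardNormal Ω x⟫ =
      p x * (φ x * ⟪v' x, outwardNormal Ω x⟫) := fun x => by
    rw [real_inner_smul_left, real_inner_smul_left]
  have key := integral_divergence_eq_flux hΩ hbdd (Z := Z)
    (F := fun y => p y • (φ y • v' y))
    ((hN.union hN').union (isClosed_singularBoundary hΩ))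
    (union_subset (union_subset hNf hNf') fun x hx => hx.1) subset_union_right
    ((measure_union_le _ _).trans_lt (ENNReal.add_lt_top.2
      ⟨(measure_union_le _ _).trans_lt (ENNReal.add_lt_top.2 ⟨hNμ, hNμ'⟩), hsmooth⟩))
    (h.differentiable_pressure.smul h'.differentiable_discharge)
    ((hNp.mono (sdiff_subset_sdiff_right hZN)).smul ((hφ.mono sdiff_subset).smul
      (hNv'.mono (sdiff_subset_sdiff_right hZN'))))
    (by
      refine MemLp.of_le_mul (c := Cp * C) h'.memLp_velocity
        (hpm.smul (hφm.smul h'.memLp_velocity.aestronglyMeasurable)) ?_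
      filter_upwards [ae_restrict_mem hΩm, hφb] with x hx hx2
      have := hCp x hx
      have h0 : 0 ≤ Cp := (abs_nonneg _).trans this
      rw [norm_smul, norm_smul, Real.norm_eq_abs (p x), ← mul_assoc]
      gcongr)
    ((hχ.add (i1.sub i2)).congr_fun (fun x hx => (hdiv x hx).symm) hΩm)
    (by
      simp_rw [hflux]
      exact h.integrableOn_flux hΩ h')
  simp_rw [hflux] at key
  have i3 : IntegrableOn (fun x => φ x * γ * ⟪b x, v' x⟫ - ⟪drag μ φ K x (v x), v' x⟫) Ω :=
    i1.sub i2
  rw [setIntegral_congr_fun hΩm hdiv, integral_add hχ i3, integral_sub i1 i2] at key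
  linarith

/-- Splitting of the boundary term according to the boundary conditions. -/
theorem boundary_splitting {k : ℕ} {Ω Γv Γp : Set (Space (k + 1))} (hu : Γv ∪ Γp = frontier Ω)
    (hi : Γv ∩ Γp = ∅) (hp : MeasurableSet Γp)
    {φ p p₀ vn : Space (k + 1) → ℝ} {v : Space (k + 1) → Space (k + 1)}
    (hint : IntegrableOn (fun x => p x * (φ x * ⟪v x, outwardNormal Ω x⟫)) (frontier Ω) μHE[k])
    (hvbc : ∀ᵐ x ∂(μHE[k] : Measure (Space (k + 1))).restrict Γv, ⟪v x, outwardNormal Ω x⟫ = vn x)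
    (hpbc : ∀ᵐ x ∂(μHE[k] : Measure (Space (k + 1))).restrict Γp, p x = p₀ x) :
    IntegrableOn (fun x => φ x * p₀ x * ⟪v x, outwardNormal Ω x⟫) Γp μHE[k] ∧
    IntegrableOn (fun x => φ x * p x * vn x) Γv μHE[k] ∧
    surfaceIntegral Γp (fun x => φ x * p₀ x * ⟪v x, outwardNormal Ω x⟫) +
      surfaceIntegral Γv (fun x => φ x * p x * vn x) =
      ∫ x in frontier Ω, p x * (φ x * ⟪v x, outwardNormal Ω x⟫) ∂μHE[k] := by
  have e1 : (fun x => p x * (φ x * ⟪v x, outwardNormal Ω x⟫))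
      =ᵐ[(μHE[k] : Measure (Space (k + 1))).restrict Γp]
      fun x => φ x * p₀ x * ⟪v x, outwardNormal Ω x⟫ := by
    filter_upwards [hpbc] with x hx
    rw [hx]; ring
  have e2 : (fun x => p x * (φ x * ⟪v x, outwardNormal Ω x⟫))
      =ᵐ[(μHE[k] : Measure (Space (k + 1))).restrict Γv] fun x => φ x * p x * vn x := by
    filter_upwards [hvbc] with x hx
    rw [hx]; ring
  rw [← hu, integrableOn_union] at hint
  refine ⟨hint.2.congr_fun_ae e1, hint.1.congr_fun_ae e2, ?_⟩
  have := setIntegral_union (disjoint_iff_inter_eq_empty.2 hi) hp hint.1 hint.2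
  rw [hu] at this
  rw [this, integral_congr_ae e1, integral_congr_ae e2, add_comm]
  rfl

/-! ### Coupling of the two networks and reciprocity -/

theorem IsRegular.integrableOn_mul {d : ℕ} {Ω : Set (Space d)} (hΩ : IsOpen Ω)
    (hbdd : Bornology.IsBounded Ω) {φ₁ φ₂ : Space d → ℝ} {v₁ v₂ : Space d → Space d}
    {p₁ p₂ : Space d → ℝ} (h₁ : IsRegular Ω φ₁ v₁ p₁) (h₂ : IsRegular Ω φ₂ v₂ p₂) :
    IntegrableOn (fun x => p₁ x * p₂ x) Ω := by
  have hΩm := hΩ.measurableSet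
  obtain ⟨C₁, hC₁⟩ := h₁.bounded_pressure
  obtain ⟨C₂, hC₂⟩ := h₂.bounded_pressure
  have hm := fun {φ v p} (h : IsRegular Ω φ v p) =>
    h.differentiable_pressure.continuousOn.aestronglyMeasurable (μ := volume) hΩm
  refine (integrableOn_const (C := C₁ * C₂) hbdd.measure_lt_top.ne).mono' ((hm h₁).mul (hm h₂)) ?_
  filter_upwards [ae_restrict_mem hΩm] with x hx
  rw [norm_mul, Real.norm_eq_abs, Real.norm_eq_abs]
  exact mul_le_mul (hC₁ x hx) (hC₂ x hx) (abs_nonneg _) ((abs_nonneg _).trans (hC₁ x hx))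

theorem dissipationForm_comm {d : ℕ} {Ω : Set (Space d)} (hΩ : IsOpen Ω) {m : Medium d}
    (hm : m.IsAdmissible Ω) (s s' : Fields d) :
    dissipationForm Ω m s s' = dissipationForm Ω m s' s := by
  unfold dissipationForm
  congr 1
  · congr 1
    · exact setIntegral_congr_fun hΩ.measurableSet fun x hx => by
        rw [real_inner_comm (s.v₁ x)]
        exact inner_drag_comm (hm.permeability₁.symm x hx) _ _ |>.trans (real_inner_comm _ _)
    · exact setIntegral_congr_fun hΩ.measurableSet fun x hx => by
        rw [real_inner_comm (s.v₂ x)]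
        exact inner_drag_comm (hm.permeability₂.symm x hx) _ _ |>.trans (real_inner_comm _ _)
  · congr 1
    ext x
    ring

/-- Add the two network identities, each with force and pressure from `s` and velocity from `s'`.
The exchange contributes `-p₁ χ' + p₂ χ'`, which is `(β/μ) (p₁ - p₂) (p₁' - p₂')`. -/
theorem reciprocalWork_eq_dissipationForm {d : ℕ} (hd : 1 ≤ d) {Ω : Set (Space d)} (hΩ : IsOpen Ω)
    (hbdd : Bornology.IsBounded Ω) (hsmooth : HasPiecewiseSmoothBoundary Ω)
    {P : BoundaryPartition Ω} {m : Medium d} (hm : m.IsAdmissible Ω) {D D' : DataSet d}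
    {s s' : Fields d} (hs : IsSolution Ω P m D s) (hs' : IsSolution Ω P m D' s') :
    ReciprocalWorkConverges Ω P m D s D' s' ∧ DissipationFormConverges Ω m s s' ∧
      reciprocalWork Ω P m D s D' s' = dissipationForm Ω m s s' := by
  obtain ⟨k, rfl⟩ : ∃ k, d = k + 1 := ⟨d - 1, by omega⟩
  have p11 := hs.regular₁.integrableOn_mul hΩ hbdd hs'.regular₁
  have p12 := hs.regular₁.integrableOn_mul hΩ hbdd hs'.regular₂
  have p21 := hs.regular₂.integrableOn_mul hΩ hbdd hs'.regular₁
  have p22 := hs.regular₂.integrableOn_mul hΩ hbdd hs'.regular₂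
  have c1 : IntegrableOn (fun x => s.p₁ x * massTransfer m s' x) Ω :=
    ((p11.sub p12).const_mul (-(m.β / m.μ))).congr (Eventually.of_forall fun x => by
      simp only [massTransfer, Pi.sub_apply]; ring)
  have c2 : IntegrableOn (fun x => s.p₂ x * -massTransfer m s' x) Ω :=
    ((p21.sub p22).const_mul (m.β / m.μ)).congr (Eventually.of_forall fun x => by
      simp only [massTransfer, Pi.sub_apply]; ring)
  have e3 : ∀ x, m.β / m.μ * (s.p₁ x - s.p₂ x) * (s'.p₁ x - s'.p₂ x) =
      -(s.p₁ x * massTransfer m s' x) - s.p₂ x * -massTransfer m s' x := fun x => by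
    simp only [massTransfer]; ring
  obtain ⟨f1, d1, id1⟩ := network_identity hΩ hbdd hsmooth hm.porosity₁ hm.permeability₁
    hs.regular₁ hs'.regular₁ hs.memLp_force hs.momentum₁ hs'.mass₁ c1
  obtain ⟨f2, d2, id2⟩ := network_identity hΩ hbdd hsmooth hm.porosity₂ hm.permeability₂
    hs.regular₂ hs'.regular₂ hs.memLp_force hs.momentum₂ hs'.mass₂ c2
  obtain ⟨q1, w1, b1⟩ := boundary_splitting P.union₁ P.inter₁ P.measurable_p₁
    (hs.regular₁.integrableOn_flux hΩ hs'.regular₁) hs'.velocity_bc₁ hs.pressure_bc₁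
  obtain ⟨q2, w2, b2⟩ := boundary_splitting P.union₂ P.inter₂ P.measurable_p₂
    (hs.regular₂.integrableOn_flux hΩ hs'.regular₂) hs'.velocity_bc₂ hs.pressure_bc₂
  refine ⟨⟨f1, q1, w1, f2, q2, w2⟩, ⟨d1, d2, ?_⟩, ?_⟩
  · simp_rw [e3]
    exact c1.neg.sub c2
  · have e4 : ∫ x in Ω, m.β / m.μ * (s.p₁ x - s.p₂ x) * (s'.p₁ x - s'.p₂ x) =
        -(∫ x in Ω, s.p₁ x * massTransfer m s' x) -
          ∫ x in Ω, s.p₂ x * -massTransfer m s' x := by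
      simp_rw [e3]
      have c3 : IntegrableOn (fun x => -(s.p₁ x * massTransfer m s' x)) Ω := c1.neg
      rw [integral_sub c3 c2, integral_neg]
    have g1 : ∀ x, m.α₁ x = drag m.μ m.φ₁ m.K₁ x := fun _ => rfl
    have g2 : ∀ x, m.α₂ x = drag m.μ m.φ₂ m.K₂ x := fun _ => rfl
    rw [reciprocalWork, dissipationForm, e4]
    simp_rw [g1, g2]
    linarith

end DoublePorosity

theorem mainTheorem4 {d : ℕ} (hd : 1 ≤ d) (Ω : Set (DoublePorosity.Space d)) (hΩ : IsOpen Ω)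
    (hbdd : Bornology.IsBounded Ω) (hsmooth : DoublePorosity.HasPiecewiseSmoothBoundary Ω)
    (P : DoublePorosity.BoundaryPartition Ω)
    (m : DoublePorosity.Medium d) (hm : m.IsAdmissible Ω)
    (D' Dstar : DoublePorosity.DataSet d) (s' sstar : DoublePorosity.Fields d)
    (hs' : DoublePorosity.IsSolution Ω P m D' s')
    (hsstar : DoublePorosity.IsSolution Ω P m Dstar sstar) :
    (DoublePorosity.ReciprocalWorkConverges Ω P m D' s' Dstar sstar ∧
      DoublePorosity.ReciprocalWorkConverges Ω P m Dstar sstar D' s' ∧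
      DoublePorosity.DissipationFormConverges Ω m s' sstar) ∧
    DoublePorosity.reciprocalWork Ω P m D' s' Dstar sstar
      = DoublePorosity.reciprocalWork Ω P m Dstar sstar D' s' ∧
    DoublePorosity.reciprocalWork Ω P m D' s' Dstar sstar
      = DoublePorosity.dissipationForm Ω m s' sstar ∧
    DoublePorosity.reciprocalWork Ω P m Dstar sstar D' s'
      = DoublePorosity.dissipationForm Ω m s' sstar := by
  obtain ⟨w, c, e⟩ :=
    DoublePorosity.reciprocalWork_eq_dissipationForm hd hΩ hbdd hsmooth hm hs' hsstar
  -- With the two states exchanged, the work is the same form with its arguments swapped; symmetry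
  -- of the form finishes the proof.
  obtain ⟨w', -, e'⟩ :=
    DoublePorosity.reciprocalWork_eq_dissipationForm hd hΩ hbdd hsmooth hm hsstar hs'
  rw [DoublePorosity.dissipationForm_comm hΩ hm] at e'
  exact ⟨⟨w, w', c⟩, e.trans e'.symm, e, e'⟩
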